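/- Let $F$ be a non-archimedean local field of characteristic $0$ with normalized absolute value $|\cdot|$ and residue field of cardinality $q$. Let $k\ge 1$, $c\ge 2$ and $0<l<c$ be integers, and let $\tau_1,\dots,\tau_k$ be unramified quasi-characters of $F^*$. Fix a nontrivial continuous additive character $\psi$ of $F$ and a Haar measure on $F$; unipotent groups carry the product measures in their matrix entries. Notation. For $b\ge1$ let $P_{(b^k)}=M_{(b^k)}V_{(b^k)}\subset \mathrm{GL}_{kb}(F)$ be the standard parabolic subgroup with $k$ diagonal blocks of size $b$, put $\psi(v)=\psi(\sum_{i<k}\mathrm{tr}\,v_{i,i+1})$ for $v=(v_{i,j})\in V_{(b^k)}$, and let $w_{(b^k)}$ be the permutation matrix with blocks $I_b$ on the anti-diagonal. For $\zeta\in\mathbb C^k$ let $\rho_b(\tau_\zeta)=\mathrm{Ind}_{P_{(b^k)}}^{\mathrm{GL}_{kb}}(\otimes_i|\det|^{\zeta_i}\,\tau_i\circ\det)$ (smooth, normalized induction), realized in complex-valued functions. An entire section on $V(\tau,b)$ is a function $\xi(\zeta,g)$ with $\xi(\zeta,\cdot)\in\rho_b(\tau_\zeta)$ for all $\zeta$ and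 $\xi(\cdot,g)\in\mathbb C[q^{\pm\zeta_1},\dots,q^{\pm\zeta_k}]$ for all $g$; a meromorphic section is a function $\xi$ such that $\varphi(\zeta)\xi(\zeta,g)$ is an entire section for some nonzero $\varphi\in\mathbb C[q^{\pm\zeta_1},\dots,q^{\pm\zeta_k}]$. The $(k,b)$ functional on $\rho_b(\tau_\zeta)$ is $$\lambda^{b}_\zeta(f)=\int_{V_{(b^k)}}f(w_{(b^k)}v)\psi^{-1}(v)\,dv,$$ defined by this integral where it is absolutely convergent, in particular on some cone $\mathrm{Re}(\zeta_i-\zeta_{i+1})>R$ $(1\le i<k)$, and by analytic continuation (along entire sections, with values in $\mathbb C[q^{\pm\zeta_1},\dots,q^{\pm\zeta_k}]$) for general $\zeta$. Write $v_{i,j}=\begin{pmatrix}v^1_{i,j}&v^2_{i,j}\\v^3_{i,j}&v^4_{i,j}\end{pmatrix}$ with $v^1_{i,j}\in\mathrm{Mat}_l$, $v^4_{i,j}\in\mathrm{Mat}_{c-l}$ for $v\in V_{(c^k)}$; let $V^2$, resp. $V=V^3$, be the subgroup where only the blocks $v^2_{i,j}$, resp. $v^3_{i,j}$ ($i<j$),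 may be nonzero. Let $\kappa\in\mathrm{GL}_{kc}$ be the permutation matrix whose row $il+a$ ($0\le i<k$, $1\le a\le l$) has its $1$ in column $ic+a$, and whose row $kl+i(c-l)+b$ ($1\le b\le c-l$) has its $1$ in column $ic+l+b$. Put $h=\mathrm{diag}(w_{(l^k)},w_{((c-l)^k)})\kappa$, $Z=hV^2h^{-1}$ (with the measure of $V^2$), and $m(\zeta,\kappa)\xi(\zeta,g)=\int_Z\xi(\zeta,\kappa^{-1}zg)\,dz$. With $P=P_{(kl,k(c-l))}$, for $f$ in $$I(\zeta)=\mathrm{Ind}_{P}^{\mathrm{GL}_{kc}}\big((\rho_l(\tau_\zeta)\otimes\rho_{c-l}(\tau_\zeta))\,\delta_{P}^{-1/(2k)}\big)$$ let $(\lambda^l_\zeta\otimes\lambda^{c-l}_\zeta)f$ be the function on $\mathrm{GL}_{kc}$ obtained by applying $\lambda^l_\zeta$ and $\lambda^{c-l}_\zeta$ to the two factors of the values of $f$. Lemma. There is a real number $R$, depending only on $F,k,c,l$ and the $\tau_i$, such that the following hold. (1) The integral $\int_{V_{(c^k)}}f(w_{(c^k)}v)\psi^{-1}(v)\,dv$ is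 absolutely convergent for all $f\in\rho_c(\tau_\zeta)$ whenever $\mathrm{Re}(\zeta_i-\zeta_{i+1})>R$ for all $1\le i<k$. For every $\zeta$ such that it is absolutely convergent for all $f\in\rho_c(\tau_\zeta)$, and every such $f$, the integral $m(\zeta,\kappa)f(g)$ is absolutely convergent for all $g$ and $m(\zeta,\kappa)f\in I(\zeta)$; the double integral over $V_{(l^k)}\times V_{((c-l)^k)}$ defining $(\lambda^l_\zeta\otimes\lambda^{c-l}_\zeta)\,m(\zeta,\kappa)f$ is absolutely convergent at all $g$; and $$\int_{V_{(c^k)}}f(w_{(c^k)}v)\psi^{-1}(v)\,dv=\int_V\big((\lambda^l_\zeta\otimes\lambda^{c-l}_\zeta)\,m(\zeta,\kappa)f\big)(\kappa v)\,dv,$$ the functionals being given by their integrals and the right-hand side being absolutely convergent. (2) For $b\in\{c,l,c-l\}$ the functional $\lambda^b_\zeta$ is given by its absolutely convergent integral for $\mathrm{Re}(\zeta_i-\zeta_{i+1})>R$ $(1\le i<k)$, and has the analytic continuation described above. For every meromorphic section $\xi$ on $V(\tau,c)$, the integral $m(\zeta,\kappa)\xi(\zeta,g)$, $\mathrm{Re}(\zeta_i-\zeta_{i+1})>R$,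 has a meromorphic continuation to $\mathbb C^k$ with a denominator independent of $g$, and there is a nonzero $D\in\mathbb C[q^{\pm\zeta_1},\dots,q^{\pm\zeta_k}]$, a multiple of this denominator, such that for all $\zeta$ with $D(\zeta)\ne0$: $\xi(\zeta,\cdot)\in\rho_c(\tau_\zeta)$, $m(\zeta,\kappa)\xi(\zeta,\cdot)\in I(\zeta)$, and $$\lambda^c_\zeta(\xi(\zeta,\cdot))=\int_V\big((\lambda^l_\zeta\otimes\lambda^{c-l}_\zeta)\,m(\zeta,\kappa)\xi(\zeta,\cdot)\big)(\kappa v)\,dv,$$ where the integral over $V$ is absolutely convergent. -/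

import Mathlib

open MeasureTheory
open scoped NormedField Valued

namespace KC

/-! ### The field -/

section Field

variable (F : Type*) [NontriviallyNormedField F] [IsUltrametricDist F]

/-- The cardinality `q` of the residue field. -/
noncomputable def residueCard : ℕ := Nat.card 𝓀[F]

/-- The absolute value of `F` is the normalized one: a uniformizer has absolute value `q⁻¹`. -/
def IsNormalizedAbs : Prop :=
  ∀ ϖ : 𝒪[F], Irreducible ϖ → ‖(ϖ : F)‖ = (residueCard F : ℝ)⁻¹

end Field

/-! ### Matrices

Rows and columns of elements of `GL_{kc}` are indexed by `Fin (k * c)`; the bijection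
`finProdFinEquiv : Fin k × Fin c ≃ Fin (k * c)`, `(i, α) ↦ α + c * i`, is the division into `k`
consecutive blocks of size `c`. -/

section Matrices

variable {F : Type*} [NontriviallyNormedField F]

/-- Pairs `i < j` of block indices. -/
abbrev Pair (k : ℕ) : Type := {p : Fin k × Fin k // p.1 < p.2}

/-- Coordinates `(v_{i,j})_{i<j}`, each `v_{i,j}` a matrix of size `a × b` over `F`. -/
abbrev Coord (k a b : ℕ) (F : Type*) : Type _ := Pair k × Fin a × Fin b → F

/-- The strictly upper triangular `k × k` block matrix with blocks `v_{i,j}`, `i < j`. -/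
def strictUpper {k a b : ℕ} (v : Coord k a b F) : Matrix (Fin k × Fin a) (Fin k × Fin b) F :=
  Matrix.of fun s t => if h : s.1 < t.1 then v (⟨(s.1, t.1), h⟩, s.2, t.2) else 0

theorem det_one_add_strictUpper {k c : ℕ} (v : Coord k c c F) :
    (1 + strictUpper v).det = 1 := by
  have h : (1 + strictUpper v).BlockTriangular (Prod.fst : Fin k × Fin c → Fin k) := by
    intro s t hst
    have h1 : s ≠ t := by rintro rfl; exact lt_irrefl _ hst
    simp [strictUpper, Matrix.one_apply_ne h1, not_lt.2 hst.le]
  rw [h.det_fintype]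
  refine Finset.prod_eq_one fun i _ => ?_
  have : (1 + strictUpper v).toSquareBlock Prod.fst i = 1 := by
    ext s t
    have : ¬ (s.1.1 < t.1.1) := by rw [s.2, t.2]; exact lt_irrefl _
    simp [Matrix.toSquareBlock_def, strictUpper, this, Matrix.one_apply, Subtype.ext_iff]
  rw [this, Matrix.det_one]

/-- The element `v` of the unipotent group `V_{(c^k)} < GL_{kc}` with coordinates `v_{i,j}`. -/
noncomputable def unip {k c : ℕ} (v : Coord k c c F) : GL (Fin (k * c)) F :=
  Matrix.GeneralLinearGroup.mkOfDetNeZero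
    ((1 + strictUpper v).submatrix finProdFinEquiv.symm finProdFinEquiv.symm)
    (by rw [Matrix.det_submatrix_equiv_self, det_one_add_strictUpper]; exact one_ne_zero)

/-- The block diagonal matrix `diag(g_1, …, g_k)` in the Levi subgroup `M_{(c^k)}`. -/
def levi {k c : ℕ} (g : Fin k → GL (Fin c) F) : GL (Fin (k * c)) F where
  val := (Matrix.blockDiagonal fun i => (g i).val).submatrix
    (finProdFinEquiv.symm.trans (Equiv.prodComm _ _))
    (finProdFinEquiv.symm.trans (Equiv.prodComm _ _))
  inv := (Matrix.blockDiagonal fun i => (g i)⁻¹.val).submatrix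
    (finProdFinEquiv.symm.trans (Equiv.prodComm _ _))
    (finProdFinEquiv.symm.trans (Equiv.prodComm _ _))
  val_inv := by
    rw [Matrix.submatrix_mul_equiv, ← Matrix.blockDiagonal_mul]
    simp only [Units.mul_inv]
    exact (congrArg (fun A : Matrix (Fin c × Fin k) (Fin c × Fin k) F => A.submatrix _ _)
      Matrix.blockDiagonal_one).trans (Matrix.submatrix_one_equiv _)
  inv_val := by
    rw [Matrix.submatrix_mul_equiv, ← Matrix.blockDiagonal_mul]
    simp only [Units.inv_mul]
    exact (congrArg (fun A : Matrix (Fin c × Fin k) (Fin c × Fin k) F => A.submatrix _ _)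
      Matrix.blockDiagonal_one).trans (Matrix.submatrix_one_equiv _)

/-- The permutation matrix with entry `1` in row `i` and column `σ i`. -/
def permGL {n : ℕ} (σ : Equiv.Perm (Fin n)) : GL (Fin n) F where
  val := σ.permMatrix F
  inv := (σ⁻¹).permMatrix F
  val_inv := by rw [← Matrix.permMatrix_mul]; simp
  inv_val := by rw [← Matrix.permMatrix_mul]; simp

/-- The permutation `(i, α) ↦ (k - 1 - i, α)` of block indices. -/
def weylPerm (k c : ℕ) : Equiv.Perm (Fin (k * c)) :=
  (finProdFinEquiv.symm.trans (Fin.revPerm.prodCongr (Equiv.refl (Fin c)))).trans finProdFinEquiv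

/-- `w_{(c^k)}`: identity blocks `I_c` on the anti-diagonal. -/
def weyl (k c : ℕ) : GL (Fin (k * c)) F := permGL (weylPerm k c)

/-- The division of `k(l+r)` indices into the first `kl` and the last `kr`. -/
def splitEquiv (k l r : ℕ) : Fin (k * l) ⊕ Fin (k * r) ≃ Fin (k * (l + r)) :=
  finSumFinEquiv.trans (finCongr (Nat.mul_add k l r).symm)

/-- Row `(i, α)` among the first `kl` rows goes to column `i(l+r) + α`; row `(i, β)` among the
last `kr` rows goes to column `i(l+r) + l + β`. -/
def kappaPerm (k l r : ℕ) : Equiv.Perm (Fin (k * (l + r))) :=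
  (splitEquiv k l r).symm.trans <|
    (Equiv.sumCongr finProdFinEquiv.symm finProdFinEquiv.symm).trans <|
      (Equiv.prodSumDistrib (Fin k) (Fin l) (Fin r)).symm.trans <|
        ((Equiv.refl (Fin k)).prodCongr finSumFinEquiv).trans finProdFinEquiv

/-- The permutation matrix `κ = κ_{l,r}`, `r = c - l`. -/
def kappa (k l r : ℕ) : GL (Fin (k * (l + r))) F := permGL (kappaPerm k l r)

/-- The matrix of size `k(l+r)` with blocks of sizes `kl` and `kr`. -/
def assemble {k l r : ℕ} (A : Matrix (Fin (k * l)) (Fin (k * l)) F)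
    (B : Matrix (Fin (k * l)) (Fin (k * r)) F) (C : Matrix (Fin (k * r)) (Fin (k * l)) F)
    (D : Matrix (Fin (k * r)) (Fin (k * r)) F) :
    Matrix (Fin (k * (l + r))) (Fin (k * (l + r))) F :=
  (Matrix.fromBlocks A B C D).submatrix (splitEquiv k l r).symm (splitEquiv k l r).symm

theorem assemble_mul {k l r : ℕ} (A A' : Matrix (Fin (k * l)) (Fin (k * l)) F)
    (B B' : Matrix (Fin (k * l)) (Fin (k * r)) F) (D D' : Matrix (Fin (k * r)) (Fin (k * r)) F) :
    assemble A B 0 D * assemble A' B' 0 D' = assemble (A * A') (A * B' + B * D') 0 (D * D') := by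
  simp [assemble, Matrix.submatrix_mul_equiv, Matrix.fromBlocks_multiply]

theorem assemble_one {k l r : ℕ} :
    assemble (F := F) (k := k) (l := l) (r := r) 1 0 0 1 = 1 := by
  simp [assemble]

/-- `diag(a, d)` in the Levi subgroup of `P_{(kl, kr)}`. -/
def diagGL {k l r : ℕ} (a : GL (Fin (k * l)) F) (d : GL (Fin (k * r)) F) :
    GL (Fin (k * (l + r))) F where
  val := assemble a.val 0 0 d.val
  inv := assemble a⁻¹.val 0 0 d⁻¹.val
  val_inv := by rw [assemble_mul]; simp [assemble_one]
  inv_val := by rw [assemble_mul]; simp [assemble_one]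

/-- The element of the unipotent radical `V_{(kl, kr)}` with top right block `B`. -/
def radicalGL {k l r : ℕ} (B : Matrix (Fin (k * l)) (Fin (k * r)) F) :
    GL (Fin (k * (l + r))) F where
  val := assemble 1 B 0 1
  inv := assemble 1 (-B) 0 1
  val_inv := by rw [assemble_mul]; simp [assemble_one]
  inv_val := by rw [assemble_mul]; simp [assemble_one]

/-- The coordinates in `V_{((l+r)^k)}` with
`v_{i,j} = (v_{i,j}^1, v_{i,j}^2; v_{i,j}^3, v_{i,j}^4)`. -/
def blockCoord {k l r : ℕ} (v1 : Coord k l l F) (v2 : Coord k l r F) (v3 : Coord k r l F)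
    (v4 : Coord k r r F) : Coord k (l + r) (l + r) F := fun t =>
  Matrix.fromBlocks (Matrix.of fun α β => v1 (t.1, α, β)) (Matrix.of fun α β => v2 (t.1, α, β))
    (Matrix.of fun α β => v3 (t.1, α, β)) (Matrix.of fun α β => v4 (t.1, α, β))
    (finSumFinEquiv.symm t.2.1) (finSumFinEquiv.symm t.2.2)

/-- Elements of the subgroup `V = V³`. -/
noncomputable def vThree {k l r : ℕ} (v : Coord k r l F) : GL (Fin (k * (l + r))) F :=
  unip (blockCoord 0 0 v 0)

/-- Elements of `Z = ^{(diag(w_{(l^k)}, w_{(r^k)}) κ)} V²`, through the coordinates of `V²`. -/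
noncomputable def zElt {k l r : ℕ} (v : Coord k l r F) : GL (Fin (k * (l + r))) F :=
  (diagGL (weyl k l) (weyl k r) * kappa k l r) * unip (blockCoord 0 v 0 0) *
    (diagGL (weyl k l) (weyl k r) * kappa k l r)⁻¹

end Matrices

/-! ### Induced spaces -/

section Induced

variable {F : Type*} [NontriviallyNormedField F]

/-- The absolute value of the determinant. -/
noncomputable def absDet {n : ℕ} (g : GL (Fin n) F) : ℝ := ‖g.val.det‖

/-- Right invariance under an open subgroup. -/
def IsSmooth {n : ℕ} (f : GL (Fin n) F → ℂ) : Prop :=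
  ∃ K : Subgroup (GL (Fin n) F), IsOpen (K : Set (GL (Fin n) F)) ∧ ∀ g, ∀ h ∈ K, f (g * h) = f g

/-- The modulus character of `P_{(c^k)}` at `diag(g_1, …, g_k)`: the change of measure under
conjugation on the blocks `v_{i,j}`, `i < j`, of `V_{(c^k)}`. -/
noncomputable def deltaP {k c : ℕ} (g : Fin k → GL (Fin c) F) : ℝ :=
  ∏ p : Pair k, (absDet (g p.1.1) / absDet (g p.1.2)) ^ c

/-- The modulus character of `P_{(kl, kr)}` at `diag(a, d)`. -/
noncomputable def deltaTwo {k l r : ℕ} (a : GL (Fin (k * l)) F) (d : GL (Fin (k * r)) F) : ℝ :=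
  absDet a ^ (k * r) / absDet d ^ (k * l)

/-- `δ_{P_{(c^k)}}^{1/2} · ⊗_i |det|^{ζ_i} (τ_i ∘ det)` at `diag(g_1, …, g_k)`. -/
noncomputable def inducingChar {k c : ℕ} (τ : Fin k → (Fˣ →* ℂˣ)) (ζ : Fin k → ℂ)
    (g : Fin k → GL (Fin c) F) : ℂ :=
  ((deltaP g ^ (1 / 2 : ℝ) : ℝ) : ℂ) *
    ∏ i, ((absDet (g i) : ℂ) ^ ζ i * (τ i (Matrix.GeneralLinearGroup.det (g i)) : ℂ))

/-- The space `V(ζ, τ, c)` of `ρ_c(τ_ζ) = Ind_{P_{(c^k)}}^{GL_{kc}} (⊗_i |det|^{ζ_i} τ_i ∘ det)`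
(smooth normalized induction). -/
def rhoSpace {k : ℕ} (c : ℕ) (τ : Fin k → (Fˣ →* ℂˣ)) (ζ : Fin k → ℂ) :
    Set (GL (Fin (k * c)) F → ℂ) :=
  {f | IsSmooth f ∧ ∀ (m : Fin k → GL (Fin c) F) (u : Coord k c c F) (g : GL (Fin (k * c)) F),
    f (levi m * unip u * g) = inducingChar τ ζ m * f g}

/-- The space of
`Ind_{P_{(kl, kr)}}^{GL_{k(l+r)}} ((ρ_l(τ_ζ) ⊗ ρ_r(τ_ζ)) δ_{P_{(kl, kr)}}^{-1/(2k)})`,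
realized in complex-valued functions on `GL_{k(l+r)}` by evaluating the inducing functions at the
identity (smooth normalized induction, induction in stages). -/
def twoStepSpace {k : ℕ} (l r : ℕ) (τ : Fin k → (Fˣ →* ℂˣ)) (ζ : Fin k → ℂ) :
    Set (GL (Fin (k * (l + r))) F → ℂ) :=
  {f | IsSmooth f ∧ ∀ (m₁ : Fin k → GL (Fin l) F) (u₁ : Coord k l l F)
      (m₂ : Fin k → GL (Fin r) F) (u₂ : Coord k r r F)
      (B : Matrix (Fin (k * l)) (Fin (k * r)) F) (g : GL (Fin (k * (l + r))) F),
    f (diagGL (levi m₁ * unip u₁) (levi m₂ * unip u₂) * radicalGL B * g) =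
      ((deltaTwo (levi m₁ * unip u₁) (levi m₂ * unip u₂) ^ (1 / 2 - 1 / (2 * (k : ℝ))) : ℝ) : ℂ) *
        inducingChar τ ζ m₁ * inducingChar τ ζ m₂ * f g}

/-- For `f` in the induced space above, the value of `f` at `g` is the vector
`(a, d) ↦ δ^{-(1/2 - 1/(2k))}(diag(a, d)) f(diag(a, d) g)` of `ρ_l(τ_ζ) ⊗ ρ_r(τ_ζ)`. -/
noncomputable def fibre {k l r : ℕ} (f : GL (Fin (k * (l + r))) F → ℂ)
    (g : GL (Fin (k * (l + r))) F) (a : GL (Fin (k * l)) F) (d : GL (Fin (k * r)) F) : ℂ :=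
  ((deltaTwo a d ^ (-(1 / 2 - 1 / (2 * (k : ℝ)))) : ℝ) : ℂ) * f (diagGL a d * g)

/-- Application of functionals `lam₁` on `ρ_l(τ_ζ)` and `lam₂` on `ρ_r(τ_ζ)` to the two factors:
the function `g ↦ (lam₁ ⊗ lam₂)(f(g))`. -/
noncomputable def applyFactors {k l r : ℕ} (lam₁ : (GL (Fin (k * l)) F → ℂ) → ℂ)
    (lam₂ : (GL (Fin (k * r)) F → ℂ) → ℂ) (f : GL (Fin (k * (l + r))) F → ℂ)
    (g : GL (Fin (k * (l + r))) F) : ℂ :=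
  lam₁ fun a => lam₂ fun d => fibre f g a d

end Induced

/-! ### Sections -/

section Sections

variable (F : Type*) [NontriviallyNormedField F] [IsUltrametricDist F]

/-- `ℂ[q^{±ζ_1}, …, q^{±ζ_k}]` as functions of `ζ`. -/
noncomputable def entireFun (k : ℕ) : Subalgebra ℂ ((Fin k → ℂ) → ℂ) :=
  Algebra.adjoin ℂ
    ((Set.range fun i : Fin k => fun ζ : Fin k → ℂ => (residueCard F : ℂ) ^ ζ i) ∪
      (Set.range fun i : Fin k => fun ζ : Fin k → ℂ => (residueCard F : ℂ) ^ (-ζ i)))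

variable {F}

/-- Entire sections on `V(τ, c)`. -/
def IsEntireSection {k : ℕ} (c : ℕ) (τ : Fin k → (Fˣ →* ℂˣ))
    (ξ : (Fin k → ℂ) → GL (Fin (k * c)) F → ℂ) : Prop :=
  (∀ ζ, ξ ζ ∈ rhoSpace c τ ζ) ∧ ∀ g, (fun ζ => ξ ζ g) ∈ entireFun F k

/-- Meromorphic sections on `V(τ, c)`. -/
def IsMeromorphicSection {k : ℕ} (c : ℕ) (τ : Fin k → (Fˣ →* ℂˣ))
    (ξ : (Fin k → ℂ) → GL (Fin (k * c)) F → ℂ) : Prop :=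
  ∃ φ ∈ entireFun F k, φ ≠ 0 ∧ IsEntireSection c τ fun ζ g => φ ζ * ξ ζ g

end Sections

/-! ### Integrals -/

section Integrals

/-- The cone `Re ζ_1 ≫ … ≫ Re ζ_k` with constant `R`. -/
def cone (k : ℕ) (R : ℝ) : Set (Fin k → ℂ) :=
  {ζ | ∀ i j : Fin k, (i : ℕ) + 1 = j → R < (ζ i - ζ j).re}

variable {F : Type*} [NontriviallyNormedField F] [MeasurableSpace F]

/-- `dv = ∏ dv_{i,j}`, the product of the measure `μ` on `F` over all entries. -/
noncomputable def coordMeasure (μ : Measure F) (k a b : ℕ) : Measure (Coord k a b F) :=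
  Measure.pi fun _ => μ

/-- The character `ψ(v) = ψ(∑_i tr(v_{i,i+1}))` of `V_{(c^k)}`. -/
noncomputable def psiV {k c : ℕ} (ψ : AddChar F Circle) (v : Coord k c c F) : Circle :=
  ψ (∑ p : Pair k, if (p.1.1 : ℕ) + 1 = p.1.2 then ∑ α, v (p, α, α) else 0)

/-- The integrand `v ↦ f(w_{(c^k)} v) ψ⁻¹(v)` on `V_{(c^k)}`. -/
noncomputable def jacquetIntegrand {k c : ℕ} (ψ : AddChar F Circle)
    (f : GL (Fin (k * c)) F → ℂ) (v : Coord k c c F) : ℂ :=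
  f (weyl k c * unip v) * (((psiV ψ v)⁻¹ : Circle) : ℂ)

/-- `∫_{V_{(c^k)}} f(w_{(c^k)} v) ψ⁻¹(v) dv`. -/
noncomputable def jacquetIntegral {k c : ℕ} (ψ : AddChar F Circle) (μ : Measure F)
    (f : GL (Fin (k * c)) F → ℂ) : ℂ :=
  ∫ v, jacquetIntegrand ψ f v ∂(coordMeasure μ k c c)

/-- The domain of absolute convergence of the integral above on `ρ_c(τ_ζ)`. -/
def convergenceDomain {k : ℕ} (c : ℕ) (τ : Fin k → (Fˣ →* ℂˣ)) (ψ : AddChar F Circle)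
    (μ : Measure F) : Set (Fin k → ℂ) :=
  {ζ | ∀ f ∈ rhoSpace c τ ζ, Integrable (jacquetIntegrand ψ f) (coordMeasure μ k c c)}

/-- The integral `m(ζ, κ) f (g) = ∫_Z f(κ⁻¹ z g) dz`. -/
noncomputable def mIntegral {k l r : ℕ} (μ : Measure F) (f : GL (Fin (k * (l + r))) F → ℂ)
    (g : GL (Fin (k * (l + r))) F) : ℂ :=
  ∫ z, f ((kappa k l r)⁻¹ * zElt z * g) ∂(coordMeasure μ k l r)

/-- `lam ζ` is, on each `ρ_c(τ_ζ)`, the functional given by `jacquetIntegral` on the cone with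
constant `R`, and by analytic continuation for general `ζ`. -/
def IsJacquetContinuation [IsUltrametricDist F] {k : ℕ} (c : ℕ) (τ : Fin k → (Fˣ →* ℂˣ))
    (ψ : AddChar F Circle) (μ : Measure F) (R : ℝ)
    (lam : (Fin k → ℂ) → (GL (Fin (k * c)) F → ℂ) →ₗ[ℂ] ℂ) : Prop :=
  cone k R ⊆ convergenceDomain c τ ψ μ ∧
  (∀ ζ ∈ cone k R, ∀ f ∈ rhoSpace c τ ζ, lam ζ f = jacquetIntegral ψ μ f) ∧
  ∀ ξ, IsEntireSection c τ ξ → (fun ζ => lam ζ (ξ ζ)) ∈ entireFun F k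

end Integrals

end KC

namespace KC
open Filter Topology

set_option linter.unusedSectionVars false
set_option linter.style.haveILetI false

/-! ### The field: residue field, normalized absolute value, scaling of Haar measure. -/

section FieldLemmas

variable {F : Type*} [NontriviallyNormedField F] [IsUltrametricDist F] [ProperSpace F]

/-! Write `r` for c - l. Where everything converges, the identity is a change of variables and
Fubini. The group V_{(c^k)} is the product V² · D · V³, with D the κ-conjugate of diag(V_{(l^k)},
V_{(r^k)}). Multiplication is a measure preserving parametrization and ψ sees only D
(`measurePreserving_decomposition`). Since diag(w_{(l^k)}, w_{(r^k)}) κ = κ w_{(c^k)}, the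
V²-integral of f(w v ·) is m(ζ, κ)f, the D-integral with ψ⁻¹ is λ^l ⊗ λ^r, and the V³-integral is
the outer one. Fubini controls almost every slice only; since f is smooth, a slice at a given point
agrees with slices at nearby points, so convergence holds everywhere (`exists_near_of_ae`). That
m(ζ, κ)f lies in I(ζ) follows by moving the parabolic across κ⁻¹Zκ = w V² w⁻¹. The Jacobian of this
move produces the twist δ^{-1/(2k)} (`modulus_identity`).

Convergence on a cone, and the continuation of m(ζ, κ), come from rank one. Both w V w⁻¹ and κ⁻¹Zκ
are spanned by the root groups at the inversions of a permutation, so an integral over either is a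
succession of integrals along adjacent roots (`exists_swapChain`, `exists_chain_coord`). One such
integral is a finite combination of values of f plus a geometric series (`exists_evalSpan_step`).
The series converges when Re(ζ_i - ζ_j) is large for i < j and contributes one denominator 1 -
(character value)·q (`chain_continuation`).

The continuation of λ is Bernstein-style stability. A section of fixed level is unaffected by small
lower triangular shears of v, while ψ changes under them by a character which is nontrivial as soon
as a block column of v is large. Averaging over the shears kills the contribution of large v
(`exists_colStable`). Thus on functions of a given level the Jacquet integral, taken over growing
boxes, is a finite combination of evaluations not depending on ζ (`exists_jacquetFunctional`). A
single linear functional therefore serves for all ζ, and it has Laurent polynomial values along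
entire sections.

To reach general ζ, an entire section has one level for all ζ, by Baire (`exists_uniform_rInv`). The
integrand over V is supported in a bounded set depending only on this level
(`exists_bound_support`), so the V-integral is again a finite combination of evaluations. After
multiplication by the denominator of m(ζ, κ) both sides are Laurent polynomials in the q^{ζ_i}; they
agree on an open cone, hence everywhere (`entireFun_ext`). -/

theorem compactSpace_integer : CompactSpace 𝒪[F] := by
  have h : IsCompact {x : F | x ∈ 𝒪[F]} := by
    convert! isCompact_closedBall (0 : F) 1
    ext x
    simp [Valued.integer.mem_iff]
  exact isCompact_iff_compactSpace.1 h

theorem isNontrivial_valuation :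
    (Valued.v : Valuation F _).IsNontrivial := by
  obtain ⟨x, h0, h1⟩ := NormedField.exists_norm_lt_one F
  refine ⟨x, by simpa using h0, ?_⟩
  intro h
  have : ‖x‖ = 1 := by
    have h2 : (NormedField.valuation x : NNReal) = 1 := h
    have := congrArg (fun t : NNReal => (t : ℝ)) h2
    simpa using! this
  linarith

theorem isDiscreteValuationRing_integer : IsDiscreteValuationRing 𝒪[F] := by
  haveI := compactSpace_integer (F := F)
  haveI := isNontrivial_valuation (F := F)
  exact Valued.integer.isDiscreteValuationRing_of_compactSpace

theorem finite_residueField : Finite 𝓀[F] := by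
  haveI := compactSpace_integer (F := F)
  haveI := isDiscreteValuationRing_integer (F := F)
  obtain ⟨p, hp⟩ := IsDiscreteValuationRing.exists_irreducible 𝒪[F]
  have hpos : 0 < ‖p‖ := Valued.integer.norm_irreducible_pos hp
  -- Closed balls of radius `‖p‖` are the cosets of the maximal ideal, so the centres of a finite
  -- subcover represent all residue classes.
  obtain ⟨t, -, ht⟩ := (isCompact_univ (X := 𝒪[F])).elim_nhds_subcover
    (fun x => Metric.closedBall x ‖p‖) fun x _ => Metric.closedBall_mem_nhds x hpos
  refine Set.finite_univ_iff.1 ((t.finite_toSet.image (IsLocalRing.residue 𝒪[F])).subset ?_)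
  intro y _
  obtain ⟨x, rfl⟩ := IsLocalRing.residue_surjective y
  have hx := ht (Set.mem_univ x)
  simp only [Set.mem_iUnion, exists_prop] at hx
  obtain ⟨z, hz, hxz⟩ := hx
  refine ⟨z, hz, ?_⟩
  rw [← sub_eq_zero, ← map_sub, IsLocalRing.residue_eq_zero_iff, ← SetLike.mem_coe,
    hp.maximalIdeal_eq_closedBall]
  simpa [dist_eq_norm, norm_sub_rev] using hxz

theorem one_lt_residueCard : 1 < residueCard F := by
  haveI := finite_residueField (F := F)
  exact Finite.one_lt_card

theorem residueCard_pos : (0 : ℝ) < residueCard F := by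
  exact_mod_cast (zero_lt_one.trans (one_lt_residueCard (F := F)))

theorem exists_uniformizer (hF : IsNormalizedAbs F) :
    ∃ ϖ : 𝒪[F], Irreducible ϖ ∧ ‖(ϖ : F)‖ = (residueCard F : ℝ)⁻¹ := by
  haveI := isDiscreteValuationRing_integer (F := F)
  obtain ⟨p, hp⟩ := IsDiscreteValuationRing.exists_irreducible 𝒪[F]
  exact ⟨p, hp, hF p hp⟩

theorem exists_norm_eq_zpow (hF : IsNormalizedAbs F) {x : F} (hx : x ≠ 0) :
    ∃ n : ℤ, ‖x‖ = (residueCard F : ℝ) ^ n := by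
  haveI := isDiscreteValuationRing_integer (F := F)
  obtain ⟨p, hp, hpn⟩ := exists_uniformizer hF
  have key : ∀ y : F, y ≠ 0 → ‖y‖ ≤ 1 → ∃ n : ℤ, ‖y‖ = (residueCard F : ℝ) ^ n := by
    intro y hy hy1
    obtain ⟨n, u, hu⟩ := IsDiscreteValuationRing.eq_unit_mul_pow_irreducible
      (x := (⟨y, Valued.integer.mem_iff.2 hy1⟩ : 𝒪[F])) (by simpa [Subtype.ext_iff] using hy) hp
    refine ⟨-n, ?_⟩
    have := congrArg (fun z : 𝒪[F] => ‖(z : F)‖) hu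
    simp only [MulMemClass.coe_mul, SubmonoidClass.coe_pow, norm_mul, norm_pow, hpn,
      Valued.integer.norm_coe_unit] at this
    simp [this]
  rcases le_total ‖x‖ 1 with h | h
  · exact key x hx h
  · obtain ⟨n, hn⟩ := key x⁻¹ (inv_ne_zero hx) (by rw [norm_inv]; exact inv_le_one_of_one_le₀ h)
    exact ⟨-n, by rw [zpow_neg, ← hn, norm_inv, inv_inv]⟩

/-- The exponent `n` with `‖x‖ = q ^ n`. -/
noncomputable def deg (x : F) : ℤ := Int.log (residueCard F) ‖x‖

theorem deg_eq {x : F} {n : ℤ} (h : ‖x‖ = (residueCard F : ℝ) ^ n) : deg x = n := by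
  rw [deg, h, Int.log_zpow one_lt_residueCard]

theorem norm_eq_zpow_deg (hF : IsNormalizedAbs F) {x : F} (hx : x ≠ 0) :
    ‖x‖ = (residueCard F : ℝ) ^ deg x := by
  obtain ⟨n, hn⟩ := exists_norm_eq_zpow hF hx
  rw [deg_eq hn, hn]

theorem deg_inv (hF : IsNormalizedAbs F) {x : F} (hx : x ≠ 0) : deg x⁻¹ = - deg x := by
  refine deg_eq ?_
  rw [norm_inv, norm_eq_zpow_deg hF hx, zpow_neg]

theorem exists_norm_eq (hF : IsNormalizedAbs F) (n : ℤ) :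
    ∃ x : F, x ≠ 0 ∧ ‖x‖ = (residueCard F : ℝ) ^ n := by
  obtain ⟨p, hp, hpn⟩ := exists_uniformizer hF
  have h0 : (p : F) ≠ 0 := by
    intro h; rw [h, norm_zero] at hpn
    exact (inv_pos.2 (residueCard_pos (F := F))).ne hpn
  exact ⟨(p : F) ^ (-n), zpow_ne_zero _ h0, by rw [norm_zpow, hpn, inv_zpow, zpow_neg, inv_inv]⟩

variable [MeasurableSpace F] [BorelSpace F] (μ : Measure F) [μ.IsAddHaarMeasure]

-- The unit ball is a disjoint union of `q` translates of the maximal ideal, which is the ball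
-- scaled by `p`; the index formula is applied to the restriction of `μ` to the ring of integers.
open Pointwise in
theorem measure_smul_uniformizer {p : 𝒪[F]} (hp : Irreducible p) :
    (residueCard F : ENNReal) * μ ((p : F) • Metric.closedBall (0 : F) 1) =
      μ (Metric.closedBall 0 1) := by
  haveI := isDiscreteValuationRing_integer (F := F)
  haveI := finite_residueField (F := F)
  let f : 𝒪[F] →+ F := (𝒪[F]).subtype.toAddMonoidHom
  have hf : MeasurableEmbedding f :=
    MeasurableEmbedding.subtype_coe (s := {x | x ∈ 𝒪[F]}) (by
      convert! (Metric.isClosed_closedBall (x := (0 : F)) (ε := 1)).measurableSet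
      ext x
      simp [Valued.integer.mem_iff])
  have hinv : (μ.comap f).IsAddLeftInvariant := by
    refine ⟨fun g => ?_⟩
    ext s hs
    rw [Measure.map_apply (measurable_const_add g) hs, hf.comap_apply, hf.comap_apply]
    rw [← measure_preimage_add μ (f g) (f '' s)]
    congr 1
    ext x
    constructor
    · rintro ⟨y, hy, rfl⟩
      exact ⟨g + y, hy, by simp⟩
    · rintro ⟨y, hy, hxy⟩
      exact ⟨-g + y, by simpa using hy, by simp [hxy]⟩
  haveI hfin : (IsLocalRing.maximalIdeal 𝒪[F]).toAddSubgroup.FiniteIndex := by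
    have h : Finite (𝒪[F] ⧸ (IsLocalRing.maximalIdeal 𝒪[F]).toAddSubgroup) := finite_residueField (F := F)
    exact AddSubgroup.finiteIndex_of_finite_quotient
  have h1 := AddSubgroup.index_mul_measure (IsLocalRing.maximalIdeal 𝒪[F]).toAddSubgroup ?_ (μ.comap f)
  · have h2 : (IsLocalRing.maximalIdeal 𝒪[F]).toAddSubgroup.index = residueCard F := rfl
    rw [h2, hf.comap_apply, hf.comap_apply] at h1
    convert! h1 using 2
    · congr 1
      ext x
      constructor
      · rintro ⟨y, hy, rfl⟩
        refine ⟨p * ⟨y, Valued.integer.mem_iff.2 (by simpa using hy)⟩, ?_, rfl⟩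
        exact Ideal.mul_mem_right _ _ (by rw [hp.maximalIdeal_eq]; exact Ideal.mem_span_singleton_self p)
      · rintro ⟨y, hy, rfl⟩
        have : y ∈ IsLocalRing.maximalIdeal 𝒪[F] := hy
        rw [hp.maximalIdeal_eq, Ideal.mem_span_singleton'] at this
        obtain ⟨z, rfl⟩ := this
        exact ⟨z, by simpa using Valued.integer.norm_le_one z, mul_comm (p : F) z⟩
    · ext x
      constructor
      · intro hx
        exact ⟨⟨x, Valued.integer.mem_iff.2 (by simpa using hx)⟩, trivial, rfl⟩
      · rintro ⟨y, -, rfl⟩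
        simpa using! Valued.integer.norm_le_one y
  · have : ((IsLocalRing.maximalIdeal 𝒪[F]).toAddSubgroup : Set 𝒪[F]) = Metric.closedBall 0 ‖p‖ :=
      hp.maximalIdeal_eq_closedBall
    rw [this]
    exact Metric.isClosed_closedBall.measurableSet

-- Both sides are multiplicative. They agree on elements of norm one, which preserve the unit ball,
-- and on a uniformizer; a power of the uniformizer brings any `x` to norm one.
open Pointwise in
theorem distribHaarChar_eq_norm (hF : IsNormalizedAbs F) (x : Fˣ) :
    (distribHaarChar F x : ℝ) = ‖(x : F)‖ := by
  haveI := isDiscreteValuationRing_integer (F := F)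
  borelize F
  let ν : Measure F := Measure.addHaar
  have hb0 : ν (Metric.closedBall 0 1) ≠ 0 := (Metric.measure_closedBall_pos ν 0 one_pos).ne'
  have hb1 : ν (Metric.closedBall 0 1) ≠ ⊤ := (isCompact_closedBall (0 : F) 1).measure_lt_top.ne
  have hu : ∀ u : Fˣ, ‖(u : F)‖ = 1 → distribHaarChar F u = 1 := by
    intro u hu
    refine distribHaarChar_eq_of_measure_smul_eq_mul hb0 hb1 ?_
    rw [ENNReal.coe_one, one_mul]
    congr 1
    ext y
    rw [Set.mem_smul_set_iff_inv_smul_mem]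
    simp [Units.smul_def, hu]
  obtain ⟨p, hp, hpn⟩ := exists_uniformizer hF
  have h0 : (p : F) ≠ 0 := by simpa using hp.ne_zero
  have hpc : (distribHaarChar F (Units.mk0 (p : F) h0) : ℝ) = (residueCard F : ℝ)⁻¹ := by
    have := measure_smul_uniformizer ν hp
    have h2 : distribHaarChar F (Units.mk0 (p : F) h0) = ((residueCard F : NNReal))⁻¹ := by
      refine distribHaarChar_eq_of_measure_smul_eq_mul (μ := ν) hb0 hb1 ?_
      have h3 : (residueCard F : NNReal) ≠ 0 := by
        exact_mod_cast (zero_lt_one.trans (one_lt_residueCard (F := F))).ne'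
      rw [← this, ENNReal.coe_inv h3, ← mul_assoc, ENNReal.coe_natCast, ENNReal.inv_mul_cancel, one_mul]
      · rfl
      · exact_mod_cast h3
      · exact ENNReal.natCast_ne_top _
    rw [h2]; simp
  have hx := norm_eq_zpow_deg hF x.ne_zero
  have h4 : ‖((x * Units.mk0 (p : F) h0 ^ deg (x : F) : Fˣ) : F)‖ = 1 := by
    simp only [Units.val_mul, Units.val_zpow_eq_zpow_val, Units.val_mk0, norm_mul, norm_zpow, hpn]
    rw [hx, inv_zpow, mul_inv_cancel₀]
    exact zpow_ne_zero _ residueCard_pos.ne'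
  have h5 := hu _ h4
  rw [map_mul, map_zpow] at h5
  have h6 := congrArg (fun t : NNReal => (t : ℝ)) h5
  simp only [NNReal.coe_mul, NNReal.coe_zpow, hpc, NNReal.coe_one] at h6
  rw [hx]
  rw [inv_zpow, mul_inv_eq_one₀ (zpow_ne_zero _ residueCard_pos.ne')] at h6
  exact h6

open Pointwise in
theorem measure_preimage_mul_left (hF : IsNormalizedAbs F) {a : F} (ha : a ≠ 0) (s : Set F) :
    ENNReal.ofReal ‖a‖ * μ ((fun x => a * x) ⁻¹' s) = μ s := by
  have h := distribHaarChar_mul μ (Units.mk0 a ha) ((fun x => a * x) ⁻¹' s)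
  have h2 : (Units.mk0 a ha) • ((fun x => a * x) ⁻¹' s) = s := by
    ext x
    rw [Set.mem_smul_set_iff_inv_smul_mem]
    simp [Units.smul_def, ha]
  rw [h2] at h
  rw [← h]
  congr 1
  have h3 := distribHaarChar_eq_norm hF (Units.mk0 a ha)
  rw [Units.val_mk0] at h3
  rw [← h3, ENNReal.ofReal_coe_nnreal]

theorem map_mul_left_eq (hF : IsNormalizedAbs F) {a : F} (ha : a ≠ 0) :
    Measure.map (fun x => a * x) μ = ENNReal.ofReal ‖a‖⁻¹ • μ := by
  ext s hs
  rw [Measure.map_apply (by fun_prop) hs, Measure.smul_apply, smul_eq_mul,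
    ← measure_preimage_mul_left μ hF ha s, ← mul_assoc,
    ← ENNReal.ofReal_mul (by positivity), inv_mul_cancel₀ (norm_ne_zero_iff.2 ha),
    ENNReal.ofReal_one, one_mul]

theorem integral_comp_mul_left (hF : IsNormalizedAbs F) {a : F} (ha : a ≠ 0) (f : F → ℂ) :
    ∫ x, f (a * x) ∂μ = ((‖a‖⁻¹ : ℝ) : ℂ) * ∫ x, f x ∂μ := by
  have h : MeasurableEmbedding (fun x : F => a * x) :=
    (Homeomorph.mulLeft₀ a ha).measurableEmbedding
  rw [← h.integral_map (μ := μ) f, map_mul_left_eq μ hF ha, integral_smul_measure,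
    ENNReal.toReal_ofReal (by positivity), Complex.real_smul]

theorem lintegral_comp_mul_left (hF : IsNormalizedAbs F) {a : F} (ha : ‖a‖ = 1) (f : F → ENNReal) :
    ∫⁻ x, f (a * x) ∂μ = ∫⁻ x, f x ∂μ := by
  have h0 : a ≠ 0 := by rintro rfl; simp at ha
  have h : MeasurableEmbedding (fun x : F => a * x) :=
    (Homeomorph.mulLeft₀ a h0).measurableEmbedding
  rw [← h.lintegral_map f, map_mul_left_eq μ hF h0, ha]
  simp

end FieldLemmas

/-! ### Product measures: linear and triangular changes of variables. -/

section PiMeasure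

variable {F : Type*} [NontriviallyNormedField F] [IsUltrametricDist F] [ProperSpace F]
  [MeasurableSpace F] [BorelSpace F] (μ : Measure F) [μ.IsAddHaarMeasure]
  {ι : Type*} [Fintype ι]

open Matrix in
theorem map_toLin'_diagonal (hF : IsNormalizedAbs F) [DecidableEq ι] {D : ι → F}
    (h : (diagonal D).det ≠ 0) :
    Measure.map (toLin' (diagonal D)) (Measure.pi fun _ : ι => μ) =
      ENNReal.ofReal ‖(diagonal D).det‖⁻¹ • Measure.pi fun _ : ι => μ := by
  have key : ENNReal.ofReal ‖(diagonal D).det‖ •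
      Measure.map (toLin' (diagonal D)) (Measure.pi fun _ : ι => μ) = Measure.pi fun _ : ι => μ := by
    refine (Measure.pi_eq fun s hs => ?_).symm
    simp only [det_diagonal, Measure.coe_smul, smul_eq_mul, Pi.smul_apply]
    rw [Measure.map_apply (LinearMap.continuous_on_pi _).measurable (MeasurableSet.univ_pi hs)]
    have h1 : (toLin' (diagonal D) ⁻¹' Set.pi Set.univ fun i : ι => s i) =
        Set.pi Set.univ fun i : ι => (fun x => D i * x) ⁻¹' s i := by
      ext f
      simp [Set.mem_pi, toLin'_apply, mulVec_diagonal]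
    rw [h1, Measure.pi_pi, norm_prod, ENNReal.ofReal_prod_of_nonneg fun i _ => norm_nonneg (D i),
      ← Finset.prod_mul_distrib]
    refine Finset.prod_congr rfl fun i _ => measure_preimage_mul_left μ hF ?_ _
    rw [det_diagonal] at h
    exact Finset.prod_ne_zero_iff.1 h i (Finset.mem_univ i)
  conv_rhs => rw [← key]
  rw [smul_smul, ← ENNReal.ofReal_mul (by positivity), inv_mul_cancel₀ (norm_ne_zero_iff.2 h),
    ENNReal.ofReal_one, one_smul]

/-- Changing one coordinate by an isometric affine function of it, depending on the others. -/
theorem measurePreserving_update (hF : IsNormalizedAbs F) [DecidableEq ι] (p : ι) (s : F)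
    (hs : ‖s‖ = 1) (φ : (ι → F) → F) (hm : Measurable φ)
    (hφ : ∀ x c, φ (Function.update x p c) - s * c = φ x - s * x p) :
    MeasurePreserving (fun x => Function.update x p (φ x)) (Measure.pi fun _ : ι => μ)
      (Measure.pi fun _ : ι => μ) := by
  have ht : Measurable (fun x : ι → F => Function.update x p (φ x)) := by
    refine measurable_pi_iff.2 fun a => ?_
    by_cases h : a = p
    · subst h; simpa using hm
    · simpa [h] using measurable_pi_apply a
  refine ⟨ht, (Measure.pi_eq fun A hA => ?_).symm⟩
  have h2s : MeasurableSet (Set.univ.pi A) := .pi Set.countable_univ fun i _ ↦ hA i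
  simp_rw [← Measure.pi_pi, ← lintegral_indicator_one h2s]
  rw [lintegral_map (measurable_one.indicator h2s) ht]
  -- It suffices to compare marginals in the coordinate `p`. With the others frozen the map is `c ↦
  -- s * c + const` with `‖s‖ = 1`, which preserves `μ`.
  refine lintegral_eq_of_lmarginal_eq {p} ((measurable_one.indicator h2s).comp ht)
    (measurable_one.indicator h2s) ?_
  simp_rw [lmarginal_singleton]
  ext x
  have h1 : ∀ c, φ (Function.update x p c) = s * c + (φ x - s * x p) := fun c => by
    rw [← hφ x c]; ring
  simp only [Function.update_idem, h1]
  rw [lintegral_comp_mul_left μ hF hs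
    (fun y => (Set.univ.pi A).indicator 1 (Function.update x p (y + (φ x - s * x p)))),
    lintegral_add_right_eq_self (fun y => (Set.univ.pi A).indicator 1 (Function.update x p y))]

/-- Triangular maps with isometric diagonal preserve the product measure. -/
theorem measurePreserving_triangular (hF : IsNormalizedAbs F) (rk : ι → ℕ) (s : ι → F)
    (hs : ∀ p, ‖s p‖ = 1) (T : (ι → F) → ι → F) (hm : Measurable T)
    (hT : ∀ p x y, (∀ q, rk q < rk p → x q = y q) → T x p - s p * x p = T y p - s p * y p) :
    MeasurePreserving T (Measure.pi fun _ : ι => μ) (Measure.pi fun _ : ι => μ) := by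
  classical
  have key : ∀ S : Finset ι, MeasurePreserving (fun x p => if p ∈ S then T x p else x p)
      (Measure.pi fun _ : ι => μ) (Measure.pi fun _ : ι => μ) := by
    intro S
    -- Coordinates of large rank are changed before those of small rank: when `a` is treated, every
    -- coordinate on which its correction depends has smaller rank and is still unchanged.
    induction S using Finset.induction_on_min_value rk with
    | empty => exact MeasurePreserving.id _
    | insert a S ha hmin ih =>
      have h1 := measurePreserving_update μ hF a (s a) (hs a) (fun x => T x a)
        ((measurable_pi_apply a).comp hm) (fun x c => by
          have := hT a (Function.update x a c) x (fun q hq => by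
            rw [Function.update_of_ne]; rintro rfl; exact lt_irrefl _ hq)
          simpa using this)
      convert! h1.comp ih using 1
      funext x p
      have h2 := hT a (fun p => if p ∈ S then T x p else x p) x (fun q hq => by
        rw [if_neg]; intro hqS; exact absurd (hmin q hqS) (not_le.2 hq))
      rw [if_neg ha, sub_left_inj] at h2
      by_cases hp : p = a
      · subst hp
        simp [h2]
      · simp [hp]
  simpa using key Finset.univ

open Matrix in
theorem measurePreserving_transvection (hF : IsNormalizedAbs F) [DecidableEq ι]
    (t : TransvectionStruct ι F) :
    MeasurePreserving (toLin' t.toMatrix) (Measure.pi fun _ : ι => μ)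
      (Measure.pi fun _ : ι => μ) := by
  have h := measurePreserving_update μ hF t.i 1 norm_one (fun x => x t.i + t.c * x t.j)
    (by fun_prop) (fun x c => by simp [Function.update_of_ne t.hij.symm])
  convert! h using 1
  funext x
  cases t with | mk i j hij c =>
  ext p
  by_cases hp : p = i
  · subst hp
    simp [TransvectionStruct.toMatrix, transvection, single_mulVec]
  · simp [TransvectionStruct.toMatrix, transvection, single_mulVec, hp]

open Matrix in
/-- An invertible matrix scales the product measure by the inverse of `‖det‖`. -/
theorem map_toLin'_pi (hF : IsNormalizedAbs F) [DecidableEq ι] {M : Matrix ι ι F}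
    (hM : M.det ≠ 0) :
    Measure.map (toLin' M) (Measure.pi fun _ : ι => μ) =
      ENNReal.ofReal ‖M.det‖⁻¹ • Measure.pi fun _ : ι => μ := by
  apply diagonal_transvection_induction_of_det_ne_zero _ M hM
  · intro D hD
    exact map_toLin'_diagonal μ hF hD
  · intro t
    simp [(measurePreserving_transvection μ hF t).map_eq]
  · intro A B _ _ IHA IHB
    rw [toLin'_mul, det_mul, LinearMap.coe_comp, ← Measure.map_map, IHB, Measure.map_smul, IHA,
      smul_smul, ← ENNReal.ofReal_mul (by positivity), norm_mul, mul_comm, mul_inv]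
    · exact (LinearMap.continuous_on_pi _).measurable
    · exact (LinearMap.continuous_on_pi _).measurable

theorem map_linearMap_pi (hF : IsNormalizedAbs F) {f : (ι → F) →ₗ[F] ι → F}
    (hf : LinearMap.det f ≠ 0) :
    Measure.map f (Measure.pi fun _ : ι => μ) =
      ENNReal.ofReal ‖LinearMap.det f‖⁻¹ • Measure.pi fun _ : ι => μ := by
  classical
  obtain ⟨M, rfl⟩ : ∃ M, f = Matrix.toLin' M := ⟨LinearMap.toMatrix' f, by simp⟩
  rw [LinearMap.det_toLin'] at hf ⊢
  exact map_toLin'_pi μ hF hf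

theorem integral_comp_linearMap (hF : IsNormalizedAbs F) {f : (ι → F) →ₗ[F] ι → F}
    (hf : LinearMap.det f ≠ 0) {g : (ι → F) → ℂ} (hg : Continuous g) :
    ∫ x, g (f x) ∂(Measure.pi fun _ : ι => μ) =
      ((‖LinearMap.det f‖⁻¹ : ℝ) : ℂ) * ∫ x, g x ∂(Measure.pi fun _ : ι => μ) := by
  rw [← integral_map (φ := f) (LinearMap.continuous_on_pi _).measurable.aemeasurable
    hg.aestronglyMeasurable, map_linearMap_pi μ hF hf, integral_smul_measure,
    ENNReal.toReal_ofReal (by positivity), Complex.real_smul]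

theorem _root_.MeasureTheory.MeasurePreserving.integral_comp_continuous {α β E : Type*}
    [MeasurableSpace α] [MeasurableSpace β] [TopologicalSpace β] [OpensMeasurableSpace β]
    [NormedAddCommGroup E] [NormedSpace ℝ E] [SecondCountableTopology E]
    {μ : Measure α} {ν : Measure β} {T : α → β} (h : MeasurePreserving T μ ν) {g : β → E}
    (hg : Continuous g) : ∫ x, g (T x) ∂μ = ∫ y, g y ∂ν := by
  borelize E
  rw [← h.map_eq, integral_map h.measurable.aemeasurable hg.measurable.aestronglyMeasurable]

end PiMeasure

/-! ### Topology of GL_n, smooth functions, finite combinations of evaluations. -/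

section GLTopology

variable {F : Type*} [NontriviallyNormedField F] {n : ℕ}

/-- The unit group carries the topology induced by `g` together with `g⁻¹`. Matrix inversion is
continuous at `1`, so closeness of the entries of `g` alone is enough. -/
theorem exists_entries_nhds_one {U : Set (GL (Fin n) F)} (hU : U ∈ 𝓝 1) :
    ∃ δ > 0, ∀ g : GL (Fin n) F, (∀ i j, ‖(g.val - 1) i j‖ < δ) → g ∈ U := by
  have h1 : Tendsto (fun A : Matrix (Fin n) (Fin n) F => A⁻¹) (𝓝 1) (𝓝 1) := by
    have hd : ContinuousAt (fun A : Matrix (Fin n) (Fin n) F => Ring.inverse A.det) 1 := by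
      simp only [Ring.inverse_eq_inv']
      exact (Continuous.continuousAt (by fun_prop)).inv₀ (by simp)
    have h2 : ContinuousAt (fun A : Matrix (Fin n) (Fin n) F => Ring.inverse A.det • A.adjugate) 1 :=
      hd.smul (Continuous.continuousAt (by fun_prop))
    have h3 : ContinuousAt (fun A : Matrix (Fin n) (Fin n) F => A⁻¹) 1 := h2
    simpa [ContinuousAt] using h3
  have h2 : comap (Units.val : GL (Fin n) F → _) (𝓝 1) ≤ 𝓝 1 := by
    rw [← tendsto_id']
    rw [Units.isInducing_embedProduct.tendsto_nhds_iff]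
    refine Tendsto.prodMk_nhds tendsto_comap ?_
    have h4 : Tendsto (fun x : GL (Fin n) F => (x.val)⁻¹) (comap Units.val (𝓝 1)) (𝓝 1) :=
      h1.comp tendsto_comap
    have h5 := (MulOpposite.continuous_op.tendsto (1 : Matrix (Fin n) (Fin n) F)).comp h4
    simpa [Function.comp_def, Units.embedProduct] using h5
  obtain ⟨W, hW, hWU⟩ := mem_comap.1 (h2 hU)
  have hW' : (W : Set (Fin n → Fin n → F)) ∈
      @nhds (Fin n → Fin n → F) _ (fun i j => (1 : Matrix (Fin n) (Fin n) F) i j) := hW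
  obtain ⟨δ, hδ, hb⟩ := Metric.mem_nhds_iff.1 hW'
  refine ⟨δ, hδ, fun g hg => hWU (hb ?_)⟩
  have hd : dist (fun i j => g.val i j) (fun i j => (1 : Matrix (Fin n) (Fin n) F) i j) < δ := ?_
  · exact hd
  rw [dist_eq_norm, pi_norm_lt_iff hδ]
  intro i
  rw [pi_norm_lt_iff hδ]
  exact fun j => hg i j

theorem continuous_of_val {X : Type*} [TopologicalSpace X] {x : X → GL (Fin n) F}
    (h : Continuous fun t => (x t).val) : Continuous x := by
  refine Units.continuous_iff.2 ⟨h, ?_⟩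
  have h1 : (fun t => ((x t)⁻¹).val) = fun t => ((x t).val.det)⁻¹ • (x t).val.adjugate := by
    funext t
    rw [Matrix.coe_units_inv, Matrix.inv_def, Ring.inverse_eq_inv']
  change Continuous (fun t => ((x t)⁻¹).val)
  rw [h1]
  refine Continuous.smul (h.matrix_det.inv₀ fun t => ?_) h.matrix_adjugate
  exact ((Matrix.isUnit_iff_isUnit_det _).1 (x t).isUnit).ne_zero

/-- Right invariance under the elements of a set. -/
def RInv (U : Set (GL (Fin n) F)) (f : GL (Fin n) F → ℂ) : Prop :=
  ∀ g, ∀ h ∈ U, f (g * h) = f g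

theorem RInv.mono {U U' : Set (GL (Fin n) F)} {f : GL (Fin n) F → ℂ} (h : RInv U f)
    (hU : U' ⊆ U) : RInv U' f := fun g x hx => h g x (hU hx)

/-- The right stabilizer of `f` is a subgroup, open once it contains a neighbourhood of `1`. Working
with `RInv U` allows one `U` to serve a whole family of functions. -/
theorem isSmooth_iff {f : GL (Fin n) F → ℂ} : IsSmooth f ↔ ∃ U ∈ 𝓝 1, RInv U f := by
  constructor
  · rintro ⟨K, hK, h⟩
    exact ⟨K, hK.mem_nhds K.one_mem, h⟩
  · rintro ⟨U, hU, h⟩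
    let K : Subgroup (GL (Fin n) F) :=
      { carrier := {x | ∀ g, f (g * x) = f g}
        mul_mem' := fun {a b} ha hb g => by rw [← mul_assoc, hb, ha]
        one_mem' := fun g => by rw [mul_one]
        inv_mem' := fun {a} ha g => by rw [← ha (g * a⁻¹), inv_mul_cancel_right] }
    refine ⟨K, K.isOpen_of_mem_nhds (g := 1) (mem_of_superset hU fun x hx g => h g x hx), ?_⟩
    exact fun g x hx => hx g

theorem RInv.eventually_eq {U : Set (GL (Fin n) F)} {f : GL (Fin n) F → ℂ} (h : RInv U f)
    (hU : U ∈ 𝓝 1) (g : GL (Fin n) F) : ∀ᶠ x in 𝓝 g, f x = f g := by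
  have h1 : Tendsto (fun x => g⁻¹ * x) (𝓝 g) (𝓝 1) := by
    have : Continuous fun x => g⁻¹ * x := continuous_const.mul continuous_id
    simpa using this.tendsto g
  filter_upwards [h1 hU] with x hx
  rw [← h g _ hx, mul_inv_cancel_left]

theorem RInv.continuous {U : Set (GL (Fin n) F)} {f : GL (Fin n) F → ℂ} (h : RInv U f)
    (hU : U ∈ 𝓝 1) : Continuous f := by
  refine continuous_iff_continuousAt.2 fun g => ?_
  exact (continuousAt_const (y := f g)).congr ((h.eventually_eq hU g).mono fun x hx => hx.symm)

theorem IsSmooth.continuous {f : GL (Fin n) F → ℂ} (h : IsSmooth f) : Continuous f := by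
  obtain ⟨U, hU, h⟩ := isSmooth_iff.1 h
  exact h.continuous hU

theorem conj_mem_nhds_one {U : Set (GL (Fin n) F)} (hU : U ∈ 𝓝 1) (g : GL (Fin n) F) :
    {h | g⁻¹ * h * g ∈ U} ∈ 𝓝 1 := by
  have : Continuous fun x => g⁻¹ * x * g := by fun_prop
  exact this.tendsto' 1 1 (by simp) hU

theorem RInv.translate {U : Set (GL (Fin n) F)} {f : GL (Fin n) F → ℂ} (h : RInv U f)
    (g : GL (Fin n) F) : RInv {h | g⁻¹ * h * g ∈ U} fun x => f (x * g) := fun x y hy => by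
  have := h (x * g) _ hy
  change f (x * y * g) = f (x * g)
  rw [← this]
  simp only [mul_assoc, mul_inv_cancel_left]

theorem IsSmooth.translate {f : GL (Fin n) F → ℂ} (h : IsSmooth f) (g : GL (Fin n) F) :
    IsSmooth fun x => f (x * g) := by
  obtain ⟨U, hU, h⟩ := isSmooth_iff.1 h
  exact isSmooth_iff.2 ⟨_, conj_mem_nhds_one hU g, h.translate g⟩

/-- The span of the evaluation functionals. -/
noncomputable def evalSpan (G : Type*) : Submodule ℂ ((G → ℂ) →ₗ[ℂ] ℂ) :=
  Submodule.span ℂ (Set.range fun g : G => LinearMap.proj g)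

theorem proj_mem_evalSpan {G : Type*} (g : G) : LinearMap.proj g ∈ evalSpan G :=
  Submodule.subset_span ⟨g, rfl⟩

/-- Integrals of right invariant functions over compact sets are finite combinations of
evaluations, the combination being independent of the function. -/
theorem exists_evalSpan_setIntegral {X : Type*} [TopologicalSpace X] [MeasurableSpace X]
    [BorelSpace X] {ν : Measure X} {Ω : Set X} (hΩ : IsCompact Ω) (hΩm : MeasurableSet Ω)
    {x : X → GL (Fin n) F} (hx : Continuous x) {θ : X → ℂ} (hθ : IntegrableOn θ Ω ν)
    {U : Set (GL (Fin n) F)} (hU : U ∈ 𝓝 1) :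
    ∃ A ∈ evalSpan (GL (Fin n) F), ∀ f, RInv U f →
      IntegrableOn (fun v => f (x v) * θ v) Ω ν ∧ ∫ v in Ω, f (x v) * θ v ∂ν = A f := by
  obtain ⟨U', hU', hUo, hU1⟩ := mem_nhds_iff.1 hU
  -- On `W v` every `f` of level `U` satisfies `f (x y) = f (x v)`. A finite cover of `Ω` by such
  -- sets is cut into disjoint pieces, each contributing an evaluation weighted by an integral of
  -- `θ`.
  let W : X → Set X := fun v => {y | (x v)⁻¹ * x y ∈ U'}
  have hWo : ∀ v, IsOpen (W v) := fun v => hUo.preimage (by fun_prop)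
  obtain ⟨t, -, ht⟩ := hΩ.elim_nhds_subcover W fun v _ => (hWo v).mem_nhds (by simpa [W] using hU1)
  have key : ∀ t : Finset X, ∀ B : Set X, MeasurableSet B → B ⊆ Ω → (B ⊆ ⋃ v ∈ t, W v) →
      ∃ A ∈ evalSpan (GL (Fin n) F), ∀ f, RInv U f →
      IntegrableOn (fun v => f (x v) * θ v) B ν ∧ ∫ v in B, f (x v) * θ v ∂ν = A f := by
    classical
    intro t
    induction t using Finset.induction_on with
    | empty =>
      intro B _ _ hB
      have : B = ∅ := by simpa using hB
      subst this
      exact ⟨0, zero_mem _, fun f _ => by simp⟩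
    | insert v t _ ih =>
      intro B hBm hBΩ hB
      obtain ⟨A, hA, h⟩ := ih (B \ W v) (hBm.diff (hWo v).measurableSet)
        (Set.sdiff_subset.trans hBΩ) (by
          rintro y ⟨hy, hyv⟩
          have := hB hy
          simp only [Finset.mem_insert, Set.iUnion_iUnion_eq_or_left, Set.mem_union] at this
          exact this.resolve_left hyv)
      refine ⟨(∫ y in B ∩ W v, θ y ∂ν) • LinearMap.proj (x v) + A,
        add_mem (Submodule.smul_mem _ _ (proj_mem_evalSpan _)) hA, fun f hf => ?_⟩
      obtain ⟨h1, h2⟩ := h f hf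
      have hm : MeasurableSet (B ∩ W v) := hBm.inter (hWo v).measurableSet
      have heq : ∀ y ∈ B ∩ W v, f (x v) * θ y = f (x y) * θ y := by
        rintro y ⟨-, hy⟩
        rw [← hf (x v) _ (hU' hy), mul_inv_cancel_left]
      have h3 : IntegrableOn (fun y => f (x y) * θ y) (B ∩ W v) ν :=
        IntegrableOn.congr_fun ((hθ.mono_set (Set.inter_subset_left.trans hBΩ)).const_mul (f (x v))) heq hm
      have hu : B ∩ W v ∪ B \ W v = B := Set.inter_union_sdiff B (W v)
      constructor
      · rw [← hu]; exact h3.union h1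
      · rw [← hu, setIntegral_union (Set.disjoint_sdiff_inter.symm) (hBm.diff (hWo v).measurableSet)
          h3 h1, h2, ← setIntegral_congr_fun hm heq, integral_const_mul]
        simp [hu, mul_comm]
  exact key t Ω hΩm subset_rfl ht

end GLTopology

/-! ### Laurent polynomials in q^{ζ_i}: identity theorem, cones, uniform level of sections. -/

section EntireFun

variable {F : Type*} [NontriviallyNormedField F] [IsUltrametricDist F] [ProperSpace F] {k : ℕ}

theorem residueCard_cast_ne_zero : (residueCard F : ℂ) ≠ 0 := by
  exact_mod_cast (zero_lt_one.trans (one_lt_residueCard (F := F))).ne'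

theorem const_mem_entireFun (c : ℂ) : (fun _ => c) ∈ entireFun F k :=
  (entireFun F k).algebraMap_mem c

theorem cpow_mem_entireFun (i : Fin k) : (fun ζ => (residueCard F : ℂ) ^ ζ i) ∈ entireFun F k :=
  Algebra.subset_adjoin (Or.inl ⟨i, rfl⟩)

theorem cpow_neg_mem_entireFun (i : Fin k) :
    (fun ζ => (residueCard F : ℂ) ^ (-ζ i)) ∈ entireFun F k :=
  Algebra.subset_adjoin (Or.inr ⟨i, rfl⟩)

theorem cpow_zpow_mem_entireFun (i : Fin k) (n : ℤ) :
    (fun ζ => ((residueCard F : ℂ) ^ ζ i) ^ n) ∈ entireFun F k := by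
  obtain ⟨m, rfl | rfl⟩ := n.eq_nat_or_neg
  · convert! pow_mem (cpow_mem_entireFun (F := F) i) m using 1
  · convert! pow_mem (cpow_neg_mem_entireFun (F := F) i) m using 1
    funext ζ
    simp [Complex.cpow_neg]

theorem analyticOnNhd_of_mem_entireFun {f : (Fin k → ℂ) → ℂ} (hf : f ∈ entireFun F k) :
    AnalyticOnNhd ℂ f Set.univ := by
  have hq := residueCard_cast_ne_zero (F := F)
  have hp : ∀ i : Fin k, AnalyticOnNhd ℂ (fun ζ : Fin k → ℂ => ζ i) Set.univ := fun i =>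
    (ContinuousLinearMap.proj (R := ℂ) (φ := fun _ : Fin k => ℂ) i).analyticOnNhd _
  refine Algebra.adjoin_induction (p := fun f _ => AnalyticOnNhd ℂ f Set.univ) ?_ ?_ ?_ ?_ hf
  · rintro _ (⟨i, rfl⟩ | ⟨i, rfl⟩)
    · have : (fun ζ : Fin k → ℂ => (residueCard F : ℂ) ^ ζ i) =
          fun ζ => Complex.exp (Complex.log (residueCard F) * ζ i) := by
        funext ζ; rw [Complex.cpow_def_of_ne_zero hq]
      change AnalyticOnNhd ℂ (fun ζ : Fin k → ℂ => (residueCard F : ℂ) ^ ζ i) Set.univ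
      rw [this]
      exact fun ζ _ => (analyticAt_const.mul (hp i ζ trivial)).cexp
    · have : (fun ζ : Fin k → ℂ => (residueCard F : ℂ) ^ (-ζ i)) =
          fun ζ => Complex.exp (Complex.log (residueCard F) * (-ζ i)) := by
        funext ζ; rw [Complex.cpow_def_of_ne_zero hq]
      change AnalyticOnNhd ℂ (fun ζ : Fin k → ℂ => (residueCard F : ℂ) ^ (-ζ i)) Set.univ
      rw [this]
      exact fun ζ _ => (analyticAt_const.mul (hp i ζ trivial).neg).cexp
  · exact fun c => analyticOnNhd_const
  · exact fun f g _ _ h1 h2 => h1.add h2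
  · exact fun f g _ _ h1 h2 => h1.mul h2

theorem continuous_of_mem_entireFun {f : (Fin k → ℂ) → ℂ} (hf : f ∈ entireFun F k) :
    Continuous f :=
  continuousOn_univ.1 (analyticOnNhd_of_mem_entireFun hf).continuousOn

/-- The identity theorem for analytic functions on the connected space ℂ^k. It is the tool by which
identities proved on a cone are carried to all `ζ`. -/
theorem entireFun_eq_zero {f : (Fin k → ℂ) → ℂ} (hf : f ∈ entireFun F k) {S : Set (Fin k → ℂ)}
    (hS : (interior S).Nonempty) (h : ∀ ζ ∈ S, f ζ = 0) : f = 0 := by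
  obtain ⟨ζ, hζ⟩ := hS
  refine (analyticOnNhd_of_mem_entireFun hf).eq_of_eventuallyEq (g := 0) analyticOnNhd_const
    (z₀ := ζ) ?_
  filter_upwards [mem_interior_iff_mem_nhds.1 hζ] with x hx using h x hx

theorem entireFun_ext {f g : (Fin k → ℂ) → ℂ} (hf : f ∈ entireFun F k) (hg : g ∈ entireFun F k)
    {S : Set (Fin k → ℂ)} (hS : (interior S).Nonempty) (h : ∀ ζ ∈ S, f ζ = g ζ) : f = g :=
  sub_eq_zero.1 (entireFun_eq_zero (sub_mem hf hg) hS fun ζ hζ => sub_eq_zero.2 (h ζ hζ))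

/-- If the product vanished, `g` would vanish on the nonempty open set where `f` does not. -/
theorem entireFun_mul_ne_zero {f g : (Fin k → ℂ) → ℂ} (hf : f ∈ entireFun F k)
    (hg : g ∈ entireFun F k) (hf0 : f ≠ 0) (hg0 : g ≠ 0) : f * g ≠ 0 := by
  intro h
  refine hg0 (entireFun_eq_zero hg (S := {ζ | f ζ ≠ 0}) ?_ fun ζ hζ => ?_)
  · rw [(isOpen_ne_fun (continuous_of_mem_entireFun hf) continuous_const).interior_eq]
    by_contra hne
    rw [Set.not_nonempty_iff_eq_empty, Set.eq_empty_iff_forall_notMem] at hne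
    exact hf0 (funext fun ζ => not_not.1 (hne ζ))
  · exact (mul_eq_zero.1 (congrFun h ζ)).resolve_left hζ

theorem isOpen_cone (R : ℝ) : IsOpen (cone k R) := by
  have : cone k R = ⋂ i : Fin k, ⋂ j : Fin k, {ζ | (i : ℕ) + 1 = j → R < (ζ i - ζ j).re} := by
    ext ζ; simp [cone]
  rw [this]
  refine isOpen_iInter_of_finite fun i => isOpen_iInter_of_finite fun j => ?_
  by_cases h : (i : ℕ) + 1 = j
  · simp only [h, forall_const]
    exact isOpen_lt continuous_const (by fun_prop)
  · simp [h]

theorem cone_nonempty (R : ℝ) : (cone k R).Nonempty := by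
  refine ⟨fun i => ((-(R + 1) * (i : ℝ) : ℝ) : ℂ), fun i j h => ?_⟩
  have : (j : ℝ) = i + 1 := by exact_mod_cast h.symm
  rw [← Complex.ofReal_sub, Complex.ofReal_re, this]
  linarith

theorem interior_cone_nonempty (R : ℝ) : (interior (cone k R)).Nonempty := by
  rw [(isOpen_cone R).interior_eq]; exact cone_nonempty R

theorem cone_mono {R R' : ℝ} (h : R ≤ R') : cone k R' ⊆ cone k R :=
  fun _ hζ i j hij => h.trans_lt (hζ i j hij)

/-- Telescoping over consecutive indices; `0 ≤ R` is what makes the sum of several gaps exceed `R`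
again. -/
theorem lt_of_mem_cone {R : ℝ} (hR : 0 ≤ R) {ζ : Fin k → ℂ} (hζ : ζ ∈ cone k R) {i j : Fin k}
    (hij : i < j) : R < (ζ i - ζ j).re := by
  obtain ⟨d, hd⟩ : ∃ d : ℕ, (j : ℕ) = i + d + 1 := ⟨j - i - 1, by have : (i : ℕ) < j := hij; omega⟩
  induction d generalizing j with
  | zero => exact hζ i j (by omega)
  | succ d ih =>
    have hj := j.2
    have h1 := ih (j := ⟨i + d + 1, by omega⟩) (Fin.lt_def.2 (by simp only; omega)) rfl
    have h2 := hζ ⟨i + d + 1, by omega⟩ j (by simp only; omega)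
    simp only [Complex.sub_re] at *
    linarith

theorem mem_entireFun_of_evalSpan {G : Type*} {A : (G → ℂ) →ₗ[ℂ] ℂ} (hA : A ∈ evalSpan G)
    {f : (Fin k → ℂ) → G → ℂ} (hf : ∀ g, (fun ζ => f ζ g) ∈ entireFun F k) :
    (fun ζ => A (f ζ)) ∈ entireFun F k := by
  refine Submodule.span_induction (p := fun A _ => (fun ζ => A (f ζ)) ∈ entireFun F k)
    ?_ ?_ ?_ ?_ hA
  · rintro _ ⟨g, rfl⟩
    exact hf g
  · exact zero_mem _
  · exact fun A B _ _ h1 h2 => add_mem h1 h2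
  · exact fun c A _ h1 => Subalgebra.smul_mem _ h1 c

/-- An entire section is right invariant under a neighbourhood of `1` independent of `ζ`. -/
theorem exists_uniform_rInv {n : ℕ} {f : (Fin k → ℂ) → GL (Fin n) F → ℂ}
    (hs : ∀ ζ, IsSmooth (f ζ)) (hf : ∀ g, (fun ζ => f ζ g) ∈ entireFun F k) :
    ∃ U ∈ 𝓝 1, ∀ ζ, RInv U (f ζ) := by
  let B : ℕ → Set (GL (Fin n) F) := fun m => {g | ∀ i j, ‖(g.val - 1) i j‖ < 1 / ((m : ℝ) + 1)}
  have hB : ∀ m, B m ∈ 𝓝 1 := by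
    intro m
    have h : IsOpen (B m) := by
      have : B m = ⋂ i : Fin n, ⋂ j : Fin n, {g | ‖(g.val - 1) i j‖ < 1 / ((m : ℝ) + 1)} := by
        ext g; simp [B]
      rw [this]
      refine isOpen_iInter_of_finite fun i => isOpen_iInter_of_finite fun j => ?_
      refine isOpen_lt ?_ continuous_const
      exact (((Units.continuous_val.sub continuous_const).matrix_elem i j)).norm
    refine h.mem_nhds ?_
    have : (0 : ℝ) < 1 / ((m : ℝ) + 1) := by positivity
    exact fun i j => by simpa using this
  -- Each `A m` is closed and together they cover ℂ^k, so by Baire one of them has interior points.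
  -- The invariance under `B m` holding there extends to every `ζ` by the identity theorem.
  let A : ℕ → Set (Fin k → ℂ) := fun m => {ζ | RInv (B m) (f ζ)}
  have hA : ∀ m, IsClosed (A m) := by
    intro m
    have : A m = ⋂ g, ⋂ h ∈ B m, {ζ | f ζ (g * h) = f ζ g} := by
      ext ζ; simp [A, RInv]
    rw [this]
    exact isClosed_iInter fun g => isClosed_iInter fun h => isClosed_iInter fun _ =>
      isClosed_eq (continuous_of_mem_entireFun (hf _)) (continuous_of_mem_entireFun (hf _))
  have hAu : ⋃ m, A m = Set.univ := by
    refine Set.eq_univ_of_forall fun ζ => ?_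
    obtain ⟨U, hU, h⟩ := isSmooth_iff.1 (hs ζ)
    obtain ⟨δ, hδ, hδU⟩ := exists_entries_nhds_one hU
    obtain ⟨m, hm⟩ := exists_nat_one_div_lt hδ
    exact Set.mem_iUnion.2 ⟨m, h.mono fun g hg => hδU g fun i j => (hg i j).trans hm⟩
  obtain ⟨m, hm⟩ := nonempty_interior_of_iUnion_of_closed hA hAu
  refine ⟨B m, hB m, fun ζ g h hh => ?_⟩
  exact congrFun (entireFun_ext (hf (g * h)) (hf g) hm fun ζ hζ => hζ g h hh) ζ

end EntireFun

/-! ### Elementary matrices, diagonal elements and the Bruhat relation of rank one. -/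

section Elementary

variable {F : Type*} [NontriviallyNormedField F] {n : ℕ}

theorem single_mul_single_eq_zero {a b c d : Fin n} (h : b ≠ c) (s t : F) :
    Matrix.single a b s * Matrix.single c d t = 0 :=
  Matrix.single_mul_single_of_ne _ _ _ _ h _

/-- The elementary matrix `1 + t E_{a,b}` (`1` if `a = b`). -/
noncomputable def elemGL (a b : Fin n) (t : F) : GL (Fin n) F :=
  if h : a ≠ b then
    { val := Matrix.transvection a b t
      inv := Matrix.transvection a b (-t)
      val_inv := by rw [Matrix.transvection_mul_transvection_same _ _ h]; simp
      inv_val := by rw [Matrix.transvection_mul_transvection_same _ _ h]; simp }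
  else 1

theorem elemGL_val {a b : Fin n} (h : a ≠ b) (t : F) :
    (elemGL a b t).val = 1 + Matrix.single a b t := by
  rw [elemGL, dif_pos h]; rfl

/-- The diagonal matrix with entry `s` at `a` and `1` elsewhere. -/
noncomputable def torGL (a : Fin n) (s : Fˣ) : GL (Fin n) F where
  val := 1 + Matrix.single a a ((s : F) - 1)
  inv := 1 + Matrix.single a a (((s⁻¹ : Fˣ) : F) - 1)
  val_inv := by
    simp only [mul_add, add_mul, mul_one, one_mul, Matrix.single_mul_single_same]
    rw [add_assoc, ← Matrix.single_add, ← Matrix.single_add]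
    have : (s : F) - 1 + (((s⁻¹ : Fˣ) : F) - 1 + ((s : F) - 1) * (((s⁻¹ : Fˣ) : F) - 1)) = 0 := by
      have := s.mul_inv; linear_combination this
    rw [this]; simp
  inv_val := by
    simp only [mul_add, add_mul, mul_one, one_mul, Matrix.single_mul_single_same]
    rw [add_assoc, ← Matrix.single_add, ← Matrix.single_add]
    have : (((s⁻¹ : Fˣ) : F) - 1) + ((s : F) - 1 + (((s⁻¹ : Fˣ) : F) - 1) * ((s : F) - 1)) = 0 := by
      have := s.inv_mul; linear_combination this
    rw [this]; simp

theorem torGL_val (a : Fin n) (s : Fˣ) :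
    (torGL a s).val = 1 + Matrix.single a a ((s : F) - 1) := rfl

theorem elemGL_add {a b : Fin n} (h : a ≠ b) (s t : F) :
    elemGL a b s * elemGL a b t = elemGL a b (s + t) := by
  refine Units.ext ?_
  simp only [Units.val_mul, elemGL_val h, mul_add, add_mul, mul_one, one_mul,
    single_mul_single_eq_zero h.symm, Matrix.single_add]
  abel

theorem elemGL_comm {a b c d : Fin n} (hab : a ≠ b) (hcd : c ≠ d) (h1 : b ≠ c) (h2 : d ≠ a)
    (s t : F) : elemGL a b s * elemGL c d t = elemGL c d t * elemGL a b s := by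
  refine Units.ext ?_
  simp only [Units.val_mul, elemGL_val hab, elemGL_val hcd, mul_add, add_mul, mul_one, one_mul,
    single_mul_single_eq_zero h1, single_mul_single_eq_zero h2]
  abel

theorem elemGL_mul_right {a b d : Fin n} (hab : a ≠ b) (hbd : b ≠ d) (had : a ≠ d) (t s : F) :
    elemGL b a t * elemGL a d s = elemGL b d (t * s) * (elemGL a d s * elemGL b a t) := by
  refine Units.ext ?_
  simp only [Units.val_mul, elemGL_val hab.symm, elemGL_val hbd, elemGL_val had, mul_add, add_mul,
    mul_one, one_mul, Matrix.single_mul_single_same, single_mul_single_eq_zero hbd.symm,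
    single_mul_single_eq_zero had.symm]
  simp only [← add_assoc, add_zero, mul_zero]
  abel

theorem elemGL_mul_left {a b c : Fin n} (hab : a ≠ b) (hca : c ≠ a) (hcb : c ≠ b) (t s : F) :
    elemGL b a t * elemGL c b s = elemGL c a (-(s * t)) * (elemGL c b s * elemGL b a t) := by
  refine Units.ext ?_
  simp only [Units.val_mul, elemGL_val hab.symm, elemGL_val hca, elemGL_val hcb, mul_add, add_mul,
    mul_one, one_mul, Matrix.single_mul_single_same, single_mul_single_eq_zero hca.symm,
    single_mul_single_eq_zero hab]
  have : Matrix.single c a (-(s * t)) = - Matrix.single c a (s * t) := by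
    rw [← Matrix.single_neg]
  rw [this]
  abel

theorem elemGL_mul_torGL_col {a b : Fin n} (hab : a ≠ b) (t : F) (s : Fˣ) :
    elemGL b a t * torGL a s = torGL a s * elemGL b a (s * t) := by
  refine Units.ext ?_
  simp only [Units.val_mul, elemGL_val hab.symm, torGL_val, mul_add, add_mul,
    mul_one, one_mul, Matrix.single_mul_single_same, single_mul_single_eq_zero hab]
  have : (s : F) * t = t + t * (s - 1) := by ring
  rw [this, Matrix.single_add]
  abel

theorem elemGL_mul_torGL_row {a b : Fin n} (hab : a ≠ b) (t : F) (s : Fˣ) :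
    elemGL b a t * torGL b s = torGL b s * elemGL b a (((s⁻¹ : Fˣ) : F) * t) := by
  refine Units.ext ?_
  simp only [Units.val_mul, elemGL_val hab.symm, torGL_val, mul_add, add_mul,
    mul_one, one_mul, Matrix.single_mul_single_same, single_mul_single_eq_zero hab]
  have : t = ((s⁻¹ : Fˣ) : F) * t + ((s : F) - 1) * (((s⁻¹ : Fˣ) : F) * t) := by
    have := s.mul_inv
    linear_combination (-t) * this
  conv_lhs => rw [this]
  rw [Matrix.single_add]
  abel

theorem elemGL_mul_torGL_comm {a b c : Fin n} (hab : a ≠ b) (hca : c ≠ a) (hcb : c ≠ b) (t : F)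
    (s : Fˣ) : elemGL b a t * torGL c s = torGL c s * elemGL b a t := by
  refine Units.ext ?_
  simp only [Units.val_mul, elemGL_val hab.symm, torGL_val, mul_add, add_mul,
    mul_one, one_mul, single_mul_single_eq_zero hca.symm,
    single_mul_single_eq_zero hcb]
  abel

/-- The Weyl element of the pair `a, b`. -/
noncomputable def reflGL (F : Type*) [NontriviallyNormedField F] (a b : Fin n) : GL (Fin n) F :=
  elemGL a b (-1) * elemGL b a 1 * elemGL a b (-1)

/-- The matrix which is `(p, q; r, s)` in the coordinates `a, b` and `1` elsewhere. -/
def twoByTwo (a b : Fin n) (p q r s : F) : Matrix (Fin n) (Fin n) F :=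
  1 + (p - 1) • Matrix.single a a 1 + q • Matrix.single a b 1 + r • Matrix.single b a 1 +
    (s - 1) • Matrix.single b b 1

theorem twoByTwo_mul {a b : Fin n} (hab : a ≠ b) (p q r s p' q' r' s' : F) :
    twoByTwo a b p q r s * twoByTwo a b p' q' r' s' =
      twoByTwo a b (p * p' + q * r') (p * q' + q * s') (r * p' + s * r') (r * q' + s * s') := by
  simp only [twoByTwo, mul_add, add_mul, mul_one, one_mul, smul_mul_assoc, mul_smul_comm,
    Matrix.single_mul_single_same, single_mul_single_eq_zero hab,
    single_mul_single_eq_zero hab.symm, smul_zero]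
  module

/-- For large `t` the rightmost factor, with parameter `t⁻¹`, is close to `1` and is absorbed by the
level of a smooth function, while the leftmost factors act through the character. This makes the
integrand of a rank one intertwining integral explicit near infinity. -/
theorem elemGL_bruhat {a b : Fin n} (hab : a ≠ b) (t : Fˣ) :
    elemGL b a (t : F) = elemGL a b ((t⁻¹ : Fˣ) : F) * (torGL a t⁻¹ * (torGL b t *
      (reflGL F a b * elemGL a b ((t⁻¹ : Fˣ) : F)))) := by
  have h1 : ∀ u : F, (elemGL a b u).val = twoByTwo a b 1 u 0 1 := fun u => by
    simp [elemGL_val hab, twoByTwo, Matrix.smul_single]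
  have h2 : ∀ u : F, (elemGL b a u).val = twoByTwo a b 1 0 u 1 := fun u => by
    simp [elemGL_val hab.symm, twoByTwo, Matrix.smul_single]
  have h3 : ∀ u : Fˣ, (torGL a u).val = twoByTwo a b (u : F) 0 0 1 := fun u => by
    simp [torGL_val, twoByTwo, Matrix.smul_single]
  have h4 : ∀ u : Fˣ, (torGL b u).val = twoByTwo a b 1 0 0 (u : F) := fun u => by
    simp [torGL_val, twoByTwo, Matrix.smul_single]
  refine Units.ext ?_
  simp only [reflGL, Units.val_mul, h1, h2, h3, h4, twoByTwo_mul hab]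
  congr 1 <;> simp

end Elementary

/-! ### The intertwining integral along one pair of adjacent indices. -/

section RankOne

variable {F : Type*} [NontriviallyNormedField F] [IsUltrametricDist F] [ProperSpace F]
  {n : ℕ}

/-- `f` is left equivariant under the Borel subgroup attached to the order `σ` of the indices,
with respect to an unramified character. -/
structure BorelEquivariant (σ : Equiv.Perm (Fin n)) (y : Fin n → ℂ) (f : GL (Fin n) F → ℂ) :
    Prop where
  ne_zero : ∀ a, y a ≠ 0
  unipotent : ∀ a b, σ a < σ b → ∀ (t : F) g, f (elemGL a b t * g) = f g
  torus : ∀ a (s : Fˣ) g, f (torGL a s * g) = y a ^ deg (s : F) * f g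

theorem continuous_elemGL (a b : Fin n) : Continuous fun t : F => elemGL a b t := by
  by_cases h : a = b
  · subst h
    simpa [elemGL] using continuous_const
  · refine continuous_of_val ?_
    simp only [elemGL_val h]
    refine continuous_const.add ?_
    refine continuous_matrix fun i j => ?_
    by_cases hij : a = i ∧ b = j
    · simp only [Matrix.single_apply, hij, and_self, if_true]
      fun_prop
    · simp only [Matrix.single_apply, hij, if_false]
      fun_prop

theorem elemGL_zero (a b : Fin n) : elemGL a b (0 : F) = 1 := by
  by_cases h : a = b
  · subst h; simp [elemGL]
  · exact Units.ext (by simp [elemGL_val h])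

variable [MeasurableSpace F] [BorelSpace F] (μ : Measure F) [μ.IsAddHaarMeasure]

/-- The character after an intertwining integral along the pair `a, b`. -/
noncomputable def swapChar (F : Type*) [NontriviallyNormedField F] [IsUltrametricDist F]
    (a b : Fin n) {𝕂 : Type*} [Field 𝕂] (y : Fin n → 𝕂) : Fin n → 𝕂 :=
  Function.update (Function.update y a (y a / residueCard F)) b (y b * residueCard F)

/-- No Weyl element is inserted: each index keeps its own character and it is the order, hence the
Borel subgroup, that changes. The only effect on the characters is the Jacobian of the integration
variable, recorded by `swapChar`. -/
theorem BorelEquivariant.step (hF : IsNormalizedAbs F) {σ : Equiv.Perm (Fin n)} {y : Fin n → ℂ}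
    {f : GL (Fin n) F → ℂ} (hf : BorelEquivariant σ y f) {a b : Fin n}
    (hab : (σ b : ℕ) = σ a + 1) :
    BorelEquivariant ((Equiv.swap a b).trans σ) (swapChar F a b y)
      fun g => ∫ t, f (elemGL b a t * g) ∂μ := by
  have hne : a ≠ b := by rintro rfl; omega
  have hq := residueCard_cast_ne_zero (F := F)
  refine ⟨fun c => ?_, fun c d hcd s g => ?_, fun c s g => ?_⟩
  · by_cases hcb : c = b
    · subst hcb; simp [swapChar, hq, hf.ne_zero]
    · by_cases hca : c = a
      · subst hca; simp [swapChar, hcb, hq, hf.ne_zero]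
      · simp [swapChar, hcb, hca, hf.ne_zero]
  · have hcd' : c ≠ d := by rintro rfl; exact lt_irrefl _ hcd
    simp only [Equiv.trans_apply, Fin.lt_def] at hcd
    simp only [← mul_assoc]
    -- This is the root group being integrated over, where invariance is translation invariance of
    -- `μ`.
    by_cases hc : c = b ∧ d = a
    · obtain ⟨rfl, rfl⟩ := hc
      simp only [elemGL_add hne.symm]
      exact integral_add_right_eq_self (fun t => f (elemGL c d t * g)) s
    -- Since `a` and `b` are adjacent for `σ`, swapping them changes the order of no other pair.
    have hσ : σ c < σ d ∧ ¬(c = a ∧ d = b) := by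
      have hinj : ∀ x y, ((σ x : ℕ) = σ y) → x = y := fun x y h => σ.injective (Fin.ext h)
      rw [Fin.lt_def]
      by_cases h1 : c = a
      · subst h1
        rw [Equiv.swap_apply_left] at hcd
        by_cases h2 : d = b
        · subst h2; rw [Equiv.swap_apply_right] at hcd; omega
        · rw [Equiv.swap_apply_of_ne_of_ne hcd'.symm h2] at hcd
          exact ⟨by omega, fun h => h2 h.2⟩
      · by_cases h2 : c = b
        · subst h2
          rw [Equiv.swap_apply_right] at hcd
          have h3 : d ≠ a := fun h => hc ⟨rfl, h⟩
          rw [Equiv.swap_apply_of_ne_of_ne h3 hcd'.symm] at hcd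
          have : (σ d : ℕ) ≠ σ c := fun h => hcd' (hinj _ _ h).symm
          exact ⟨by omega, fun h => h1 h.1⟩
        · rw [Equiv.swap_apply_of_ne_of_ne h1 h2] at hcd
          by_cases h3 : d = a
          · subst h3; rw [Equiv.swap_apply_left] at hcd
            have : (σ d : ℕ) ≠ σ c := fun h => hcd' (hinj _ _ h).symm
            exact ⟨by omega, fun h => h1 h.1⟩
          · by_cases h4 : d = b
            · subst h4; rw [Equiv.swap_apply_right] at hcd
              exact ⟨by omega, fun h => h1 h.1⟩
            · rw [Equiv.swap_apply_of_ne_of_ne h3 h4] at hcd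
              exact ⟨hcd, fun h => h1 h.1⟩
    obtain ⟨hσ, hσ'⟩ := hσ
    have hab' : σ a < σ b := Fin.lt_def.2 (by omega)
    congr 1
    funext t
    -- Moving past `elemGL b a t` costs at most one commutator, in the root group of `(b, d)` or
    -- `(c, a)`; adjacency of `a` and `b` keeps it in the Borel subgroup of `σ`.
    by_cases h1 : a = c
    · subst h1
      have hdb : b ≠ d := fun h => hσ' ⟨rfl, h.symm⟩
      have hbd : σ b < σ d := by
        have : (σ d : ℕ) ≠ σ b := fun h => hdb (σ.injective (Fin.ext h)).symm
        rw [Fin.lt_def] at hσ ⊢; omega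
      rw [elemGL_mul_right hne hdb hcd', mul_assoc, mul_assoc, hf.unipotent _ _ hbd,
        hf.unipotent _ _ hσ]
    · by_cases h2 : d = b
      · subst h2
        have hca : σ c < σ a := by
          have : (σ c : ℕ) ≠ σ a := fun h => h1 (σ.injective (Fin.ext h)).symm
          rw [Fin.lt_def] at hσ ⊢; omega
        rw [elemGL_mul_left hne (Ne.symm h1) hcd', mul_assoc, mul_assoc, hf.unipotent _ _ hca,
          hf.unipotent _ _ hσ]
      · rw [elemGL_comm hne.symm hcd' h1 h2, mul_assoc, hf.unipotent _ _ hσ]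
  · simp only [← mul_assoc]
    have hs := norm_eq_zpow_deg hF s.ne_zero
    have hs' : ((‖(s : F)‖ : ℝ) : ℂ) = (residueCard F : ℂ) ^ deg (s : F) := by rw [hs]; simp
    -- The torus rescales `t` when it sits at `a` or `b`, which gives the factor `‖s‖` or its
    -- inverse.
    by_cases hcb : c = b
    · subst hcb
      simp only [elemGL_mul_torGL_row hne]
      rw [integral_comp_mul_left μ hF (s⁻¹).ne_zero (fun t => f (torGL c s * elemGL c a t * g))]
      simp only [mul_assoc, hf.torus, integral_const_mul]
      simp only [swapChar, Function.update_self, mul_zpow]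
      rw [← hs', Units.val_inv_eq_inv_val, norm_inv, inv_inv]
      ring
    · by_cases hca : c = a
      · subst hca
        simp only [elemGL_mul_torGL_col hne]
        rw [integral_comp_mul_left μ hF s.ne_zero (fun t => f (torGL c s * elemGL b c t * g))]
        simp only [mul_assoc, hf.torus, integral_const_mul]
        simp only [swapChar, Function.update_of_ne hne, Function.update_self, div_zpow]
        rw [← hs']
        push_cast
        ring
      · simp only [elemGL_mul_torGL_comm hne hca hcb, mul_assoc, hf.torus, integral_const_mul]
        simp [swapChar, hca, hcb]

/-- Absolute values stay in the same class of functions, so absolute convergence of iterated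
integrals can be proved by the same induction. -/
theorem BorelEquivariant.norm {σ : Equiv.Perm (Fin n)} {y : Fin n → ℂ}
    {f : GL (Fin n) F → ℂ} (hf : BorelEquivariant σ y f) :
    BorelEquivariant σ (fun a => ((‖y a‖ : ℝ) : ℂ)) fun g => ((‖f g‖ : ℝ) : ℂ) :=
  ⟨fun a => by simpa using hf.ne_zero a, fun a b hab t g => by rw [hf.unipotent a b hab],
    fun a s g => by rw [hf.torus]; simp⟩

theorem BorelEquivariant.elem_large (hF : IsNormalizedAbs F) {σ : Equiv.Perm (Fin n)} {y : Fin n → ℂ}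
    {f : GL (Fin n) F → ℂ} (hf : BorelEquivariant σ y f) {a b : Fin n} (hab : σ a < σ b)
    (t : Fˣ) (g : GL (Fin n) F) : f (elemGL b a (t : F) * g) =
      (y b / y a) ^ deg (t : F) * f (reflGL F a b * (elemGL a b ((t⁻¹ : Fˣ) : F) * g)) := by
  have hne : a ≠ b := by rintro rfl; exact lt_irrefl _ hab
  rw [elemGL_bruhat hne, mul_assoc, hf.unipotent a b hab, mul_assoc, hf.torus, mul_assoc, hf.torus,
    Units.val_inv_eq_inv_val, deg_inv hF t.ne_zero, mul_assoc, zpow_neg, div_zpow]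
  ring

/-- Tail integrals of unramified characters. -/
theorem integral_tail (hF : IsNormalizedAbs F) (N : ℕ) (ρ : ℂ) (hρ : ‖ρ‖ * residueCard F < 1)
    {h : F → ℂ} (hh : ∀ t : F, (residueCard F : ℝ) ^ N ≤ ‖t‖ → h t = ρ ^ deg t) :
    IntegrableOn h {t | (residueCard F : ℝ) ^ N ≤ ‖t‖} μ ∧
      ∫ t in {t | (residueCard F : ℝ) ^ N ≤ ‖t‖}, h t ∂μ =
        (μ.real (Metric.sphere (0 : F) 1) : ℂ) * (ρ * residueCard F) ^ N *
          (1 - ρ * residueCard F)⁻¹ := by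
  have hq1 : (1 : ℝ) < residueCard F := by exact_mod_cast one_lt_residueCard (F := F)
  have hq := residueCard_pos (F := F)
  -- The tail is the union of spheres of radius `q ^ (N + m)`, of measure `q ^ (N + m)` times that
  -- of the unit sphere. The integral is thus a geometric series of ratio `ρ * q`.
  let S : ℕ → Set F := fun m => Metric.sphere 0 ((residueCard F : ℝ) ^ (N + m))
  have hS : {t : F | (residueCard F : ℝ) ^ N ≤ ‖t‖} = ⋃ m, S m := by
    ext t
    simp only [Set.mem_ofPred_eq, Set.mem_iUnion, S, mem_sphere_zero_iff_norm]
    constructor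
    · intro ht
      have ht0 : t ≠ 0 := by
        rintro rfl
        rw [norm_zero] at ht
        exact absurd ht (not_le.2 (by positivity))
      rw [norm_eq_zpow_deg hF ht0] at ht ⊢
      have h1 : (N : ℤ) ≤ deg t := by
        rw [← zpow_natCast] at ht
        exact (zpow_le_zpow_iff_right₀ hq1).1 ht
      refine ⟨(deg t - N).toNat, ?_⟩
      rw [← zpow_natCast]
      congr 1
      push_cast
      omega
    · rintro ⟨m, hm⟩
      rw [hm]
      exact pow_le_pow_right₀ hq1.le (by omega)
  have hdeg : ∀ m, ∀ t ∈ S m, h t = ρ ^ (N + m) := by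
    intro m t ht
    have ht' : ‖t‖ = (residueCard F : ℝ) ^ (N + m) := by simpa [S] using ht
    rw [hh t (by rw [ht']; exact pow_le_pow_right₀ hq1.le (by omega)),
      deg_eq (n := ((N + m : ℕ) : ℤ)) (by rw [ht', zpow_natCast]), zpow_natCast]
  have hSm : ∀ m, MeasurableSet (S m) := fun m => Metric.isClosed_sphere.measurableSet
  have hμS : ∀ m, μ (S m) = ENNReal.ofReal ((residueCard F : ℝ) ^ (N + m)) * μ (Metric.sphere 0 1) := by
    intro m
    obtain ⟨x, hx0, hx⟩ := exists_norm_eq hF ((N + m : ℕ) : ℤ)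
    rw [zpow_natCast] at hx
    rw [← measure_preimage_mul_left μ hF hx0 (S m), hx]
    congr 2
    ext t
    simp [S, hx, hq.ne']
  have hfin : μ (Metric.sphere (0 : F) 1) ≠ ⊤ := (isCompact_sphere 0 1).measure_lt_top.ne
  have hμr : ∀ m, μ.real (S m) = (residueCard F : ℝ) ^ (N + m) * μ.real (Metric.sphere 0 1) := by
    intro m
    rw [measureReal_def, hμS, ENNReal.toReal_mul, ENNReal.toReal_ofReal (by positivity),
      measureReal_def]
  have hint : ∀ m, IntegrableOn h (S m) μ := by
    intro m
    refine IntegrableOn.congr_fun (f := fun _ => ρ ^ (N + m)) ?_ (fun t ht => (hdeg m t ht).symm)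
      (hSm m)
    exact integrableOn_const ((isCompact_sphere _ _).measure_lt_top.ne)
  have hval : ∀ m, ∫ t in S m, h t ∂μ =
      (μ.real (Metric.sphere (0 : F) 1) : ℂ) * (ρ * residueCard F) ^ N * (ρ * residueCard F) ^ m := by
    intro m
    rw [setIntegral_congr_fun (hSm m) (hdeg m), setIntegral_const, hμr, Complex.real_smul]
    push_cast
    ring
  have hsum : Summable fun m => ∫ t in S m, ‖h t‖ ∂μ := by
    have : ∀ m, ∫ t in S m, ‖h t‖ ∂μ = (μ.real (Metric.sphere (0 : F) 1)) *
        (‖ρ‖ * residueCard F) ^ N * (‖ρ‖ * residueCard F) ^ m := by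
      intro m
      rw [setIntegral_congr_fun (g := fun _ => ‖ρ‖ ^ (N + m)) (hSm m)
        (fun t ht => by simp [hdeg m t ht]), setIntegral_const, hμr, smul_eq_mul]
      ring
    simp only [this]
    exact (summable_geometric_of_lt_one (by positivity) hρ).mul_left _
  have hI : IntegrableOn h (⋃ m, S m) μ :=
    integrableOn_iUnion_of_summable_integral_norm hint hsum
  refine ⟨hS ▸ hI, ?_⟩
  have hdisj : Pairwise (Function.onFun Disjoint S) := by
    intro m m' hm
    refine Set.disjoint_left.2 fun t ht ht' => hm ?_
    have h1 : ‖t‖ = (residueCard F : ℝ) ^ (N + m) := by simpa [S] using ht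
    have h2 : ‖t‖ = (residueCard F : ℝ) ^ (N + m') := by simpa [S] using ht'
    have := pow_right_injective₀ hq hq1.ne' (h1.symm.trans h2)
    omega
  have h1 := hasSum_integral_iUnion hSm hdisj hI
  rw [← hS] at h1
  refine h1.unique ?_
  simp only [hval]
  have hlt : ‖ρ * (residueCard F : ℂ)‖ < 1 := by simpa using hρ
  exact (hasSum_geometric_of_norm_lt_one hlt).mul_left
    ((μ.real (Metric.sphere (0 : F) 1) : ℂ) * (ρ * residueCard F) ^ N)

/-- The intertwining integral along one root. -/
theorem exists_evalSpan_step (hF : IsNormalizedAbs F) {U : Set (GL (Fin n) F)} (hU : U ∈ 𝓝 1)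
    (a b : Fin n) (g : GL (Fin n) F) :
    ∃ (N : ℕ) (A : (GL (Fin n) F → ℂ) →ₗ[ℂ] ℂ) (w : GL (Fin n) F), A ∈ evalSpan (GL (Fin n) F) ∧
      ∀ (σ : Equiv.Perm (Fin n)) (y : Fin n → ℂ) (f : GL (Fin n) F → ℂ), σ a < σ b → RInv U f →
        BorelEquivariant σ y f → ‖y b / y a‖ * residueCard F < 1 →
        Integrable (fun t => f (elemGL b a t * g)) μ ∧
        ∫ t, f (elemGL b a t * g) ∂μ = A f + f w *
          ((μ.real (Metric.sphere (0 : F) 1) : ℂ) * (y b / y a * residueCard F) ^ N *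
          (1 - y b / y a * residueCard F)⁻¹) := by
  have hq1 : (1 : ℝ) < residueCard F := by exact_mod_cast one_lt_residueCard (F := F)
  have hcont : Continuous fun t : F => g⁻¹ * (elemGL a b t * g) := by
    have := continuous_elemGL (F := F) a b
    fun_prop
  have h0 : (fun t : F => g⁻¹ * (elemGL a b t * g)) ⁻¹' U ∈ 𝓝 0 :=
    hcont.tendsto' 0 1 (by simp [elemGL_zero]) hU
  obtain ⟨δ, hδ, hδU⟩ := Metric.mem_nhds_iff.1 h0
  -- `N` is chosen so that `‖t‖ ≥ q ^ N` forces `‖t⁻¹‖ < δ`; it depends on `U`, `a`, `b` and `g` but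
  -- not on the function.
  obtain ⟨N, hN⟩ := pow_unbounded_of_one_lt δ⁻¹ hq1
  have hNδ : ((residueCard F : ℝ) ^ N)⁻¹ < δ := inv_lt_of_inv_lt₀ hδ hN
  let Ω : Set F := Metric.ball 0 ((residueCard F : ℝ) ^ N)
  have hΩc : IsCompact Ω := (isCompact_closedBall (0 : F) _).of_isClosed_subset
    (IsUltrametricDist.isClosed_ball _ _) Metric.ball_subset_closedBall
  have hΩm : MeasurableSet Ω := Metric.isOpen_ball.measurableSet
  obtain ⟨A, hA, hAf⟩ := exists_evalSpan_setIntegral (ν := μ) hΩc hΩm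
    (x := fun t => elemGL b a t * g) (by have := continuous_elemGL (F := F) b a; fun_prop)
    (θ := fun _ => 1) (integrableOn_const hΩc.measure_lt_top.ne) hU
  refine ⟨N, A, reflGL F a b * g, hA, fun σ y f hab hfU hf hρ => ?_⟩
  obtain ⟨hi1, he1⟩ := hAf f hfU
  simp only [mul_one] at hi1 he1
  have hc : Ωᶜ = {t | (residueCard F : ℝ) ^ N ≤ ‖t‖} := by
    ext t; simp [Ω]
  -- Outside the ball the Bruhat relation leaves a power of the character ratio times one value of
  -- `f`; inside it `exists_evalSpan_setIntegral` applies.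
  have hlarge : ∀ t : F, (residueCard F : ℝ) ^ N ≤ ‖t‖ →
      f (elemGL b a t * g) = (y b / y a) ^ deg t * f (reflGL F a b * g) := by
    intro t ht
    have ht0 : t ≠ 0 := by
      rintro rfl
      rw [norm_zero] at ht
      exact absurd ht (not_le.2 (by positivity))
    have h1 := hf.elem_large hF hab (Units.mk0 t ht0) g
    rw [Units.val_mk0] at h1
    rw [h1]
    congr 1
    have hmem : g⁻¹ * (elemGL a b (((Units.mk0 t ht0)⁻¹ : Fˣ) : F) * g) ∈ U := by
      refine hδU ?_
      simp only [Metric.mem_ball, dist_zero_right, Units.val_inv_eq_inv_val, Units.val_mk0, norm_inv]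
      exact lt_of_le_of_lt (inv_anti₀ (by positivity) ht) hNδ
    rw [← hfU (reflGL F a b * g) _ hmem]
    congr 1
    simp [mul_assoc]
  obtain ⟨hi2, he2⟩ := integral_tail μ hF N (y b / y a) hρ (h := fun t => (y b / y a) ^ deg t)
    (fun t _ => rfl)
  have hm2 : MeasurableSet {t : F | (residueCard F : ℝ) ^ N ≤ ‖t‖} := hc ▸ hΩm.compl
  have hi3 : IntegrableOn (fun t => f (elemGL b a t * g)) Ωᶜ μ := by
    rw [hc]
    exact IntegrableOn.congr_fun (hi2.mul_const _) (fun t ht => (hlarge t ht).symm) hm2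
  have hint : Integrable (fun t => f (elemGL b a t * g)) μ := by
    rw [← integrableOn_univ, ← Set.union_compl_self Ω]
    exact hi1.union hi3
  refine ⟨hint, ?_⟩
  rw [← integral_add_compl hΩm hint, he1, hc, setIntegral_congr_fun hm2 (fun t ht => hlarge t ht),
    integral_mul_const, he2]
  ring

end RankOne

/-! ### Successive intertwining integrals: convergence and meromorphic continuation. -/

section Chains

variable {F : Type*} [NontriviallyNormedField F] [IsUltrametricDist F] [ProperSpace F]
  {n k : ℕ}

/-- A list of successive adjacent transpositions, starting from the order `σ`. -/
def IsSwapChain : Equiv.Perm (Fin n) → List (Fin n × Fin n) → Prop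
  | _, [] => True
  | σ, p :: L => (σ p.2 : ℕ) = σ p.1 + 1 ∧ IsSwapChain ((Equiv.swap p.1 p.2).trans σ) L

variable (F) in
/-- The conditions for the convergence of the successive intertwining integrals. -/
def ConvChain {𝕂 : Type*} [NormedField 𝕂] : (Fin n → 𝕂) → List (Fin n × Fin n) → Prop
  | _, [] => True
  | y, p :: L => ‖y p.2 / y p.1‖ * residueCard F < 1 ∧ ConvChain (swapChar F p.1 p.2 y) L

/-- The product of the elementary matrices attached to a list. -/
noncomputable def chainProd : (L : List (Fin n × Fin n)) → (Fin L.length → F) → GL (Fin n) F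
  | [], _ => 1
  | p :: L, t => elemGL p.2 p.1 (t 0) * chainProd L fun i => t i.succ

theorem continuous_chainProd (L : List (Fin n × Fin n)) :
    Continuous (chainProd (F := F) L) := by
  induction L with
  | nil => exact continuous_const
  | cons p L ih =>
    refine Continuous.mul ?_ ?_
    · exact (continuous_elemGL p.2 p.1).comp (continuous_apply 0)
    · exact ih.comp (continuous_pi fun i => continuous_apply i.succ)

/-- The condition on `L` makes all cross terms in the product of the elementary matrices vanish, so
the chain parameters are literally matrix entries. -/
theorem chainProd_val (L : List (Fin n × Fin n)) (hne : ∀ p ∈ L, p.1 ≠ p.2)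
    (hL : L.Pairwise fun p p' => p.1 ≠ p'.2) (t : Fin L.length → F) :
    (chainProd L t).val = 1 + ∑ i, Matrix.single (L.get i).2 (L.get i).1 (t i) := by
  induction L with
  | nil => simp [chainProd]
  | cons p L ih =>
    rw [List.pairwise_cons] at hL
    have h0 : Matrix.single p.2 p.1 (t 0) *
        ∑ i : Fin L.length, Matrix.single (L.get i).2 (L.get i).1 (t i.succ) = 0 := by
      rw [Finset.mul_sum]
      exact Finset.sum_eq_zero fun i _ =>
        single_mul_single_eq_zero (hL.1 _ (List.get_mem _ _)) _ _
    simp only [chainProd, Units.val_mul]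
    rw [ih (fun q hq => hne q (List.mem_cons_of_mem _ hq)) hL.2,
      elemGL_val (hne p List.mem_cons_self).symm, mul_add, mul_one, add_mul, one_mul, h0, add_zero]
    change _ = 1 + ∑ i : Fin (L.length + 1), _
    rw [Fin.sum_univ_succ, ← add_assoc]
    rfl

theorem swapChar_norm (a b : Fin n) (y : Fin n → ℂ) :
    (fun c => ‖swapChar F a b y c‖) = swapChar F a b fun c => ‖y c‖ := by
  funext c
  simp only [swapChar]
  by_cases hcb : c = b
  · subst hcb; simp
  · by_cases hca : c = a
    · subst hca; simp [hcb]
    · simp [hcb, hca]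

theorem convChain_norm (L : List (Fin n × Fin n)) (y : Fin n → ℂ) :
    ConvChain F (fun c => ‖y c‖) L ↔ ConvChain F y L := by
  induction L generalizing y with
  | nil => exact Iff.rfl
  | cons p L ih =>
    simp only [ConvChain]
    rw [← swapChar_norm, ih]
    simp

theorem convChain_ofReal (L : List (Fin n × Fin n)) (y : Fin n → ℂ) :
    ConvChain F (fun c => ((‖y c‖ : ℝ) : ℂ)) L ↔ ConvChain F y L := by
  rw [← convChain_norm, ← convChain_norm L y]
  simp

variable [MeasurableSpace F] [BorelSpace F] (μ : Measure F) [μ.IsAddHaarMeasure]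

theorem measure_pi_fin_zero (μ : Measure F) : (Measure.pi fun _ : Fin 0 => μ) Set.univ = 1 := by
  rw [Measure.pi_of_empty]; simp

theorem comp_chainProd_cons (p : Fin n × Fin n) (L : List (Fin n × Fin n))
    (f : GL (Fin n) F → ℂ) (g : GL (Fin n) F) :
    (fun t => f (chainProd (p :: L) t * g)) =
      (fun z : F × (Fin L.length → F) => f (elemGL p.2 p.1 z.1 * (chainProd L z.2 * g))) ∘
        MeasurableEquiv.piFinSuccAbove (fun _ : Fin (L.length + 1) => F) 0 := by
  funext t
  simp only [Function.comp_apply, chainProd, mul_assoc]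
  rfl

/-- Tonelli one root at a time: the inner integral of `‖f‖` is again equivariant, for the swapped
order, and has the same level because the integration acts on the left. The induction therefore
applies to it. -/
theorem chain_integrable (hF : IsNormalizedAbs F) {U : Set (GL (Fin n) F)} (hU : U ∈ 𝓝 1)
    (L : List (Fin n × Fin n)) {σ : Equiv.Perm (Fin n)} (hL : IsSwapChain σ L) {y : Fin n → ℂ}
    {f : GL (Fin n) F → ℂ} (hf : BorelEquivariant σ y f) (hfU : RInv U f) (hc : ConvChain F y L)
    (g : GL (Fin n) F) :
    Integrable (fun t => f (chainProd L t * g)) (Measure.pi fun _ => μ) := by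
  induction L generalizing σ y f g with
  | nil =>
    simp only [chainProd]
    exact integrable_const_iff.2 (Or.inr (by
      rw [isFiniteMeasure_iff]
      change (Measure.pi fun _ : Fin 0 => μ) Set.univ < ⊤
      rw [measure_pi_fin_zero]; exact ENNReal.one_lt_top))
  | cons p L ih =>
    have hstep := hf.norm.step μ hF hL.1
    have hconv := (convChain_ofReal (p :: L) y).2 hc
    have hlt : σ p.1 < σ p.2 := Fin.lt_def.2 (by rw [hL.1]; exact Nat.lt_succ_self _)
    have hFU : RInv U fun g => ∫ t, ((‖f (elemGL p.2 p.1 t * g)‖ : ℝ) : ℂ) ∂μ := by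
      intro g x hx
      simp only [← mul_assoc, hfU _ x hx]
    have h1 : ∀ g, Integrable (fun t => f (elemGL p.2 p.1 t * g)) μ := fun g => by
      obtain ⟨N, A, w, -, h⟩ := exists_evalSpan_step μ hF hU p.1 p.2 g
      exact (h σ y f hlt hfU hf hc.1).1
    have h2 := ih hL.2 (y := swapChar F p.1 p.2 fun c => ((‖y c‖ : ℝ) : ℂ))
      (f := fun g => ∫ t, ((‖f (elemGL p.2 p.1 t * g)‖ : ℝ) : ℂ) ∂μ) hstep hFU hconv.2
    have hfc := hfU.continuous hU
    have hm := measurePreserving_piFinSuccAbove (fun _ : Fin (L.length + 1) => μ) 0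
    have hcp := continuous_chainProd (F := F) L
    have hce := continuous_elemGL (F := F) p.2 p.1
    have h3 : Integrable (fun z : F × (Fin L.length → F) =>
        f (elemGL p.2 p.1 z.1 * (chainProd L z.2 * g))) (μ.prod (Measure.pi fun _ => μ)) := by
      have hcont : Continuous (fun z : F × (Fin L.length → F) =>
        f (elemGL p.2 p.1 z.1 * (chainProd L z.2 * g))) := by fun_prop
      rw [integrable_prod_iff' hcont.aestronglyMeasurable]
      refine ⟨Eventually.of_forall fun t => h1 (chainProd L t * g), ?_⟩
      refine (h2 g).norm.congr (Eventually.of_forall fun t => ?_)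
      simp only
      rw [integral_complex_ofReal, Complex.norm_real, Real.norm_of_nonneg]
      exact integral_nonneg fun _ => norm_nonneg _
    have h4 := (hm.integrable_comp_emb (MeasurableEquiv.measurableEmbedding _)).2 h3
    rwa [← comp_chainProd_cons] at h4

theorem integral_chainProd_cons (p : Fin n × Fin n) (L : List (Fin n × Fin n))
    {f : GL (Fin n) F → ℂ} (g : GL (Fin n) F)
    (h : Integrable (fun t => f (chainProd (p :: L) t * g)) (Measure.pi fun _ => μ)) :
    ∫ t, f (chainProd (p :: L) t * g) ∂(Measure.pi fun _ => μ) =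
      ∫ t, ∫ s, f (elemGL p.2 p.1 s * (chainProd L t * g)) ∂μ ∂(Measure.pi fun _ => μ) := by
  have hm := measurePreserving_piFinSuccAbove (fun _ : Fin (L.length + 1) => μ) 0
  rw [comp_chainProd_cons] at h ⊢
  have h2 := (hm.integrable_comp_emb (MeasurableEquiv.measurableEmbedding _)).1 h
  rw [← integral_prod_symm _ h2]
  exact hm.integral_comp (MeasurableEquiv.measurableEmbedding _)
    (fun z : F × (Fin L.length → F) => f (elemGL p.2 p.1 z.1 * (chainProd L z.2 * g)))

/-- Each coordinate is only multiplied by a constant, so ratios remain Laurent polynomials along the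
chain. -/
theorem swapChar_div_mem (a b : Fin n) {y : (Fin k → ℂ) → Fin n → ℂ}
    (hy : ∀ c d, (fun ζ => y ζ c / y ζ d) ∈ entireFun F k) (c d : Fin n) :
    (fun ζ => swapChar F a b (y ζ) c / swapChar F a b (y ζ) d) ∈ entireFun F k := by
  have h : ∀ c, ∃ m : ℂ, ∀ y : Fin n → ℂ, swapChar F a b y c = m * y c := by
    intro c
    by_cases hcb : c = b
    · subst hcb
      exact ⟨residueCard F, fun y => by simp [swapChar, mul_comm]⟩
    · by_cases hca : c = a
      · subst hca
        exact ⟨(residueCard F : ℂ)⁻¹, fun y => by simp [swapChar, hcb, div_eq_inv_mul]⟩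
      · exact ⟨1, fun y => by simp [swapChar, hcb, hca]⟩
  obtain ⟨m, hm⟩ := h c
  obtain ⟨m', hm'⟩ := h d
  convert! Subalgebra.smul_mem _ (hy c d) (m / m') using 1
  funext ζ
  simp [hm, hm', mul_div_mul_comm]

/-- Meromorphic continuation of the successive intertwining integrals. -/
theorem chain_continuation (hF : IsNormalizedAbs F) {U : Set (GL (Fin n) F)} (hU : U ∈ 𝓝 1)
    (R : ℝ) (L : List (Fin n × Fin n)) {σ : Equiv.Perm (Fin n)} (hL : IsSwapChain σ L)
    {y : (Fin k → ℂ) → Fin n → ℂ} (hy : ∀ c d, (fun ζ => y ζ c / y ζ d) ∈ entireFun F k)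
    {f : (Fin k → ℂ) → GL (Fin n) F → ℂ} (hf : ∀ ζ ∈ cone k R, BorelEquivariant σ (y ζ) (f ζ))
    (hfU : ∀ ζ ∈ cone k R, RInv U (f ζ)) (hfe : ∀ g, (fun ζ => f ζ g) ∈ entireFun F k)
    (hc : ∀ ζ ∈ cone k R, ConvChain F (y ζ) L) :
    ∃ D ∈ entireFun F k, D ≠ 0 ∧ ∃ N : (Fin k → ℂ) → GL (Fin n) F → ℂ,
      (∀ g, (fun ζ => N ζ g) ∈ entireFun F k) ∧
      ∀ ζ ∈ cone k R, ∀ g, N ζ g =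
        D ζ * ∫ t, f ζ (chainProd L t * g) ∂(Measure.pi fun _ => μ) := by
  induction L generalizing σ y f with
  | nil =>
    refine ⟨1, one_mem _, one_ne_zero, f, hfe, fun ζ _ g => ?_⟩
    simp only [chainProd, one_mul, Pi.one_apply]
    rw [integral_const, measureReal_def]
    change f ζ g = ((Measure.pi fun _ : Fin 0 => μ) Set.univ).toReal • f ζ g
    rw [measure_pi_fin_zero]; simp
  | cons p L ih =>
    have hlt : σ p.1 < σ p.2 := Fin.lt_def.2 (by rw [hL.1]; exact Nat.lt_succ_self _)
    -- The denominator of the geometric series of one step. The convergence condition keeps it away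
    -- from zero on the cone.
    let D₁ : (Fin k → ℂ) → ℂ := fun ζ => 1 - y ζ p.2 / y ζ p.1 * residueCard F
    have hD₁ : D₁ ∈ entireFun F k :=
      sub_mem (const_mem_entireFun 1) (mul_mem (hy p.2 p.1) (const_mem_entireFun _))
    have hD₁' : ∀ ζ ∈ cone k R, D₁ ζ ≠ 0 := by
      intro ζ hζ h
      have h1 := (hc ζ hζ).1
      have h2 : y ζ p.2 / y ζ p.1 * residueCard F = 1 := (sub_eq_zero.1 h).symm
      have h3 := congrArg (fun z : ℂ => ‖z‖) h2
      simp only [norm_mul, Complex.norm_natCast, norm_one] at h3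
      exact h1.ne h3
    have hstep : ∀ g, ∃ e ∈ entireFun F k, ∀ ζ ∈ cone k R,
        e ζ = D₁ ζ * ∫ t, f ζ (elemGL p.2 p.1 t * g) ∂μ := by
      intro g
      obtain ⟨N, A, w, hA, h⟩ := exists_evalSpan_step μ hF hU p.1 p.2 g
      refine ⟨fun ζ => D₁ ζ * A (f ζ) + f ζ w * ((μ.real (Metric.sphere (0 : F) 1) : ℂ) *
        (y ζ p.2 / y ζ p.1 * residueCard F) ^ N), ?_, fun ζ hζ => ?_⟩
      · refine add_mem (mul_mem hD₁ (mem_entireFun_of_evalSpan hA hfe)) (mul_mem (hfe w) ?_)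
        exact mul_mem (const_mem_entireFun _)
          (pow_mem (mul_mem (hy p.2 p.1) (const_mem_entireFun _)) N)
      · rw [(h σ (y ζ) (f ζ) hlt (hfU ζ hζ) (hf ζ hζ) (hc ζ hζ).1).2]
        have := hD₁' ζ hζ
        simp only [D₁] at this ⊢
        generalize y ζ p.2 / y ζ p.1 * (residueCard F : ℂ) = z at this ⊢
        field_simp
    choose e he he' using hstep
    -- The induction runs on `e`, Laurent polynomial for all `ζ` and equal to `D₁` times the inner
    -- integral on the cone. Equivariance and level are needed on the cone only.
    obtain ⟨D₂, hD₂, hD₂0, N, hN, hN'⟩ := ih (σ := (Equiv.swap p.1 p.2).trans σ) hL.2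
      (y := fun ζ => swapChar F p.1 p.2 (y ζ)) (swapChar_div_mem p.1 p.2 hy)
      (f := fun ζ g => e g ζ)
      (fun ζ hζ => by
        have h1 := (hf ζ hζ).step μ hF hL.1
        refine ⟨h1.ne_zero, fun a b hab t g => ?_, fun a s g => ?_⟩
        · simp only [he' _ ζ hζ]
          rw [h1.unipotent a b hab t g]
        · simp only [he' _ ζ hζ]
          rw [h1.torus a s g]
          ring)
      (fun ζ hζ g x hx => by
        simp only [he' _ ζ hζ, ← mul_assoc, hfU ζ hζ _ x hx])
      he (fun ζ hζ => (hc ζ hζ).2)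
    have hD₁0 : D₁ ≠ 0 := by
      obtain ⟨ζ, hζ⟩ := cone_nonempty (k := k) R
      exact fun h => hD₁' ζ hζ (congrFun h ζ)
    refine ⟨D₂ * D₁, mul_mem hD₂ hD₁, entireFun_mul_ne_zero hD₂ hD₁ hD₂0 hD₁0, N, hN,
      fun ζ hζ g => ?_⟩
    rw [hN' ζ hζ g, integral_chainProd_cons μ p L g
      (chain_integrable μ hF hU (p :: L) hL (hf ζ hζ) (hfU ζ hζ) (hc ζ hζ) g)]
    simp only [he' _ ζ hζ, integral_const_mul, Pi.mul_apply]
    ring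

end Chains

/-! ### Reduced decompositions of permutations. -/

section Combinatorics

variable {n : ℕ}

/-- The pairs whose order changes from `σ` to `σ'`. -/
def inversions (σ σ' : Equiv.Perm (Fin n)) : Finset (Fin n × Fin n) :=
  Finset.univ.filter fun p => σ p.1 < σ p.2 ∧ σ' p.2 < σ' p.1

theorem mem_inversions {σ σ' : Equiv.Perm (Fin n)} {p : Fin n × Fin n} :
    p ∈ inversions σ σ' ↔ σ p.1 < σ p.2 ∧ σ' p.2 < σ' p.1 := by
  simp [inversions]

/-- A path from the order `σ` to `σ'` by adjacent swaps, removing one inversion each time. Always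
moving the inverted index that is earliest in the current order gives the last clause, needed in
`chainProd_val`. -/
theorem exists_swapChain (σ' : Equiv.Perm (Fin n)) (m : ℕ) (σ : Equiv.Perm (Fin n))
    (hm : (inversions σ σ').card = m) :
    ∃ L : List (Fin n × Fin n), IsSwapChain σ L ∧ L.Nodup ∧ (∀ p, p ∈ L ↔ p ∈ inversions σ σ') ∧
      L.Pairwise fun p p' => p.1 ≠ p'.2 := by
  induction m generalizing σ with
  | zero =>
    refine ⟨[], trivial, List.nodup_nil, fun p => ?_, List.Pairwise.nil⟩
    rw [Finset.card_eq_zero.1 hm]; simp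
  | succ m ih =>
    have hne : ((inversions σ σ').image Prod.snd).Nonempty := by
      rw [Finset.image_nonempty, ← Finset.card_pos]; omega
    obtain ⟨b, hb, hmin⟩ := Finset.exists_min_image _ (fun b => σ b) hne
    obtain ⟨⟨a₀, b'⟩, hab, rfl⟩ := Finset.mem_image.1 hb
    simp only at hmin
    have hab' : σ a₀ < σ b' ∧ σ' b' < σ' a₀ := mem_inversions.1 hab
    have hpos : 0 < (σ b' : ℕ) := by have := Fin.lt_def.1 hab'.1; omega
    have hnb := (σ b').2
    -- `a` is the immediate predecessor of `b'` in the current order.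
    let a : Fin n := σ.symm ⟨σ b' - 1, by omega⟩
    have ha : (σ b' : ℕ) = σ a + 1 := by simp [a]; omega
    have hmin' : ∀ c d, σ c < σ d → σ' d < σ' c → σ b' ≤ σ d := fun c d h1 h2 =>
      hmin d (Finset.mem_image.2 ⟨(c, d), mem_inversions.2 ⟨h1, h2⟩, rfl⟩)
    -- If `(a, b')` were not inverted, then `(a₀, a)` would be an inversion whose second index comes
    -- before `b'`, against minimality.
    have hinv : σ' b' < σ' a := by
      by_cases h : a₀ = a
      · rw [← h]; exact hab'.2
      · have h1 : σ a₀ < σ a := by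
          have h2 : (σ a₀ : ℕ) ≠ σ a := fun h3 => h (σ.injective (Fin.ext h3))
          have := Fin.lt_def.1 hab'.1
          exact Fin.lt_def.2 (by omega)
        by_contra h2
        have h3 := hmin' a₀ a h1 (lt_of_le_of_lt (not_lt.1 h2) hab'.2)
        have := Fin.le_def.1 h3
        omega
    have hneab : a ≠ b' := by intro h; rw [h] at ha; omega
    have hinvs : inversions ((Equiv.swap a b').trans σ) σ' = (inversions σ σ').erase (a, b') := by
      ext ⟨c, d⟩
      have hinj : ∀ x y, ((σ x : ℕ) = σ y) → x = y := fun x y h => σ.injective (Fin.ext h)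
      rw [Finset.mem_erase, mem_inversions, mem_inversions]
      simp only [ne_eq, Prod.mk.injEq, Equiv.trans_apply]
      constructor
      · rintro ⟨h1, h2⟩
        have hcd : c ≠ d := by rintro rfl; exact lt_irrefl _ h1
        rw [Fin.lt_def] at h1 ⊢
        rw [Equiv.swap_apply_def, Equiv.swap_apply_def] at h1
        have e1 := hinj c d
        have e2 := hinj a c
        have e3 := hinj a d
        have e4 := hinj c b'
        have e5 := hinj d b'
        split_ifs at h1 with i1 i2 i3 i4 i5 i6
        all_goals (try subst_vars)
        all_goals (try (exact absurd h2 (not_lt.2 hinv.le)))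
        all_goals (try (exact absurd rfl hcd))
        all_goals (refine ⟨?_, ?_, h2⟩)
        all_goals (try omega)
      · rintro ⟨h0, h1, h2⟩
        refine ⟨?_, h2⟩
        have hcd : c ≠ d := by rintro rfl; exact lt_irrefl _ h1
        have e1 := hinj c d
        have e2 := hinj a c
        have e3 := hinj a d
        have e4 := hinj c b'
        have e5 := hinj d b'
        rw [Fin.lt_def] at h1 ⊢
        rw [Equiv.swap_apply_def, Equiv.swap_apply_def]
        split_ifs with i1 i2 i3 i4 i5 i6
        all_goals (try subst_vars)
        all_goals (try omega)
    have hmem : (a, b') ∈ inversions σ σ' := by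
      rw [mem_inversions]
      exact ⟨Fin.lt_def.2 (by simp only; omega), hinv⟩
    obtain ⟨L, hL1, hL2, hL3, hL4⟩ := ih ((Equiv.swap a b').trans σ) (by
      rw [hinvs, Finset.card_erase_of_mem hmem, hm]; rfl)
    rw [hinvs] at hL3
    refine ⟨(a, b') :: L, ⟨ha, hL1⟩, ?_, fun p => ?_, ?_⟩
    · rw [List.nodup_cons]
      exact ⟨fun h => by simpa using (hL3 _).1 h, hL2⟩
    · rw [List.mem_cons, hL3, Finset.mem_erase]
      by_cases hp : p = (a, b')
      · subst hp; simpa using hmem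
      · simp [hp]
    · rw [List.pairwise_cons]
      -- A later pair with second entry `a` would be an inversion ending before `b'`, which
      -- minimality excludes.
      refine ⟨fun p hp h => ?_, hL4⟩
      have h1 := (Finset.mem_erase.1 ((hL3 p).1 hp)).2
      rw [mem_inversions] at h1
      have h2 := hmin' p.1 p.2 h1.1 h1.2
      rw [← h] at h2
      have := Fin.le_def.1 h2
      simp only at this
      omega

end Combinatorics

/-! ### Convergence conditions on a cone, and chains as matrix coordinates. -/

section ChainCoord

variable {F : Type*} [NontriviallyNormedField F] [IsUltrametricDist F] [ProperSpace F]
  {n k : ℕ}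

theorem swapChar_mul_cpow (a b : Fin n) (C : Fin n → ℂ) (w : Fin n → ℂ) :
    swapChar F a b (fun c => C c * w c) = fun c => swapChar F a b C c * w c := by
  funext c
  by_cases hcb : c = b
  · subst hcb; simp [swapChar]; ring
  · by_cases hca : c = a
    · subst hca; simp [swapChar, hcb]; ring
    · simp [swapChar, hcb, hca]

theorem swapChar_ne_zero (a b : Fin n) {C : Fin n → ℂ} (hC : ∀ c, C c ≠ 0) (c : Fin n) :
    swapChar F a b C c ≠ 0 := by
  have hq := residueCard_cast_ne_zero (F := F)
  by_cases hcb : c = b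
  · subst hcb; simp [swapChar, hC, hq]
  · by_cases hca : c = a
    · subst hca; simp [swapChar, hcb, hC, hq]
    · simp [swapChar, hcb, hca, hC]

/-- Every pair in `L` joins an earlier block to a later one, so each ratio is a constant times `q ^
(ζ j - ζ i)` with `i < j`. It is small when `Re (ζ i - ζ j)` is large. -/
theorem exists_cone_convChain (β : Fin n → Fin k) (L : List (Fin n × Fin n))
    (hβ : ∀ p ∈ L, β p.1 < β p.2) (C : Fin n → ℂ) (hC : ∀ a, C a ≠ 0) :
    ∃ R : ℝ, 0 ≤ R ∧ ∀ ζ ∈ cone k R,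
      ConvChain F (fun a => C a * (residueCard F : ℂ) ^ ζ (β a)) L := by
  have hq1 : (1 : ℝ) < residueCard F := by exact_mod_cast one_lt_residueCard (F := F)
  have hq := residueCard_pos (F := F)
  induction L generalizing C with
  | nil => exact ⟨0, le_rfl, fun ζ _ => trivial⟩
  | cons p L ih =>
    obtain ⟨R, hR, h⟩ := ih (fun q hq => hβ q (List.mem_cons_of_mem _ hq))
      (swapChar F p.1 p.2 C) (swapChar_ne_zero p.1 p.2 hC)
    obtain ⟨N, hN⟩ := pow_unbounded_of_one_lt (‖C p.2 / C p.1‖ * residueCard F) hq1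
    refine ⟨max R N, le_max_of_le_left hR, fun ζ hζ => ⟨?_, ?_⟩⟩
    · have h1 := lt_of_mem_cone (le_max_of_le_left hR) hζ (hβ p List.mem_cons_self)
      have h2 : (N : ℝ) < (ζ (β p.1) - ζ (β p.2)).re := (le_max_right _ _).trans_lt h1
      rw [mul_div_mul_comm, norm_mul, norm_div ((residueCard F : ℂ) ^ _),
        Complex.norm_natCast_cpow_of_pos (zero_lt_one.trans one_lt_residueCard),
        Complex.norm_natCast_cpow_of_pos (zero_lt_one.trans one_lt_residueCard),
        ← Real.rpow_sub hq]
      have h3 : (residueCard F : ℝ) ^ ((ζ (β p.2)).re - (ζ (β p.1)).re) ≤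
          ((residueCard F : ℝ) ^ N)⁻¹ := by
        rw [← Real.rpow_natCast, ← Real.rpow_neg hq.le]
        refine Real.rpow_le_rpow_of_exponent_le hq1.le ?_
        rw [Complex.sub_re] at h2
        linarith
      calc ‖C p.2 / C p.1‖ * (residueCard F : ℝ) ^ ((ζ (β p.2)).re - (ζ (β p.1)).re) * residueCard F
          ≤ ‖C p.2 / C p.1‖ * ((residueCard F : ℝ) ^ N)⁻¹ * residueCard F := by gcongr
        _ = (‖C p.2 / C p.1‖ * residueCard F) / (residueCard F : ℝ) ^ N := by
          field_simp
        _ < 1 := by rw [div_lt_one (by positivity)]; exact hN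
    · rw [swapChar_mul_cpow]
      exact h ζ (cone_mono (le_max_left _ _) hζ)

variable [MeasurableSpace F] [BorelSpace F]

/-- Integrals over the lower unipotent elements supported on the inversions of a permutation. -/
theorem exists_chain_coord (σ' : Equiv.Perm (Fin n)) {ι : Type*} [Fintype ι]
    (e : ι → Fin n × Fin n) (he : Function.Injective e)
    (hr : ∀ p, p ∈ inversions (Equiv.refl _) σ' ↔ ∃ i, e i = p)
    {x : (ι → F) → GL (Fin n) F}
    (hx : ∀ t, (x t).val = 1 + ∑ i, Matrix.single (e i).2 (e i).1 (t i)) :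
    ∃ L : List (Fin n × Fin n), IsSwapChain (Equiv.refl _) L ∧
      (∀ p ∈ L, p ∈ inversions (Equiv.refl _) σ') ∧
      ∀ (μ : Measure F) [μ.IsAddHaarMeasure] (f : GL (Fin n) F → ℂ) (g : GL (Fin n) F),
        (Integrable (fun t => f (chainProd L t * g)) (Measure.pi fun _ => μ) →
          Integrable (fun t => f (x t * g)) (Measure.pi fun _ => μ)) ∧
        ∫ t, f (x t * g) ∂(Measure.pi fun _ => μ) =
          ∫ t, f (chainProd L t * g) ∂(Measure.pi fun _ => μ) := by
  obtain ⟨L, hL1, hL2, hL3, hL4⟩ := exists_swapChain σ' _ (Equiv.refl _) rfl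
  refine ⟨L, hL1, fun p hp => (hL3 p).1 hp, ?_⟩
  have h1 : ∀ i : Fin L.length, ∃ j, e j = L.get i := fun i =>
    (hr _).1 ((hL3 _).1 (List.get_mem L i))
  choose E hE using h1
  have hEb : Function.Bijective E := by
    constructor
    · intro i j hij
      have : L.get i = L.get j := by rw [← hE, ← hE, hij]
      exact List.nodup_iff_injective_get.1 hL2 this
    · intro j
      obtain ⟨i, hi⟩ := List.get_of_mem ((hL3 (e j)).2 ((hr _).2 ⟨j, rfl⟩))
      exact ⟨i, he (by rw [hE, hi])⟩
  let E' : Fin L.length ≃ ι := Equiv.ofBijective E hEb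
  -- Both sides place the same entries at the inversions; only the labelling of the coordinates
  -- differs.
  have hkey : ∀ t : Fin L.length → F,
      x (MeasurableEquiv.piCongrLeft (fun _ : ι => F) E' t) = chainProd L t := by
    intro t
    refine Units.ext ?_
    rw [hx, chainProd_val L (fun p hp h => ?_) hL4]
    · congr 1
      rw [← E'.sum_comp]
      refine Finset.sum_congr rfl fun i _ => ?_
      rw [MeasurableEquiv.coe_piCongrLeft, Equiv.piCongrLeft_apply_apply]
      have : e (E' i) = L.get i := hE i
      rw [this]
    · have := (mem_inversions.1 ((hL3 p).1 hp)).1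
      rw [h] at this
      exact lt_irrefl _ this
  intro μ _ f g
  have hm := measurePreserving_piCongrLeft (fun _ : ι => μ) E'
  have hcomp : (fun t => f (chainProd L t * g)) = (fun t => f (x t * g)) ∘
      MeasurableEquiv.piCongrLeft (fun _ : ι => F) E' := by
    funext t
    simp only [Function.comp_apply, hkey]
  rw [hcomp]
  exact ⟨(hm.integrable_comp_emb (MeasurableEquiv.measurableEmbedding _)).1,
    (hm.integral_comp (MeasurableEquiv.measurableEmbedding _) (fun t => f (x t * g))).symm⟩

end ChainCoord

/-! ### Equivariance of functions in ρ_c(τ_ζ) under block upper triangular matrices. -/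

section BlockUpper

variable {F : Type*} [NontriviallyNormedField F] {k c : ℕ}

theorem finProdFinEquiv_lt {i j : Fin k} {α β : Fin c} :
    finProdFinEquiv (i, α) < finProdFinEquiv (j, β) ↔ i < j ∨ i = j ∧ α < β := by
  have hα := α.2
  have hβ := β.2
  rw [Fin.lt_def, Fin.lt_def, Fin.lt_def, Fin.ext_iff]
  simp only [finProdFinEquiv_apply_val]
  rcases lt_trichotomy (i : ℕ) j with h | h | h
  · have : c * ((i : ℕ) + 1) ≤ c * j := Nat.mul_le_mul_left c h
    rw [Nat.mul_add, Nat.mul_one] at this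
    constructor
    · intro _; exact Or.inl h
    · intro _; omega
  · rw [h]; omega
  · have : c * ((j : ℕ) + 1) ≤ c * i := Nat.mul_le_mul_left c h
    rw [Nat.mul_add, Nat.mul_one] at this
    constructor
    · intro _; omega
    · rintro (h1 | h1) <;> omega

/-- The matrix with rows and columns indexed by blocks. -/
def blocks (x : GL (Fin (k * c)) F) : Matrix (Fin k × Fin c) (Fin k × Fin c) F :=
  x.val.submatrix finProdFinEquiv finProdFinEquiv

theorem blocks_mul (x y : GL (Fin (k * c)) F) : blocks (x * y) = blocks x * blocks y := by
  simp [blocks, Matrix.submatrix_mul_equiv]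

theorem blocks_injective : Function.Injective (blocks : GL (Fin (k * c)) F → _) := by
  intro x y h
  refine Units.ext ?_
  have := congrArg (fun A => Matrix.submatrix A finProdFinEquiv.symm finProdFinEquiv.symm) h
  simpa [blocks] using this

theorem blocks_one : blocks (1 : GL (Fin (k * c)) F) = 1 := by
  simp [blocks]

theorem blocks_unip (v : Coord k c c F) : blocks (unip v) = 1 + strictUpper v := by
  ext s t
  simp [blocks, unip, Matrix.GeneralLinearGroup.mkOfDetNeZero]

theorem blocks_levi (m : Fin k → GL (Fin c) F) (s t : Fin k × Fin c) :
    blocks (levi m) s t = if s.1 = t.1 then (m s.1).val s.2 t.2 else 0 := by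
  simp [blocks, levi, Matrix.blockDiagonal_apply]

theorem exists_levi_mul_unip (x : GL (Fin (k * c)) F)
    (hx : ∀ s t : Fin k × Fin c, t.1 < s.1 → blocks x s t = 0) :
    ∃ (m : Fin k → GL (Fin c) F) (u : Coord k c c F), x = levi m * unip u ∧
      ∀ i α β, (m i).val α β = blocks x (i, α) (i, β) := by
  have hdet : (blocks x).det ≠ 0 := by
    rw [blocks, Matrix.det_submatrix_equiv_self]
    exact ((Matrix.isUnit_iff_isUnit_det _).1 x.isUnit).ne_zero
  have hbt : (blocks x).BlockTriangular (Prod.fst : Fin k × Fin c → Fin k) := fun s t h => hx s t h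
  let B : Fin k → Matrix (Fin c) (Fin c) F := fun i => Matrix.of fun α β => blocks x (i, α) (i, β)
  have hB : ∀ i, (B i).det ≠ 0 := by
    intro i
    rw [hbt.det_fintype, Finset.prod_ne_zero_iff] at hdet
    have h1 := hdet i (Finset.mem_univ i)
    let e : Fin c ≃ {s : Fin k × Fin c // s.1 = i} :=
      { toFun := fun α => ⟨(i, α), rfl⟩
        invFun := fun s => s.1.2
        left_inv := fun α => rfl
        right_inv := by rintro ⟨⟨j, α⟩, rfl⟩; rfl }
    have h2 : B i = ((blocks x).toSquareBlock Prod.fst i).submatrix e e := by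
      ext α β; simp [B, Matrix.toSquareBlock_def, e]
    rw [h2, Matrix.det_submatrix_equiv_self]
    exact h1
  let m : Fin k → GL (Fin c) F := fun i => Matrix.GeneralLinearGroup.mkOfDetNeZero (B i) (hB i)
  have hm : ∀ i, (m i).val = B i := fun i => rfl
  let u : Coord k c c F := fun t => ∑ γ, (m t.1.1.1)⁻¹.val t.2.1 γ *
    blocks x (t.1.1.1, γ) (t.1.1.2, t.2.2)
  refine ⟨m, u, blocks_injective ?_, fun i α β => rfl⟩
  ext ⟨i, α⟩ ⟨j, β⟩
  rw [blocks_mul, blocks_unip, Matrix.mul_add, Matrix.mul_one, Matrix.add_apply, blocks_levi,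
    Matrix.mul_apply, Fintype.sum_prod_type]
  simp only [blocks_levi]
  rw [Finset.sum_eq_single i (fun j' _ hj' => by simp [Ne.symm hj']) (by simp)]
  simp only [if_true, strictUpper, Matrix.of_apply]
  rcases lt_trichotomy i j with h | h | h
  · simp only [h, h.ne, if_false, dif_pos, zero_add, u]
    have h3 : ∀ γ δ, ∑ α', (m i).val γ α' * (m i)⁻¹.val α' δ = (1 : Matrix (Fin c) (Fin c) F) γ δ := by
      intro γ δ
      rw [← Matrix.mul_apply, Units.mul_inv]
    simp only [Finset.mul_sum, ← mul_assoc]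
    rw [Finset.sum_comm]
    simp only [← Finset.sum_mul, h3]
    simp [Matrix.one_apply]
  · subst h
    simp [hm, B]
  · simp [h.ne', not_lt.2 h.le, hx (i, α) (j, β) h]

/-- The inducing character as a function of the determinants of the blocks. -/
noncomputable def detChar (c : ℕ) (τ : Fin k → (Fˣ →* ℂˣ)) (ζ : Fin k → ℂ) (d : Fin k → Fˣ) : ℂ :=
  (((∏ p : Pair k, (‖(d p.1.1 : F)‖ / ‖(d p.1.2 : F)‖) ^ c) ^ (1 / 2 : ℝ) : ℝ) : ℂ) *
    ∏ i, (((‖(d i : F)‖ : ℝ) : ℂ) ^ ζ i * (τ i (d i) : ℂ))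

theorem inducingChar_eq (τ : Fin k → (Fˣ →* ℂˣ)) (ζ : Fin k → ℂ) (m : Fin k → GL (Fin c) F) :
    inducingChar τ ζ m = detChar c τ ζ fun i => Matrix.GeneralLinearGroup.det (m i) := rfl

theorem detChar_mul (τ : Fin k → (Fˣ →* ℂˣ)) (ζ : Fin k → ℂ) (d d' : Fin k → Fˣ) :
    detChar c τ ζ (d * d') = detChar c τ ζ d * detChar c τ ζ d' := by
  simp only [detChar, Pi.mul_apply, Units.val_mul, norm_mul, map_mul]
  have h1 : ∀ p : Pair k, (‖(d p.1.1 : F)‖ * ‖(d' p.1.1 : F)‖ /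
      (‖(d p.1.2 : F)‖ * ‖(d' p.1.2 : F)‖)) ^ c = (‖(d p.1.1 : F)‖ / ‖(d p.1.2 : F)‖) ^ c *
        (‖(d' p.1.1 : F)‖ / ‖(d' p.1.2 : F)‖) ^ c := fun p => by rw [← mul_pow, mul_div_mul_comm]
  simp only [h1, Finset.prod_mul_distrib]
  rw [Real.mul_rpow (Finset.prod_nonneg fun p _ => by positivity)
    (Finset.prod_nonneg fun p _ => by positivity)]
  have h2 : ∀ i, (((‖(d i : F)‖ * ‖(d' i : F)‖ : ℝ) : ℂ)) ^ ζ i =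
      ((‖(d i : F)‖ : ℝ) : ℂ) ^ ζ i * ((‖(d' i : F)‖ : ℝ) : ℂ) ^ ζ i := fun i => by
    rw [Complex.ofReal_mul, Complex.mul_cpow_ofReal_nonneg (norm_nonneg _) (norm_nonneg _)]
  simp only [h2, Finset.prod_mul_distrib]
  push_cast
  ring

theorem detChar_eq_one {τ : Fin k → (Fˣ →* ℂˣ)} (hτ : ∀ i, ∀ u : Fˣ, ‖(u : F)‖ = 1 → τ i u = 1)
    (ζ : Fin k → ℂ) {d : Fin k → Fˣ} (hd : ∀ i, ‖(d i : F)‖ = 1) : detChar c τ ζ d = 1 := by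
  simp [detChar, hd, hτ _ _ (hd _)]

/-- A block upper triangular matrix splits as Levi times unipotent, and the character sees only the
determinants of its diagonal blocks. Later arguments then need only check vanishing below the block
diagonal. -/
theorem rhoSpace_blockUpper {τ : Fin k → (Fˣ →* ℂˣ)} {ζ : Fin k → ℂ} {f : GL (Fin (k * c)) F → ℂ}
    (hf : f ∈ rhoSpace c τ ζ) (x : GL (Fin (k * c)) F)
    (hx : ∀ s t : Fin k × Fin c, t.1 < s.1 → blocks x s t = 0) (d : Fin k → Fˣ)
    (hd : ∀ i, (Matrix.of fun α β => blocks x (i, α) (i, β)).det = d i) (g : GL (Fin (k * c)) F) :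
    f (x * g) = detChar c τ ζ d * f g := by
  obtain ⟨m, u, rfl, hm⟩ := exists_levi_mul_unip x hx
  rw [hf.2, inducingChar_eq]
  congr 2
  funext i
  refine Units.ext ?_
  rw [← hd]
  change (m i).val.det = _
  rw [show (m i).val = Matrix.of (fun α β => blocks (levi m * unip u) (i, α) (i, β)) from by
    ext α β; exact hm i α β]

theorem rhoSpace_blockUpper_one {τ : Fin k → (Fˣ →* ℂˣ)}
    (hτ : ∀ i, ∀ u : Fˣ, ‖(u : F)‖ = 1 → τ i u = 1) {ζ : Fin k → ℂ} {f : GL (Fin (k * c)) F → ℂ}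
    (hf : f ∈ rhoSpace c τ ζ) (x : GL (Fin (k * c)) F)
    (hx : ∀ s t : Fin k × Fin c, t.1 < s.1 → blocks x s t = 0)
    (hd : ∀ i, ‖(Matrix.of fun α β => blocks x (i, α) (i, β)).det‖ = 1) (g : GL (Fin (k * c)) F) :
    f (x * g) = f g := by
  have h0 : ∀ i, (Matrix.of fun α β => blocks x (i, α) (i, β)).det ≠ 0 := fun i =>
    norm_ne_zero_iff.1 (by rw [hd i]; exact one_ne_zero)
  rw [rhoSpace_blockUpper hf x hx (fun i => Units.mk0 _ (h0 i)) (fun i => rfl),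
    detChar_eq_one hτ ζ fun i => hd i, one_mul]

theorem blocks_one_add (x : GL (Fin (k * c)) F) (a b : Fin k × Fin c) (t : F)
    (hx : x.val = 1 + Matrix.single (finProdFinEquiv a) (finProdFinEquiv b) t) :
    blocks x = 1 + Matrix.single a b t := by
  ext s s'
  simp [blocks, hx, Matrix.one_apply, Matrix.single_apply]

variable [IsUltrametricDist F] [ProperSpace F]

/-- Functions in `ρ_c(τ_ζ)` are equivariant under the standard Borel subgroup. -/
theorem exists_borelEquivariant (hF : IsNormalizedAbs F) (c : ℕ) {τ : Fin k → (Fˣ →* ℂˣ)}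
    (hτ : ∀ i, ∀ u : Fˣ, ‖(u : F)‖ = 1 → τ i u = 1) :
    ∃ C : Fin (k * c) → ℂ, (∀ a, C a ≠ 0) ∧ ∀ ζ, ∀ f ∈ rhoSpace c τ ζ,
      BorelEquivariant (Equiv.refl _)
        (fun a => C a * (residueCard F : ℂ) ^ ζ (finProdFinEquiv.symm a).1) f := by
  -- An element of norm `q`, in accordance with the normalization `‖x‖ = q ^ deg x`; an unramified
  -- character is determined by its value there.
  obtain ⟨s₀, hs₀, hs₀n⟩ := exists_norm_eq hF 1
  rw [zpow_one] at hs₀n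
  have hq := residueCard_cast_ne_zero (F := F)
  let D : (i : Fin k) → Fˣ → (Fin k → Fˣ) := fun i s => Pi.mulSingle i s
  have hχ : ∀ (i : Fin k) (ζ : Fin k → ℂ) (s : Fˣ), detChar c τ ζ (D i s) =
      (detChar c τ ζ (D i (Units.mk0 s₀ hs₀))) ^ deg (s : F) := by
    intro i ζ s
    let χ : Fˣ →* ℂ :=
      { toFun := fun s => detChar c τ ζ (D i s)
        map_one' := by
          refine detChar_eq_one hτ ζ fun j => ?_
          simp [D]
        map_mul' := fun s s' => by
          rw [← detChar_mul]; congr 1; exact Pi.mulSingle_mul (f := fun _ => Fˣ) i s s' }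
    let u : Fˣ := (Units.mk0 s₀ hs₀ ^ deg (s : F))⁻¹ * s
    have hu : ‖(u : F)‖ = 1 := by
      simp only [u, Units.val_mul, Units.val_inv_eq_inv_val, Units.val_zpow_eq_zpow_val,
        Units.val_mk0, norm_mul, norm_inv, norm_zpow, hs₀n]
      rw [norm_eq_zpow_deg hF s.ne_zero, inv_mul_cancel₀]
      exact zpow_ne_zero _ residueCard_pos.ne'
    have hχu : χ u = 1 := by
      refine detChar_eq_one hτ ζ fun j => ?_
      by_cases h : j = i
      · subst h; simpa [D] using hu
      · simp [D, h]
    have h1 : χ s = χ (Units.mk0 s₀ hs₀ ^ deg (s : F)) * χ u := by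
      rw [← map_mul]; congr 1; simp [u]
    have h2 : ∀ n : ℤ, χ (Units.mk0 s₀ hs₀ ^ n) = χ (Units.mk0 s₀ hs₀) ^ n := fun n => by
      have := congrArg (fun z : ℂˣ => (z : ℂ)) (map_zpow χ.toHomUnits (Units.mk0 s₀ hs₀) n)
      simpa using this
    rw [hχu, mul_one, h2] at h1
    exact h1
  have hval : ∀ (i : Fin k) (ζ : Fin k → ℂ), detChar c τ ζ (D i (Units.mk0 s₀ hs₀)) =
      detChar c τ 0 (D i (Units.mk0 s₀ hs₀)) * (residueCard F : ℂ) ^ ζ i := by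
    intro i ζ
    simp only [detChar, Finset.prod_mul_distrib, Pi.zero_apply, Complex.cpow_zero,
      one_mul]
    have : ∏ j, ((‖(D i (Units.mk0 s₀ hs₀) j : F)‖ : ℝ) : ℂ) ^ ζ j = (residueCard F : ℂ) ^ ζ i := by
      rw [Finset.prod_eq_single i (fun j _ hj => by simp [D, hj]) (by simp)]
      simp [D, hs₀n]
    rw [this]
    ring
  have hne : ∀ (i : Fin k) (ζ : Fin k → ℂ) s, detChar c τ ζ (D i s) ≠ 0 := by
    intro i ζ s h
    have h1 : detChar c τ ζ (D i s * D i s⁻¹) = 1 := by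
      refine detChar_eq_one hτ ζ fun j => ?_
      by_cases hj : j = i
      · subst hj; simp [D]
      · simp [D, hj]
    rw [detChar_mul, h, zero_mul] at h1
    exact zero_ne_one h1
  refine ⟨fun a => detChar c τ 0 (D (finProdFinEquiv.symm a).1 (Units.mk0 s₀ hs₀)),
    fun a => hne _ _ _, fun ζ f hf => ⟨fun a => ?_, fun a b hab t g => ?_, fun a s g => ?_⟩⟩
  · rw [← hval]; exact hne _ _ _
  · obtain ⟨⟨i, α⟩, rfl⟩ := finProdFinEquiv.surjective a
    obtain ⟨⟨j, β⟩, rfl⟩ := finProdFinEquiv.surjective b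
    have hab' : finProdFinEquiv (i, α) < finProdFinEquiv (j, β) := hab
    have hb := blocks_one_add _ _ _ t (elemGL_val hab'.ne t)
    rw [finProdFinEquiv_lt] at hab'
    refine rhoSpace_blockUpper_one hτ hf _ (fun s s' hss => ?_) (fun i' => ?_) g
    · rw [hb, Matrix.add_apply, Matrix.one_apply_ne (by rintro rfl; exact lt_irrefl _ hss),
        Matrix.single_apply, if_neg, add_zero]
      rintro ⟨rfl, rfl⟩
      rcases hab' with h | h
      · exact absurd hss (not_lt.2 h.le)
      · exact absurd hss (by simp [h.1])
    · rw [hb]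
      by_cases h : i = i' ∧ j = i'
      · obtain ⟨rfl, rfl⟩ := h
        have hαβ : α ≠ β := by
          rcases hab' with h | h
          · exact absurd h (lt_irrefl _)
          · exact h.2.ne
        have : (Matrix.of fun α' β' => (1 + Matrix.single (j, α) (j, β) t :
            Matrix (Fin k × Fin c) (Fin k × Fin c) F) (j, α') (j, β')) = Matrix.transvection α β t := by
          ext α' β'
          simp [Matrix.transvection, Matrix.one_apply, Matrix.single_apply]
        rw [this, Matrix.det_transvection_of_ne _ _ hαβ, norm_one]
      · have : (Matrix.of fun α' β' => (1 + Matrix.single (i, α) (j, β) t :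
            Matrix (Fin k × Fin c) (Fin k × Fin c) F) (i', α') (i', β')) = 1 := by
          ext α' β'
          have h' : ¬ ((i = i' ∧ α = α') ∧ j = i' ∧ β = β') := fun h2 => h ⟨h2.1.1, h2.2.1⟩
          simp [Matrix.one_apply, Matrix.single_apply, h']
        rw [this, Matrix.det_one, norm_one]
  · obtain ⟨⟨i, α⟩, rfl⟩ := finProdFinEquiv.surjective a
    have hb := blocks_one_add _ _ _ _ (torGL_val (finProdFinEquiv (i, α)) s)
    simp only [Equiv.symm_apply_apply]
    rw [← hval, ← hχ]
    refine rhoSpace_blockUpper hf _ (fun s' s'' hss => ?_) _ (fun i' => ?_) g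
    · rw [hb, Matrix.add_apply, Matrix.one_apply_ne (by rintro rfl; exact lt_irrefl _ hss),
        Matrix.single_apply, if_neg, add_zero]
      rintro ⟨rfl, rfl⟩
      exact lt_irrefl _ hss
    · rw [hb]
      by_cases h : i = i'
      · subst h
        have : (Matrix.of fun α' β' => (1 + Matrix.single (i, α) (i, α) ((s : F) - 1) :
            Matrix (Fin k × Fin c) (Fin k × Fin c) F) (i, α') (i, β')) =
            Matrix.diagonal (Function.update 1 α (s : F)) := by
          ext α' β'
          by_cases h1 : α' = β'
          · subst h1
            by_cases h2 : α' = α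
            · subst h2; simp
            · simp [h2, Ne.symm h2, Matrix.single_apply]
          · have h2 : ¬(α = α' ∧ α = β') := fun h2 => h1 (h2.1.symm.trans h2.2)
            simp [h1, Matrix.one_apply, Matrix.single_apply, h2]
        rw [this, Matrix.det_diagonal, Finset.prod_update_of_mem (Finset.mem_univ _)]
        simp [D]
      · have : (Matrix.of fun α' β' => (1 + Matrix.single (i, α) (i, α) ((s : F) - 1) :
            Matrix (Fin k × Fin c) (Fin k × Fin c) F) (i', α') (i', β')) = 1 := by
          ext α' β'
          simp [Matrix.one_apply, h]
        rw [this, Matrix.det_one]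
        simp [D, Ne.symm h]

end BlockUpper

/-! ### The permutation matrices w and κ, and the positions of w V w⁻¹ and κ⁻¹Zκ. -/

section Perm

variable {F : Type*} [NontriviallyNormedField F] {n k c l r : ℕ}

theorem permGL_mul_val (σ : Equiv.Perm (Fin n)) (x : GL (Fin n) F) :
    (permGL σ * x).val = x.val.submatrix σ id := by
  simp [permGL, Equiv.Perm.permMatrix, PEquiv.toMatrix_toPEquiv_mul]

theorem mul_permGL_inv_val (σ : Equiv.Perm (Fin n)) (x : GL (Fin n) F) :
    (x * (permGL σ)⁻¹).val = x.val.submatrix id σ := by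
  have : ((permGL σ : GL (Fin n) F)⁻¹).val = (σ⁻¹).permMatrix F := rfl
  rw [Units.val_mul, this, Equiv.Perm.permMatrix, PEquiv.mul_toMatrix_toPEquiv]
  rfl

theorem permGL_mul (σ σ' : Equiv.Perm (Fin n)) :
    (permGL σ * permGL σ' : GL (Fin n) F) = permGL (σ' * σ) := by
  refine Units.ext ?_
  rw [Units.val_mul]
  exact (Matrix.permMatrix_mul _ _).symm

theorem weylPerm_apply (i : Fin k) (α : Fin c) :
    weylPerm k c (finProdFinEquiv (i, α)) = finProdFinEquiv (i.rev, α) := by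
  simp [weylPerm]

/-- Conjugation by the Weyl element, in block coordinates. -/
theorem blocks_weyl_conj (x : GL (Fin (k * c)) F) (i j : Fin k) (α β : Fin c) :
    blocks (weyl k c * x * (weyl k c)⁻¹) (i, α) (j, β) = blocks x (i.rev, α) (j.rev, β) := by
  rw [blocks, weyl, mul_permGL_inv_val, permGL_mul_val]
  simp [blocks, weylPerm_apply]

theorem splitEquiv_inl_val (x : Fin (k * l)) : (splitEquiv k l r (Sum.inl x) : ℕ) = x := by
  simp [splitEquiv]

theorem splitEquiv_inr_val (x : Fin (k * r)) : (splitEquiv k l r (Sum.inr x) : ℕ) = k * l + x := by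
  simp [splitEquiv]

theorem kappaPerm_inl (i : Fin k) (α : Fin l) :
    kappaPerm k l r (splitEquiv k l r (Sum.inl (finProdFinEquiv (i, α)))) =
      finProdFinEquiv (i, finSumFinEquiv (Sum.inl α)) := by
  simp [kappaPerm]

theorem kappaPerm_inr (i : Fin k) (α : Fin r) :
    kappaPerm k l r (splitEquiv k l r (Sum.inr (finProdFinEquiv (i, α)))) =
      finProdFinEquiv (i, finSumFinEquiv (Sum.inr α)) := by
  simp [kappaPerm]

theorem kappaPerm_symm_inl (i : Fin k) (α : Fin l) :
    (kappaPerm k l r).symm (finProdFinEquiv (i, finSumFinEquiv (Sum.inl α))) =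
      splitEquiv k l r (Sum.inl (finProdFinEquiv (i, α))) := by
  rw [Equiv.symm_apply_eq, kappaPerm_inl]

theorem kappaPerm_symm_inr (i : Fin k) (α : Fin r) :
    (kappaPerm k l r).symm (finProdFinEquiv (i, finSumFinEquiv (Sum.inr α))) =
      splitEquiv k l r (Sum.inr (finProdFinEquiv (i, α))) := by
  rw [Equiv.symm_apply_eq, kappaPerm_inr]

/-- Reversing the blocks within each of the two groups of rows and regrouping rows by κ commute.
Hence κ⁻¹Zκ is the conjugate of V² by w_{(c^k)}. -/
theorem diagGL_weyl_mul_kappa :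
    (diagGL (weyl k l) (weyl k r) * kappa k l r : GL (Fin (k * (l + r))) F) =
      kappa k l r * weyl k (l + r) := by
  have h : (diagGL (weyl k l) (weyl k r) : GL (Fin (k * (l + r))) F) =
      permGL ((splitEquiv k l r).symm.trans
        ((Equiv.sumCongr (weylPerm k l) (weylPerm k r)).trans (splitEquiv k l r))) := by
    refine Units.ext ?_
    ext a b
    obtain ⟨a, rfl⟩ := (splitEquiv k l r).surjective a
    obtain ⟨b, rfl⟩ := (splitEquiv k l r).surjective b
    rcases a with a | a <;> rcases b with b | b <;>
      simp [diagGL, assemble, weyl, permGL, Equiv.Perm.permMatrix, PEquiv.toMatrix_apply,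
        Equiv.toPEquiv_apply]
  rw [h, kappa, weyl, permGL_mul, permGL_mul]
  congr 1
  ext a
  obtain ⟨a, rfl⟩ := (splitEquiv k l r).surjective a
  rcases a with a | a
  · obtain ⟨⟨i, α⟩, rfl⟩ := finProdFinEquiv.surjective a
    simp [weylPerm_apply, kappaPerm_inl]
  · obtain ⟨⟨i, α⟩, rfl⟩ := finProdFinEquiv.surjective a
    simp [weylPerm_apply, kappaPerm_inr]

/-- The elements of `κ⁻¹ Z κ` are lower triangular. -/
theorem kappa_inv_mul_zElt (z : Coord k l r F) :
    ((kappa k l r)⁻¹ * zElt z : GL (Fin (k * (l + r))) F) =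
      weyl k (l + r) * unip (blockCoord 0 z 0 0) * (weyl k (l + r))⁻¹ * (kappa k l r)⁻¹ := by
  rw [zElt, diagGL_weyl_mul_kappa]
  group

/-- Brings a unipotent matrix with prescribed free entries to the form required by
`exists_chain_coord`. -/
theorem eq_one_add_sum_single {ι : Type*} [Fintype ι] {x : Matrix (Fin n) (Fin n) F}
    {e : ι → Fin n × Fin n} (he : Function.Injective e) {t : ι → F}
    (h1 : ∀ i, (x - 1) (e i).2 (e i).1 = t i)
    (h0 : ∀ a b, (∀ i, e i ≠ (b, a)) → (x - 1) a b = 0) :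
    x = 1 + ∑ i, Matrix.single (e i).2 (e i).1 (t i) := by
  classical
  rw [← sub_eq_iff_eq_add']
  ext a b
  rw [Matrix.sum_apply]
  by_cases h : ∃ i, e i = (b, a)
  · obtain ⟨i, hi⟩ := h
    have ha : (e i).2 = a := by rw [hi]
    have hb : (e i).1 = b := by rw [hi]
    rw [Finset.sum_eq_single i, ← ha, ← hb, h1, Matrix.single_apply_same]
    · intro j _ hj
      rw [Matrix.single_apply, if_neg]
      rintro ⟨h2, h3⟩
      exact hj (he (by rw [hi, ← h2, ← h3]))
    · simp
  · push Not at h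
    rw [h0 a b h, Finset.sum_eq_zero]
    intro i _
    rw [Matrix.single_apply, if_neg]
    rintro ⟨h2, h3⟩
    exact h i (by rw [← h2, ← h3])

/-- Positions of the entries of `w v w⁻¹`, `v ∈ V_{(c^k)}`: (column, row). -/
def weylPos (k c : ℕ) (p : Pair k × Fin c × Fin c) : Fin (k * c) × Fin (k * c) :=
  (finProdFinEquiv (p.1.1.2.rev, p.2.2), finProdFinEquiv (p.1.1.1.rev, p.2.1))

theorem weylPos_injective : Function.Injective (weylPos k c) := by
  rintro ⟨⟨⟨i, j⟩, hij⟩, α, β⟩ ⟨⟨⟨i', j'⟩, hij'⟩, α', β'⟩ h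
  simp only [weylPos, Prod.mk.injEq, EmbeddingLike.apply_eq_iff_eq] at h
  obtain ⟨⟨h1, rfl⟩, h2, rfl⟩ := h
  rw [Fin.rev_inj] at h1 h2
  subst h1 h2
  rfl

theorem mem_inversions_weylPerm (p : Fin (k * c) × Fin (k * c)) :
    p ∈ inversions (Equiv.refl _) (weylPerm k c) ↔ ∃ i, weylPos k c i = p := by
  obtain ⟨a, b⟩ := p
  obtain ⟨⟨i, α⟩, rfl⟩ := finProdFinEquiv.surjective a
  obtain ⟨⟨j, β⟩, rfl⟩ := finProdFinEquiv.surjective b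
  simp only [mem_inversions, Equiv.refl_apply, weylPerm_apply, finProdFinEquiv_lt, Fin.rev_lt_rev,
    Fin.rev_inj]
  constructor
  · rintro ⟨h1, h2⟩
    have hij : i < j := by
      rcases h1 with h1 | ⟨rfl, h1⟩
      · exact h1
      · rcases h2 with h2 | ⟨-, h2⟩
        · exact h2
        · exact absurd h1 h2.asymm
    exact ⟨(⟨(j.rev, i.rev), Fin.rev_lt_rev.2 hij⟩, β, α), by simp [weylPos]⟩
  · rintro ⟨⟨⟨⟨i', j'⟩, hij⟩, α', β'⟩, h⟩
    simp only [weylPos, Prod.mk.injEq, EmbeddingLike.apply_eq_iff_eq] at h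
    obtain ⟨⟨rfl, rfl⟩, rfl, rfl⟩ := h
    have : j'.rev < i'.rev := Fin.rev_lt_rev.2 hij
    exact ⟨Or.inl this, Or.inl this⟩

theorem weyl_unip_val (v : Coord k c c F) :
    (weyl k c * unip v * (weyl k c)⁻¹).val =
      1 + ∑ i, Matrix.single (weylPos k c i).2 (weylPos k c i).1 (v i) := by
  have hsub : ∀ (i j : Fin k) (α β : Fin c), ((weyl k c * unip v * (weyl k c)⁻¹).val - 1)
      (finProdFinEquiv (i, α)) (finProdFinEquiv (j, β)) = strictUpper v (i.rev, α) (j.rev, β) := by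
    intro i j α β
    have := blocks_weyl_conj (unip v) i j α β
    rw [blocks_unip] at this
    rw [Matrix.sub_apply, ← sub_eq_of_eq_add' (this.trans (Matrix.add_apply _ _ _ _))]
    simp [blocks, Matrix.one_apply, Fin.rev_inj]
  refine eq_one_add_sum_single weylPos_injective (fun p => ?_) fun a b h => ?_
  · rw [weylPos, hsub]
    simp [strictUpper, p.1.2]
  · obtain ⟨⟨i, α⟩, rfl⟩ := finProdFinEquiv.surjective a
    obtain ⟨⟨j, β⟩, rfl⟩ := finProdFinEquiv.surjective b
    rw [hsub, strictUpper, Matrix.of_apply, dif_neg]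
    intro hij
    exact h (⟨(i.rev, j.rev), hij⟩, α, β) (by simp [weylPos])

/-- Positions of the entries of `w v w⁻¹`, `v ∈ V²`: (column, row). -/
def zPos (k l r : ℕ) (p : Pair k × Fin l × Fin r) : Fin (k * (l + r)) × Fin (k * (l + r)) :=
  (finProdFinEquiv (p.1.1.2.rev, finSumFinEquiv (Sum.inr p.2.2)),
    finProdFinEquiv (p.1.1.1.rev, finSumFinEquiv (Sum.inl p.2.1)))

theorem zPos_injective : Function.Injective (zPos k l r) := by
  rintro ⟨⟨⟨i, j⟩, hij⟩, α, β⟩ ⟨⟨⟨i', j'⟩, hij'⟩, α', β'⟩ h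
  simp only [zPos, Prod.mk.injEq, EmbeddingLike.apply_eq_iff_eq, Sum.inr.injEq, Sum.inl.injEq] at h
  obtain ⟨⟨h1, rfl⟩, h2, rfl⟩ := h
  rw [Fin.rev_inj] at h1 h2
  subst h1 h2
  rfl

/-- The order defined by κ⁻¹ puts all indices of the first kind before those of the second. The
inverted pairs are therefore those with an index of the second kind in a strictly earlier block than
one of the first kind, which is where the entries of κ⁻¹Zκ lie. -/
theorem mem_inversions_kappaPerm (p : Fin (k * (l + r)) × Fin (k * (l + r))) :
    p ∈ inversions (Equiv.refl _) (kappaPerm k l r).symm ↔ ∃ i, zPos k l r i = p := by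
  obtain ⟨a, b⟩ := p
  obtain ⟨⟨i, α⟩, rfl⟩ := finProdFinEquiv.surjective a
  obtain ⟨⟨j, β⟩, rfl⟩ := finProdFinEquiv.surjective b
  obtain ⟨α, rfl⟩ := finSumFinEquiv.surjective α
  obtain ⟨β, rfl⟩ := finSumFinEquiv.surjective β
  rw [mem_inversions, Equiv.refl_apply, Equiv.refl_apply, finProdFinEquiv_lt]
  have hz : (∃ p, zPos k l r p = (finProdFinEquiv (i, finSumFinEquiv α),
      finProdFinEquiv (j, finSumFinEquiv β))) ↔
      i < j ∧ ∃ α' β', α = Sum.inr α' ∧ β = Sum.inl β' := by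
    constructor
    · rintro ⟨⟨⟨⟨i', j'⟩, hij⟩, α', β'⟩, h⟩
      simp only [zPos, Prod.mk.injEq, EmbeddingLike.apply_eq_iff_eq] at h
      obtain ⟨⟨rfl, rfl⟩, rfl, rfl⟩ := h
      exact ⟨Fin.rev_lt_rev.2 hij, _, _, rfl, rfl⟩
    · rintro ⟨hij, α', β', rfl, rfl⟩
      exact ⟨(⟨(j.rev, i.rev), Fin.rev_lt_rev.2 hij⟩, β', α'), by simp [zPos]⟩
  rw [hz]
  rcases α with α | α <;> rcases β with β | β
  · simp only [kappaPerm_symm_inl, Fin.lt_def (a := splitEquiv k l r _), splitEquiv_inl_val,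
      ← Fin.lt_def, finProdFinEquiv_lt, reduceCtorEq, false_and, exists_false, and_false, iff_false]
    rintro ⟨h | h, h' | h'⟩
    · exact h.asymm h'
    · exact h.ne h'.1.symm
    · exact h'.ne h.1.symm
    · have : α < β := by
        have h3 := h.2
        rw [finSumFinEquiv_apply_left, finSumFinEquiv_apply_left] at h3
        exact h3
      exact this.asymm h'.2
  · simp only [kappaPerm_symm_inl, kappaPerm_symm_inr, Fin.lt_def (a := splitEquiv k l r _),
      splitEquiv_inl_val, splitEquiv_inr_val, reduceCtorEq, exists_false, and_false,
      iff_false]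
    rintro ⟨-, h⟩
    have := (finProdFinEquiv (i, α)).2
    omega
  · simp only [kappaPerm_symm_inl, kappaPerm_symm_inr, Fin.lt_def (a := splitEquiv k l r _),
      splitEquiv_inl_val, splitEquiv_inr_val, Sum.inr.injEq, Sum.inl.injEq, exists_and_left,
      exists_eq', and_true]
    constructor
    · rintro ⟨h | h, -⟩
      · exact h
      · have h2 := h.2
        rw [Fin.lt_def] at h2
        simp at h2
        omega
    · intro h
      have := (finProdFinEquiv (j, β)).2
      exact ⟨Or.inl h, by omega⟩
  · simp only [kappaPerm_symm_inr, Fin.lt_def (a := splitEquiv k l r _), splitEquiv_inr_val,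
      Nat.add_lt_add_iff_left,
      ← Fin.lt_def, finProdFinEquiv_lt, reduceCtorEq, exists_false, and_false, iff_false]
    rintro ⟨h | h, h' | h'⟩
    · exact h.asymm h'
    · exact h.ne h'.1.symm
    · exact h'.ne h.1.symm
    · have : α < β := by simpa using h.2
      exact this.asymm h'.2

theorem blockCoord_apply (v1 : Coord k l l F) (v2 : Coord k l r F) (v3 : Coord k r l F)
    (v4 : Coord k r r F) (p : Pair k) (α β : Fin l ⊕ Fin r) :
    blockCoord v1 v2 v3 v4 (p, finSumFinEquiv α, finSumFinEquiv β) =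
    Matrix.fromBlocks (Matrix.of fun α β => v1 (p, α, β)) (Matrix.of fun α β => v2 (p, α, β))
    (Matrix.of fun α β => v3 (p, α, β)) (Matrix.of fun α β => v4 (p, α, β)) α β := by
  simp [blockCoord]

theorem weyl_zElt_val (z : Coord k l r F) :
    (weyl k (l + r) * unip (blockCoord 0 z 0 0) * (weyl k (l + r))⁻¹).val =
      1 + ∑ i, Matrix.single (zPos k l r i).2 (zPos k l r i).1 (z i) := by
  rw [weyl_unip_val]
  refine eq_one_add_sum_single zPos_injective (fun p => ?_) fun a b h => ?_
  all_goals rw [add_sub_cancel_left, Matrix.sum_apply]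
  · obtain ⟨⟨⟨i, j⟩, hij⟩, α, β⟩ := p
    have hw : zPos k l r (⟨(i, j), hij⟩, α, β) = weylPos k (l + r) (⟨(i, j), hij⟩,
        finSumFinEquiv (Sum.inl α), finSumFinEquiv (Sum.inr β)) := rfl
    rw [hw, Finset.sum_eq_single (⟨(i, j), hij⟩,
        finSumFinEquiv (Sum.inl α), finSumFinEquiv (Sum.inr β)), Matrix.single_apply_same,
        blockCoord_apply]
    · simp
    · intro q _ hq
      rw [Matrix.single_apply, if_neg]
      rintro ⟨h1, h2⟩
      exact hq (weylPos_injective (Prod.ext h2 h1))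
    · simp
  · refine Finset.sum_eq_zero fun q _ => ?_
    rw [Matrix.single_apply]
    split_ifs with hq
    · obtain ⟨⟨⟨i, j⟩, hij⟩, α, β⟩ := q
      obtain ⟨α, rfl⟩ := finSumFinEquiv.surjective α
      obtain ⟨β, rfl⟩ := finSumFinEquiv.surjective β
      rw [blockCoord_apply]
      rcases α with α | α <;> rcases β with β | β <;> try rfl
      exact absurd (Prod.ext hq.2 hq.1) (h (⟨(i, j), hij⟩, α, β))
    · rfl

theorem continuous_unip : Continuous fun v : Coord k c c F => unip v := by
  refine continuous_of_val (continuous_matrix fun a b => ?_)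
  obtain ⟨⟨i, α⟩, rfl⟩ := finProdFinEquiv.surjective a
  obtain ⟨⟨j, β⟩, rfl⟩ := finProdFinEquiv.surjective b
  have : ∀ v : Coord k c c F, (unip v).val (finProdFinEquiv (i, α)) (finProdFinEquiv (j, β)) =
      (1 + strictUpper v) (i, α) (j, β) := fun v => by rw [← blocks_unip]; rfl
  simp only [this, Matrix.add_apply, strictUpper, Matrix.of_apply]
  refine continuous_const.add ?_
  by_cases h : i < j
  · simp only [h, dif_pos]; fun_prop
  · simp only [h, dif_neg, not_false_iff]; fun_prop

theorem continuous_psiV {ψ : AddChar F Circle} (hψ : Continuous ψ) :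
    Continuous fun v : Coord k c c F => psiV ψ v := by
  refine hψ.comp (continuous_finsetSum _ fun p _ => ?_)
  split_ifs
  · fun_prop
  · fun_prop

end Perm

/-! ### The cone of convergence and the continuation of m(ζ, κ). -/

section Cone

variable {F : Type*} [NontriviallyNormedField F] [IsUltrametricDist F] [ProperSpace F]
  [MeasurableSpace F] [BorelSpace F] {k : ℕ}

/-- As `ψ` has absolute value one, convergence concerns `f(w v) = f((w v w⁻¹) w)` only, an integral
over the root groups at the inversions of w. This is why the bound is uniform in `ψ` and `μ`. -/
theorem exists_convergence_cone (hF : IsNormalizedAbs F) (c : ℕ) {τ : Fin k → (Fˣ →* ℂˣ)}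
    (hτ : ∀ i, ∀ u : Fˣ, ‖(u : F)‖ = 1 → τ i u = 1) :
    ∃ R : ℝ, 0 ≤ R ∧ ∀ (ψ : AddChar F Circle), Continuous ψ → ∀ (μ : Measure F)
      [μ.IsAddHaarMeasure], cone k R ⊆ convergenceDomain c τ ψ μ := by
  obtain ⟨C, hC, hB⟩ := exists_borelEquivariant (F := F) hF c hτ
  obtain ⟨L, hL, hinv, hint⟩ := exists_chain_coord (F := F) (weylPerm k c) (weylPos k c)
    weylPos_injective mem_inversions_weylPerm (x := fun v => weyl k c * unip v * (weyl k c)⁻¹)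
    weyl_unip_val
  obtain ⟨R, hR, hcone⟩ := exists_cone_convChain (F := F)
    (fun a => (finProdFinEquiv.symm a : Fin k × Fin c).1) L (fun p hp => by
      obtain ⟨⟨⟨⟨i, j⟩, hij⟩, α, β⟩, rfl⟩ := (mem_inversions_weylPerm p).1 (hinv p hp)
      simpa [weylPos] using hij) C hC
  refine ⟨R, hR, fun ψ hψ μ _ ζ hζ f hf => ?_⟩
  obtain ⟨U, hU, hfU⟩ := isSmooth_iff.1 hf.1
  have h1 := (hint μ f (weyl k c)).1
    (chain_integrable μ hF hU L hL (hB ζ f hf) hfU (hcone ζ hζ) _)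
  simp only [inv_mul_cancel_right] at h1
  refine h1.mul_bdd (c := 1) ?_ ?_
  · exact (continuous_subtype_val.comp (continuous_psiV hψ).inv).aestronglyMeasurable
  · exact Eventually.of_forall fun v => (Circle.norm_coe _).le

/-- The chain attached to κ⁻¹, evaluated at `κ⁻¹ g`. The common level of the section makes the
denominator independent of `g`. -/
theorem exists_mIntegral_continuation (hF : IsNormalizedAbs F) (l r : ℕ) {τ : Fin k → (Fˣ →* ℂˣ)}
    (hτ : ∀ i, ∀ u : Fˣ, ‖(u : F)‖ = 1 → τ i u = 1) :
    ∃ R : ℝ, 0 ≤ R ∧ ∀ (μ : Measure F) [μ.IsAddHaarMeasure],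
      ∀ ξ : (Fin k → ℂ) → GL (Fin (k * (l + r))) F → ℂ, IsEntireSection (l + r) τ ξ →
        ∃ D ∈ entireFun F k, D ≠ 0 ∧ ∃ N : (Fin k → ℂ) → GL (Fin (k * (l + r))) F → ℂ,
          (∀ g, (fun ζ => N ζ g) ∈ entireFun F k) ∧
          ∀ ζ ∈ cone k R, ∀ g, N ζ g = D ζ * mIntegral μ (ξ ζ) g := by
  obtain ⟨C, hC, hB⟩ := exists_borelEquivariant (F := F) hF (l + r) hτ
  obtain ⟨L, hL, hinv, hint⟩ := exists_chain_coord (F := F) (kappaPerm k l r).symm (zPos k l r)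
    zPos_injective mem_inversions_kappaPerm
    (x := fun z => weyl k (l + r) * unip (blockCoord 0 z 0 0) * (weyl k (l + r))⁻¹) weyl_zElt_val
  obtain ⟨R, hR, hcone⟩ := exists_cone_convChain (F := F)
    (fun a => (finProdFinEquiv.symm a : Fin k × Fin (l + r)).1) L (fun p hp => by
      obtain ⟨⟨⟨⟨i, j⟩, hij⟩, α, β⟩, rfl⟩ := (mem_inversions_kappaPerm p).1 (hinv p hp)
      simpa [zPos] using hij) C hC
  refine ⟨R, hR, fun μ _ ξ hξ => ?_⟩
  obtain ⟨U, hU, hfU⟩ := exists_uniform_rInv (fun ζ => (hξ.1 ζ).1) hξ.2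
  have hy : ∀ c d : Fin (k * (l + r)), (fun ζ : Fin k → ℂ =>
      (C c * (residueCard F : ℂ) ^ ζ (finProdFinEquiv.symm c).1) /
        (C d * (residueCard F : ℂ) ^ ζ (finProdFinEquiv.symm d).1)) ∈ entireFun F k := by
    intro c d
    have h1 := mul_mem (mul_mem (const_mem_entireFun (F := F) (k := k) (C c / C d))
      (cpow_mem_entireFun (F := F) (finProdFinEquiv.symm c).1))
      (cpow_neg_mem_entireFun (F := F) (finProdFinEquiv.symm d).1)
    convert! h1 using 1
    funext ζ
    simp only [Pi.mul_apply, Complex.cpow_neg]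
    rw [mul_div_mul_comm, div_eq_mul_inv ((residueCard F : ℂ) ^ _), mul_assoc]
  obtain ⟨D, hD, hD0, N, hN, h⟩ := chain_continuation μ hF hU R L hL hy
    (fun ζ _ => hB ζ _ (hξ.1 ζ)) (fun ζ _ => hfU ζ) hξ.2 hcone
  refine ⟨D, hD, hD0, fun ζ g => N ζ ((kappa k l r)⁻¹ * g), fun g => hN _, fun ζ hζ g => ?_⟩
  change N ζ ((kappa k l r)⁻¹ * g) = _
  rw [h ζ hζ, ← (hint μ (ξ ζ) _).2, mIntegral]
  simp only [kappa_inv_mul_zElt, mul_assoc]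
  rfl

end Cone

/-! ### Small lower triangular shears of V_{(c^k)} and their effect on f and ψ. -/

section Shear

variable {F : Type*} [NontriviallyNormedField F] {k a b c : ℕ}

theorem strictUpper_add (v v' : Coord k a b F) :
    strictUpper (v + v') = strictUpper v + strictUpper v' := by
  ext s t
  by_cases h : s.1 < t.1 <;> simp [strictUpper, h]

theorem strictUpper_smul (x : F) (v : Coord k a b F) :
    strictUpper (x • v) = x • strictUpper v := by
  ext s t
  by_cases h : s.1 < t.1 <;> simp [strictUpper, h]

theorem strictUpper_apply_pair (v : Coord k a b F) (p : Pair k × Fin a × Fin b) :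
    strictUpper v (p.1.1.1, p.2.1) (p.1.1.2, p.2.2) = v p := by
  simp [strictUpper, p.1.2]

theorem strictUpper_eq_zero (v : Coord k a b F) {s : Fin k × Fin a} {t : Fin k × Fin b}
    (h : ¬ s.1 < t.1) : strictUpper v s t = 0 := by
  simp [strictUpper, h]

/-- The part of `v` in a block column. -/
def colPart (j : Fin k) (v : Coord k a b F) : Coord k a b F := fun p => if p.1.1.2 = j then v p else 0

/-- The part of `v` in the block columns up to `m`. -/
def leftPart (m : Fin k) (v : Coord k a b F) : Coord k a b F :=
  fun p => if p.1.1.2 ≤ m then v p else 0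

theorem norm_strictUpper_le (v : Coord k a b F) (s : Fin k × Fin a) (t : Fin k × Fin b) :
    ‖strictUpper v s t‖ ≤ ‖colPart t.1 v‖ := by
  by_cases h : s.1 < t.1
  · refine le_of_eq_of_le ?_ (norm_le_pi_norm _ (⟨(s.1, t.1), h⟩, s.2, t.2))
    simp [strictUpper, h, colPart]
  · rw [strictUpper_eq_zero v h, norm_zero]; exact norm_nonneg _

theorem norm_le_colPart (v : Coord k a b F) (p : Pair k × Fin a × Fin b) :
    ‖v p‖ ≤ ‖colPart p.1.1.2 v‖ := by
  rw [← strictUpper_apply_pair v p]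
  exact norm_strictUpper_le _ _ _

theorem continuous_colPart (j : Fin k) : Continuous (colPart (a := a) (b := b) (F := F) j) := by
  refine continuous_pi fun p => ?_
  by_cases h : p.1.1.2 = j
  · simp only [colPart, h, if_true]; fun_prop
  · simp only [colPart, h, if_false]; fun_prop

/-- The matrix supported in the block row `m` and the block columns up to `m`. -/
def rowMatrix (m : Fin k) (ε : Fin c × Fin k × Fin c → F) :
    Matrix (Fin k × Fin c) (Fin k × Fin c) F :=
  Matrix.of fun s t => if s.1 = m ∧ t.1 ≤ m then ε (s.2, t) else 0

theorem continuous_rowMatrix (m : Fin k) : Continuous (rowMatrix (c := c) (F := F) m) := by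
  refine continuous_matrix fun s t => ?_
  by_cases h : s.1 = m ∧ t.1 ≤ m
  · simp only [rowMatrix, Matrix.of_apply, h, and_self, if_true]; fun_prop
  · simp only [rowMatrix, Matrix.of_apply, h, if_false]; fun_prop

theorem rowMatrix_zero (m : Fin k) : rowMatrix (c := c) (F := F) m 0 = 0 := by
  ext s t; simp [rowMatrix]

/-- Left multiplication by `1 + rowMatrix m ε`, keeping the strictly upper triangular part. -/
def shear (m : Fin k) (ε : Fin c × Fin k × Fin c → F) : Coord k c c F →ₗ[F] Coord k c c F where
  toFun v p := v p + (rowMatrix m ε * strictUpper v) (p.1.1.1, p.2.1) (p.1.1.2, p.2.2)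
  map_add' v v' := by
    funext p
    simp only [strictUpper_add, Matrix.mul_add, Matrix.add_apply, Pi.add_apply]
    ring
  map_smul' x v := by
    funext p
    simp only [strictUpper_smul, Matrix.mul_smul, Matrix.smul_apply, Pi.smul_apply, smul_eq_mul,
      RingHom.id_apply]
    ring

theorem shear_apply (m : Fin k) (ε : Fin c × Fin k × Fin c → F) (v : Coord k c c F)
    (p : Pair k × Fin c × Fin c) : shear m ε v p =
      v p + (rowMatrix m ε * strictUpper v) (p.1.1.1, p.2.1) (p.1.1.2, p.2.2) := rfl

theorem shear_zero (m : Fin k) : shear (c := c) (F := F) m 0 = LinearMap.id := by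
  ext v p
  simp [shear_apply, rowMatrix_zero]

theorem continuous_det_shear (m : Fin k) :
    Continuous fun ε : Fin c × Fin k × Fin c → F => LinearMap.det (shear m ε) := by
  have : ∀ ε : Fin c × Fin k × Fin c → F, LinearMap.det (shear m ε) =
      (LinearMap.toMatrix' (shear m ε)).det := fun ε => (LinearMap.det_toMatrix' _).symm
  simp only [this]
  refine Continuous.matrix_det (continuous_matrix fun p q => ?_)
  simp only [LinearMap.toMatrix'_apply, shear_apply]
  refine continuous_const.add ?_
  exact ((continuous_rowMatrix m).matrix_mul continuous_const).matrix_elem _ _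

/-- Left multiplication by the block lower triangular `h` is the shear followed by right
multiplication by a conjugate of `h`. The conjugating element involves only block columns up to `m`,
so no bound on the other columns is needed to keep that conjugate near `1`. -/
theorem unip_shear_mul (m : Fin k) (ε : Fin c × Fin k × Fin c → F) (h : GL (Fin (k * c)) F)
    (hh : blocks h = 1 + rowMatrix m ε) (v : Coord k c c F) :
    unip (shear m ε v) * ((unip (leftPart m v))⁻¹ * h * unip (leftPart m v)) = h * unip v := by
  set H := rowMatrix m ε with hH
  set L := strictUpper (leftPart m v) with hL
  set N := strictUpper (v - leftPart m v) with hN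
  set E := blocks (unip (leftPart m v))⁻¹ with hE
  have hLa : ∀ s t : Fin k × Fin c, L s t = if t.1 ≤ m then strictUpper v s t else 0 := by
    intro s t
    by_cases h1 : s.1 < t.1 <;> by_cases h2 : t.1 ≤ m <;>
      simp [hL, strictUpper, leftPart, h1, h2]
  have hv : strictUpper v = L + N := by
    rw [hL, hN, ← strictUpper_add]; simp
  have hNa : ∀ s t : Fin k × Fin c, N s t = if t.1 ≤ m then 0 else strictUpper v s t := by
    intro s t
    have h1 : N s t = strictUpper v s t - L s t := by
      rw [hv]; simp
    rw [h1, hLa]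
    split_ifs <;> simp
  have hHa : ∀ s t, H s t = if s.1 = m ∧ t.1 ≤ m then ε (s.2, t) else 0 := fun s t => rfl
  -- `N` lives in the columns beyond `m`, whereas the nonzero rows of `L` and `H` have index at most
  -- `m`. The resulting relations make the inverse of the left part disappear next to `N`.
  have hNL : N * L = 0 := by
    ext s t
    rw [Matrix.mul_apply]
    refine Finset.sum_eq_zero fun r _ => ?_
    rw [hNa, hLa]
    split_ifs with h1 h2 h2
    · simp
    · simp
    · rw [strictUpper_eq_zero v (s := r) (t := t), mul_zero]
      exact fun h3 => h1 (h3.le.trans h2)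
    · simp
  have hNH : N * H = 0 := by
    ext s t
    rw [Matrix.mul_apply]
    refine Finset.sum_eq_zero fun r _ => ?_
    rw [hNa, hHa]
    split_ifs with h1 h2 h2
    · simp
    · simp
    · exact absurd h2.1.le h1
    · simp
  have hS : strictUpper (shear m ε v) = L + N + H * N := by
    ext s t
    by_cases h1 : s.1 < t.1
    · have h2 : strictUpper (shear m ε v) s t = strictUpper v s t + (H * strictUpper v) s t := by
        simp only [strictUpper, h1, Matrix.of_apply, dif_pos, shear_apply]
        rfl
      rw [h2, hv, Matrix.mul_add, Matrix.add_apply (H * L)]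
      have h3 : (H * L) s t = 0 := by
        rw [Matrix.mul_apply]
        refine Finset.sum_eq_zero fun r _ => ?_
        rw [hHa, hLa]
        split_ifs with h4 h5
        · exact absurd (h4.1 ▸ h1) (not_lt.2 h5)
        all_goals simp
      rw [h3, zero_add]
      rfl
    · rw [strictUpper_eq_zero _ h1, ← hv, Matrix.add_apply, strictUpper_eq_zero _ h1, zero_add,
        Matrix.mul_apply]
      refine (Finset.sum_eq_zero fun r _ => ?_).symm
      rw [hHa, hNa]
      split_ifs with h4 h5
      · simp
      · exact absurd (h4.1 ▸ lt_of_not_ge h5) h1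
      all_goals simp
  have hLE : (1 + L) * E = 1 := by
    rw [hE, hL, ← blocks_unip, ← blocks_mul, mul_inv_cancel, blocks_one]
  have hNE : N * E = N := by
    calc N * E = (N + N * L) * E := by rw [hNL, add_zero]
      _ = N * ((1 + L) * E) := by rw [← Matrix.mul_assoc, Matrix.mul_add, Matrix.mul_one]
      _ = N := by rw [hLE, Matrix.mul_one]
  apply blocks_injective
  rw [blocks_mul, blocks_mul, blocks_mul, blocks_mul, hh, blocks_unip, blocks_unip, blocks_unip,
    ← hE, ← hL, hS, hv]
  have e1 : (1 + (L + N + H * N)) * (E * (1 + H) * (1 + L)) =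
      ((1 + L) * E) * ((1 + H) * (1 + L)) + (1 + H) * ((N * E) * ((1 + H) * (1 + L))) := by
    noncomm_ring
  have e2 : N * ((1 + H) * (1 + L)) = N := by
    rw [← Matrix.mul_assoc, Matrix.mul_add N, hNH, Matrix.mul_one, add_zero, Matrix.mul_add, hNL,
      Matrix.mul_one, add_zero]
  rw [e1, hLE, hNE, e2]
  noncomm_ring

/-- The coefficients of `ε` in the effect of `shear m ε` on the character. -/
def pairing (n : Fin k) (v : Coord k c c F) (x : Fin c × Fin k × Fin c) : F :=
  strictUpper v x.2 (n, x.1)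

/-- The character reads the first superdiagonal, and the shear changes only block row `m`; so only
the block `(m, m + 1)` matters, and its trace pairs `ε` with the whole block column `m + 1`. -/
theorem psiV_shear (ψ : AddChar F Circle) {m n : Fin k} (hmn : (m : ℕ) + 1 = n)
    (ε : Fin c × Fin k × Fin c → F) (v : Coord k c c F) :
    psiV ψ (shear m ε v) = psiV ψ v * ψ (∑ x, ε x * pairing n v x) := by
  rw [psiV, psiV, ← AddChar.map_add_eq_mul]
  congr 1
  have hlt : m < n := by rw [Fin.lt_def]; omega
  have h1 : ∀ p : Pair k, (if (p.1.1 : ℕ) + 1 = p.1.2 then ∑ α, shear m ε v (p, α, α) else 0) =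
      (if (p.1.1 : ℕ) + 1 = p.1.2 then ∑ α, v (p, α, α) else 0) +
        if p = ⟨(m, n), hlt⟩ then ∑ x, ε x * pairing n v x else 0 := by
    rintro ⟨⟨i, j⟩, hij⟩
    simp only [Subtype.mk.injEq, Prod.mk.injEq]
    by_cases hp : i = m ∧ j = n
    · obtain ⟨rfl, rfl⟩ := hp
      simp only [hmn, if_true, and_self, shear_apply, Finset.sum_add_distrib, add_right_inj,
        Matrix.mul_apply]
      rw [Fintype.sum_prod_type]
      refine Finset.sum_congr rfl fun α _ => Finset.sum_congr rfl fun t _ => ?_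
      simp only [rowMatrix, Matrix.of_apply, true_and, pairing]
      split_ifs with h
      · rfl
      · rw [strictUpper_eq_zero v (t := (j, α)), mul_zero, mul_zero]
        simp only [Fin.lt_def, Fin.le_def] at h ⊢
        omega
    · rw [if_neg hp, add_zero]
      by_cases h2 : (i : ℕ) + 1 = j
      · have hi : i ≠ m := by
          rintro rfl
          exact hp ⟨rfl, Fin.ext (by omega)⟩
        simp only [h2, if_true, shear_apply, Matrix.mul_apply, rowMatrix, Matrix.of_apply, hi,
          false_and, if_false, zero_mul, Finset.sum_const_zero, add_zero]
      · simp only [h2, if_false]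
  simp only [h1, Finset.sum_add_distrib, add_right_inj]
  simp

theorem norm_pairing (n : Fin k) (v : Coord k c c F) : ‖pairing n v‖ = ‖colPart n v‖ := by
  refine le_antisymm ?_ ?_
  · exact (pi_norm_le_iff_of_nonneg (norm_nonneg _)).2 fun x => norm_strictUpper_le _ _ _
  · refine (pi_norm_le_iff_of_nonneg (norm_nonneg _)).2 fun p => ?_
    rw [colPart]
    split_ifs with h
    · subst h
      refine le_of_eq_of_le ?_ (norm_le_pi_norm _ (p.2.2, p.1.1.1, p.2.1))
      rw [pairing, strictUpper_apply_pair]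
    · rw [norm_zero]; exact norm_nonneg _

variable [IsUltrametricDist F]

/-- The correction to a column is strictly smaller than the column, so the ultrametric inequality
leaves its norm unchanged. Hence boxes are preserved by shears. -/
theorem norm_colPart_shear (m : Fin k) {ε : Fin c × Fin k × Fin c → F} (hε : ‖ε‖ < 1) (j : Fin k)
    (v : Coord k c c F) : ‖colPart j (shear m ε v)‖ = ‖colPart j v‖ := by
  have h1 : ‖colPart j (shear m ε v) - colPart j v‖ ≤ ‖ε‖ * ‖colPart j v‖ := by
    refine (pi_norm_le_iff_of_nonneg (by positivity)).2 fun p => ?_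
    simp only [Pi.sub_apply, colPart]
    split_ifs with h
    · subst h
      rw [shear_apply, add_sub_cancel_left, Matrix.mul_apply]
      refine IsUltrametricDist.norm_sum_le_of_forall_le_of_nonneg (by positivity) fun t _ => ?_
      rw [norm_mul]
      refine mul_le_mul ?_ (norm_strictUpper_le _ _ _) (norm_nonneg _) (norm_nonneg _)
      rw [rowMatrix, Matrix.of_apply]
      split_ifs
      · exact norm_le_pi_norm ε _
      · rw [norm_zero]; exact norm_nonneg _
    · simp; positivity
  by_cases h0 : colPart j v = 0
  · rw [h0, norm_zero, mul_zero, sub_zero] at h1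
    rw [h0, norm_zero]
    exact le_antisymm h1 (norm_nonneg _)
  · have h2 : ‖colPart j (shear m ε v) - colPart j v‖ < ‖colPart j v‖ :=
      h1.trans_lt (mul_lt_of_lt_one_left (norm_pos_iff.2 h0) hε)
    have h3 := IsUltrametricDist.norm_add_eq_max_of_norm_ne_norm h2.ne
    rw [sub_add_cancel, max_eq_right h2.le] at h3
    exact h3

theorem eventually_norm_eq_one {X : Type*} [TopologicalSpace X] {φ : X → F} {x : X}
    (hφ : Continuous φ) (h : φ x = 1) : ∀ᶠ y in 𝓝 x, ‖φ y‖ = 1 := by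
  have h1 : ∀ᶠ y in 𝓝 x, ‖φ y - 1‖ < 1 := by
    have : Tendsto (fun y => ‖φ y - 1‖) (𝓝 x) (𝓝 0) := by
      have h2 : Continuous fun y => ‖φ y - 1‖ := by fun_prop
      exact h2.tendsto' x 0 (by simp [h])
    exact this.eventually_lt_const one_pos
  filter_upwards [h1] with y hy
  have h3 := IsUltrametricDist.norm_add_eq_max_of_norm_ne_norm (x := φ y - 1) (y := 1)
    (by rw [norm_one]; exact hy.ne)
  rwa [sub_add_cancel, norm_one, max_eq_right hy.le] at h3

variable [ProperSpace F]

/-- For small `ε` the element w h w⁻¹ is block upper triangular with diagonal blocks of determinant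
norm one, invisible to `f`, and the conjugate of `h` in `unip_shear_mul` falls into `U`. The same
`δ` serves all `ζ`, all `f` of level `U`, and all `v` whose first columns are bounded. -/
theorem exists_shear_radius {τ : Fin k → (Fˣ →* ℂˣ)}
    (hτ : ∀ i, ∀ u : Fˣ, ‖(u : F)‖ = 1 → τ i u = 1) {U : Set (GL (Fin (k * c)) F)} (hU : U ∈ 𝓝 1)
    (m : Fin k) (C : ℝ) :
    ∃ δ > 0, δ < 1 ∧ ∀ ε, ‖ε‖ ≤ δ → ‖LinearMap.det (shear (c := c) (F := F) m ε)‖ = 1 ∧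
      ∀ v : Coord k c c F, (∀ p, p.1.1.2 ≤ m → ‖v p‖ ≤ C) → ∀ ζ, ∀ f ∈ rhoSpace c τ ζ, RInv U f →
        f (weyl k c * unip (shear m ε v)) = f (weyl k c * unip v) := by
  obtain ⟨δ₀, hδ₀, hδU⟩ := exists_entries_nhds_one hU
  let hmat : (Fin c × Fin k × Fin c → F) → Matrix (Fin (k * c)) (Fin (k * c)) F := fun ε =>
    (1 + rowMatrix m ε).submatrix finProdFinEquiv.symm finProdFinEquiv.symm
  have hcr := continuous_rowMatrix (c := c) (F := F) m
  have e1 := eventually_norm_eq_one (continuous_det_shear (c := c) (F := F) m) (x := 0)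
    (by rw [shear_zero, LinearMap.det_id])
  have e2 := eventually_norm_eq_one (φ := fun ε => (hmat ε).det) (x := 0)
    (Continuous.matrix_det ((continuous_const.add hcr).matrix_submatrix _ _))
    (by simp [hmat, rowMatrix_zero])
  have e3 : ∀ i : Fin k, ∀ᶠ ε in 𝓝 (0 : Fin c × Fin k × Fin c → F), ‖(Matrix.of fun α β : Fin c =>
      (1 + rowMatrix m ε) (i.rev, α) (i.rev, β)).det‖ = 1 := by
    intro i
    refine eventually_norm_eq_one (Continuous.matrix_det (continuous_matrix fun α β => ?_)) ?_
    · exact (continuous_const.add hcr).matrix_elem _ _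
    · rw [rowMatrix_zero, add_zero]
      refine (congrArg Matrix.det (?_ : _ = (1 : Matrix (Fin c) (Fin c) F))).trans Matrix.det_one
      ext α β
      simp [Matrix.one_apply]
  -- Compactness of the ball containing the left parts makes the estimate uniform in `v`.
  have e4 : ∀ᶠ ε in 𝓝 (0 : Fin c × Fin k × Fin c → F),
      ∀ u ∈ Metric.closedBall (0 : Coord k c c F) (max C 0),
      ∀ i j, ‖((unip u)⁻¹.val * (rowMatrix m ε).submatrix finProdFinEquiv.symm finProdFinEquiv.symm *
        (unip u).val) i j‖ < δ₀ := by
    refine (isCompact_closedBall _ _).eventually_forall_of_forall_eventually fun u _ => ?_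
    refine eventually_all.2 fun i => eventually_all.2 fun j => ?_
    have hc : Continuous fun z : (Fin c × Fin k × Fin c → F) × Coord k c c F =>
        ‖((unip z.2)⁻¹.val * (rowMatrix m z.1).submatrix finProdFinEquiv.symm finProdFinEquiv.symm *
        (unip z.2).val) i j‖ := by
      have h1 : Continuous fun z : (Fin c × Fin k × Fin c → F) × Coord k c c F => unip z.2 :=
        continuous_unip.comp continuous_snd
      exact ((((Units.continuous_val.comp h1.inv).matrix_mul
        ((hcr.comp continuous_fst).matrix_submatrix _ _)).matrix_mul
        (Units.continuous_val.comp h1)).matrix_elem i j).norm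
    exact (hc.tendsto' (0, u) 0 (by simp [rowMatrix_zero])).eventually_lt_const hδ₀
  have e5 := e1.and (e2.and ((eventually_all.2 e3).and e4))
  obtain ⟨δ, hδ, hball⟩ := Metric.nhds_basis_closedBall.mem_iff.1 e5
  refine ⟨min δ (1 / 2), by positivity, (min_le_right _ _).trans_lt (by norm_num), fun ε hε => ?_⟩
  obtain ⟨h1, h2, h3, h4⟩ := hball (show ε ∈ Metric.closedBall 0 δ by
    rw [mem_closedBall_zero_iff]; exact hε.trans (min_le_left _ _))
  refine ⟨h1, fun v hv ζ f hf hfU => ?_⟩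
  have hdet : (hmat ε).det ≠ 0 := norm_ne_zero_iff.1 (by rw [h2]; exact one_ne_zero)
  let h : GL (Fin (k * c)) F := Matrix.GeneralLinearGroup.mkOfDetNeZero (hmat ε) hdet
  have hh : blocks h = 1 + rowMatrix m ε := by
    ext s t
    simp [blocks, h, Matrix.GeneralLinearGroup.mkOfDetNeZero, hmat]
  have hhv : h.val = 1 + (rowMatrix m ε).submatrix finProdFinEquiv.symm finProdFinEquiv.symm := by
    change (1 + rowMatrix m ε).submatrix _ _ = _
    rw [Matrix.submatrix_add]
    simp
  have hL : leftPart m v ∈ Metric.closedBall (0 : Coord k c c F) (max C 0) := by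
    rw [mem_closedBall_zero_iff, pi_norm_le_iff_of_nonneg (le_max_right _ _)]
    intro p
    rw [leftPart]
    split_ifs with hp
    · exact (hv p hp).trans (le_max_left _ _)
    · simp
  have hg : (unip (leftPart m v))⁻¹ * h * unip (leftPart m v) ∈ U := by
    refine hδU _ fun i j => ?_
    have : ((unip (leftPart m v))⁻¹ * h * unip (leftPart m v)).val - 1 =
        (unip (leftPart m v))⁻¹.val *
          (rowMatrix m ε).submatrix finProdFinEquiv.symm finProdFinEquiv.symm *
          (unip (leftPart m v)).val := by
      rw [Units.val_mul, Units.val_mul, hhv, Matrix.mul_add, Matrix.mul_one, Matrix.add_mul,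
        Units.inv_mul, add_sub_cancel_left]
    rw [this]
    exact h4 _ hL i j
  rw [← hfU _ _ hg, mul_assoc, unip_shear_mul m ε h hh]
  have : weyl k c * (h * unip v) = weyl k c * h * (weyl k c)⁻¹ * (weyl k c * unip v) := by group
  rw [this]
  refine rhoSpace_blockUpper_one hτ hf _ (fun s t hst => ?_) (fun i => ?_) _
  · rw [blocks_weyl_conj, hh, Matrix.add_apply, Matrix.one_apply_ne, zero_add, rowMatrix,
      Matrix.of_apply, if_neg]
    · rintro ⟨h5, h6⟩
      exact absurd (Fin.rev_lt_rev.2 hst) (not_lt.2 (h6.trans_eq h5.symm))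
    · intro h5
      rw [Prod.mk.injEq, Fin.rev_inj] at h5
      exact hst.ne h5.1.symm
  · simp only [blocks_weyl_conj, hh]
    exact h3 i

end Shear

/-! ### Stabilization of Jacquet integrals over growing boxes. -/

section Stable

variable {F : Type*} [NontriviallyNormedField F] [IsUltrametricDist F] [ProperSpace F]
  [MeasurableSpace F] [BorelSpace F] (μ : Measure F) [μ.IsAddHaarMeasure] {k c : ℕ}

theorem continuous_jacquetIntegrand {ψ : AddChar F Circle} (hψ : Continuous ψ)
    {f : GL (Fin (k * c)) F → ℂ} (hf : Continuous f) : Continuous (jacquetIntegrand ψ f) :=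
  (hf.comp (continuous_const.mul continuous_unip)).mul
    (continuous_subtype_val.comp (continuous_psiV hψ).inv)

/-- The elements whose block columns are bounded by `N`. -/
def box (k c : ℕ) (F : Type*) [NontriviallyNormedField F] (N : Fin k → ℕ) : Set (Coord k c c F) :=
  {v | ∀ j, ‖colPart j v‖ ≤ N j}

theorem isCompact_box (N : Fin k → ℕ) : IsCompact (box k c F N) := by
  refine (isCompact_closedBall (0 : Coord k c c F) (∑ j, (N j : ℝ))).of_isClosed_subset ?_ ?_
  · have : box k c F N = ⋂ j, {v | ‖colPart j v‖ ≤ N j} := by ext v; simp [box]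
    rw [this]
    exact isClosed_iInter fun j => isClosed_le (continuous_colPart j).norm continuous_const
  · intro v hv
    rw [mem_closedBall_zero_iff, pi_norm_le_iff_of_nonneg (Finset.sum_nonneg fun _ _ => by positivity)]
    intro p
    refine (norm_le_colPart v p).trans ((hv _).trans ?_)
    exact Finset.single_le_sum (f := fun j => (N j : ℝ)) (fun _ _ => by positivity) (Finset.mem_univ _)

theorem measurableSet_box (N : Fin k → ℕ) : MeasurableSet (box k c F N) :=
  (isCompact_box N).isClosed.measurableSet

theorem box_mono : Monotone (box k c F) := fun _ _ h _ hv j =>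
  (hv j).trans (Nat.cast_le.2 (h j))

instance (a b : ℕ) : SigmaFinite (coordMeasure μ k a b) := by unfold coordMeasure; infer_instance

instance (a b : ℕ) : IsFiniteMeasureOnCompacts (coordMeasure μ k a b) := by
  unfold coordMeasure; infer_instance

theorem integrableOn_box {ψ : AddChar F Circle} (hψ : Continuous ψ)
    {f : GL (Fin (k * c)) F → ℂ} (hf : Continuous f) (N : Fin k → ℕ) :
    IntegrableOn (jacquetIntegrand ψ f) (box k c F N) (coordMeasure μ k c c) :=
  (continuous_jacquetIntegrand hψ hf).continuousOn.integrableOn_compact (isCompact_box N)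

/-- The Jacquet integral over a box. -/
noncomputable def boxIntegral (ψ : AddChar F Circle) (N : Fin k → ℕ) (f : GL (Fin (k * c)) F → ℂ) :
    ℂ :=
  ∫ v in box k c F N, jacquetIntegrand ψ f v ∂(coordMeasure μ k c c)

/-- A nontrivial character has integral zero over a ball. -/
theorem integral_addChar_closedBall {ι : Type*} [Fintype ι] (ψ : AddChar F Circle) {a : F}
    (ha : ψ a ≠ 1) (x : ι → F) {δ : ℝ} (hx : ‖a‖ ≤ δ * ‖x‖) :
    ∫ ε in Metric.closedBall (0 : ι → F) δ, (((ψ (∑ i, ε i * x i))⁻¹ : Circle) : ℂ)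
      ∂(Measure.pi fun _ => μ) = 0 := by
  classical
  have ha0 : 0 < ‖a‖ := norm_pos_iff.2 (by rintro rfl; exact ha (AddChar.map_zero_eq_one ψ))
  have hx0 : 0 < ‖x‖ := by
    refine (norm_nonneg x).lt_of_ne fun h => ?_
    rw [← h, mul_zero] at hx
    exact absurd ha0 (not_lt.2 hx)
  obtain ⟨i, hi⟩ : ∃ i, ‖x‖ ≤ ‖x i‖ := by
    by_contra h
    push Not at h
    exact lt_irrefl _ ((pi_norm_lt_iff hx0).2 h)
  have hxi : x i ≠ 0 := norm_pos_iff.1 (hx0.trans_le hi)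
  -- A translation that preserves the ultrametric ball and multiplies the integrand by `(ψ a)⁻¹ ≠
  -- 1`.
  let e : ι → F := Pi.single i (a / x i)
  have he : ‖e‖ ≤ δ := by
    simp only [e, Pi.norm_single, norm_div]
    rw [div_le_iff₀ (hx0.trans_le hi)]
    refine hx.trans (mul_le_mul_of_nonneg_left hi ?_)
    by_contra hδ
    exact absurd (ha0.trans_le hx) (not_lt.2 (mul_nonpos_of_nonpos_of_nonneg (not_le.1 hδ).le hx0.le))
  set G : (ι → F) → ℂ := (Metric.closedBall (0 : ι → F) δ).indicator
    fun ε => (((ψ (∑ i, ε i * x i))⁻¹ : Circle) : ℂ) with hG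
  have hmem : ∀ ε : ι → F, ε + e ∈ Metric.closedBall (0 : ι → F) δ ↔
      ε ∈ Metric.closedBall (0 : ι → F) δ := by
    intro ε
    simp only [mem_closedBall_zero_iff]
    constructor
    · intro h
      have := IsUltrametricDist.norm_add_le_max (ε + e) (-e)
      rw [add_neg_cancel_right, norm_neg] at this
      exact this.trans (max_le h he)
    · exact fun h => (IsUltrametricDist.norm_add_le_max _ _).trans (max_le h he)
  have hGe : ∀ ε, G (ε + e) = (((ψ a)⁻¹ : Circle) : ℂ) * G ε := by
    intro ε
    by_cases h : ε ∈ Metric.closedBall (0 : ι → F) δ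
    · rw [hG, Set.indicator_of_mem h, Set.indicator_of_mem ((hmem ε).2 h), ← Circle.coe_mul,
        ← mul_inv, ← AddChar.map_add_eq_mul]
      congr 4
      simp only [Pi.add_apply, add_mul, Finset.sum_add_distrib]
      rw [add_comm]
      congr 1
      rw [Finset.sum_eq_single i (fun j _ hj => by simp [e, hj]) (by simp)]
      simp [e, hxi]
    · rw [hG, Set.indicator_of_notMem h, Set.indicator_of_notMem (fun h' => h ((hmem ε).1 h')),
        mul_zero]
  rw [← integral_indicator Metric.isClosed_closedBall.measurableSet]
  have h1 := integral_add_right_eq_self (μ := Measure.pi fun _ : ι => μ) G e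
  simp only [hGe] at h1
  rw [integral_const_mul] at h1
  by_contra h
  have h2 : (((ψ a)⁻¹ : Circle) : ℂ) = 1 := mul_right_cancel₀ h (h1.trans (one_mul _).symm)
  rw [Circle.coe_eq_one, inv_eq_one] at h2
  exact ha h2

variable {τ : Fin k → (Fˣ →* ℂˣ)} {ψ : AddChar F Circle}

/-- Enlarging the bound for the block column `n` beyond `N n` does not change the integral. -/
def ColStable (c : ℕ) (τ : Fin k → (Fˣ →* ℂˣ)) (ψ : AddChar F Circle) (U : Set (GL (Fin (k * c)) F))
    (N : Fin k → ℕ) (n : Fin k) : Prop :=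
  ∀ N' : Fin k → ℕ, (∀ j < n, N' j = N j) → N n ≤ N' n → ∀ x, N' n ≤ x → ∀ ζ, ∀ f ∈ rhoSpace c τ ζ,
    RInv U f → boxIntegral μ ψ (Function.update N' n x) f = boxIntegral μ ψ N' f

/-- On the difference of two boxes the column `n` is long. Small shears in row `n - 1` preserve this
region and the values of `f`, and multiply `ψ` by a character of `ε` dual to that column; averaging
over `ε` gives zero. -/
theorem exists_colStable (hF : IsNormalizedAbs F) (hτ : ∀ i, ∀ u : Fˣ, ‖(u : F)‖ = 1 → τ i u = 1)
    (hψ : Continuous ψ) (hψ1 : ψ ≠ 1) {U : Set (GL (Fin (k * c)) F)} (hU : U ∈ 𝓝 1)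
    (N : Fin k → ℕ) (n : Fin k) :
    ∃ B : ℕ, ∀ x, B ≤ x → ColStable μ c τ ψ U (Function.update N n x) n := by
  -- Block column zero of a strictly upper triangular matrix is empty, so there is nothing to bound.
  rcases Nat.eq_zero_or_pos (n : ℕ) with hn | hn
  · refine ⟨0, fun x _ N' _ _ y hy ζ f hf hfU => ?_⟩
    have : box k c F (Function.update N' n y) = box k c F N' := by
      refine Set.Subset.antisymm (fun v hv j => ?_) (box_mono fun j => ?_)
      · by_cases hj : j = n
        · subst hj
          have : colPart j v = 0 := by
            funext p
            rw [colPart, if_neg, Pi.zero_apply]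
            rintro rfl
            have := p.1.2
            rw [Fin.lt_def] at this
            omega
          rw [this, norm_zero]; positivity
        · have := hv j
          rwa [Function.update_of_ne hj] at this
      · by_cases hj : j = n
        · subst hj; simpa using hy
        · rw [Function.update_of_ne hj]
    rw [boxIntegral, this, boxIntegral]
  let m : Fin k := ⟨n - 1, by omega⟩
  have hmn : (m : ℕ) + 1 = n := by simp only [m]; omega
  obtain ⟨δ, hδ0, hδ1, hδ⟩ := exists_shear_radius (c := c) hτ hU m (∑ j, (N j : ℝ))
  obtain ⟨a, ha⟩ : ∃ a, ψ a ≠ 1 := by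
    by_contra h
    push Not at h
    exact hψ1 (DFunLike.ext _ _ h)
  -- Beyond this bound `‖a‖ ≤ δ * ‖colPart n v‖`, the condition under which the average over `‖ε‖ ≤
  -- δ` vanishes.
  refine ⟨⌈‖a‖ / δ⌉₊, fun x₀ hx₀ N' hN' hNn x hx ζ f hf hfU => ?_⟩
  rw [Function.update_self] at hNn
  have hfc := hf.1.continuous
  have hFc := continuous_jacquetIntegrand hψ hfc
  set D := box k c F (Function.update N' n x) \ box k c F N' with hD
  have hDm : MeasurableSet D := (measurableSet_box _).diff (measurableSet_box _)
  have hsub : box k c F N' ⊆ box k c F (Function.update N' n x) := box_mono fun j => by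
    by_cases hj : j = n
    · subst hj; simpa using hx
    · rw [Function.update_of_ne hj]
  have hDi : IntegrableOn (jacquetIntegrand ψ f) D (coordMeasure μ k c c) :=
    (integrableOn_box μ hψ hfc _).mono_set Set.sdiff_subset
  suffices h : ∫ v in D, jacquetIntegrand ψ f v ∂(coordMeasure μ k c c) = 0 by
    rw [hD, setIntegral_sdiff (measurableSet_box _) (integrableOn_box μ hψ hfc _) hsub] at h
    exact sub_eq_zero.1 h
  have hDv : ∀ v ∈ D, (∀ p, p.1.1.2 ≤ m → ‖v p‖ ≤ ∑ j, (N j : ℝ)) ∧ (N' n : ℝ) < ‖colPart n v‖ := by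
    rintro v ⟨hv1, hv2⟩
    refine ⟨fun p hp => ?_, ?_⟩
    · have hpn : p.1.1.2 < n := by rw [Fin.le_def] at hp; rw [Fin.lt_def]; omega
      refine (norm_le_colPart v p).trans ((hv1 _).trans ?_)
      rw [Function.update_of_ne hpn.ne, hN' _ hpn, Function.update_of_ne hpn.ne]
      exact Finset.single_le_sum (f := fun j => (N j : ℝ)) (fun _ _ => by positivity)
        (Finset.mem_univ _)
    · simp only [box, Set.mem_ofPred_eq, not_forall, not_le] at hv2
      obtain ⟨j, hj⟩ := hv2
      by_cases hjn : j = n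
      · rwa [hjn] at hj
      · have := hv1 j
        rw [Function.update_of_ne hjn] at this
        exact absurd hj (not_lt.2 this)
  have hSD : ∀ ε : Fin c × Fin k × Fin c → F, ‖ε‖ ≤ δ → ∀ v, shear m ε v ∈ D ↔ v ∈ D := by
    intro ε hε v
    simp only [hD, Set.mem_sdiff, box, Set.mem_ofPred_eq,
      norm_colPart_shear m (hε.trans_lt hδ1)]
  -- The substitution `v ↦ shear m ε v` has Jacobian one and maps `D` to itself; only the character
  -- factor survives.
  have hinv : ∀ ε ∈ Metric.closedBall (0 : Fin c × Fin k × Fin c → F) δ,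
      ∫ v in D, jacquetIntegrand ψ f v * (((ψ (∑ x, ε x * pairing n v x))⁻¹ : Circle) : ℂ)
        ∂(coordMeasure μ k c c) = ∫ v in D, jacquetIntegrand ψ f v ∂(coordMeasure μ k c c) := by
    intro ε hε
    rw [mem_closedBall_zero_iff] at hε
    obtain ⟨h1, h2⟩ := hδ ε hε
    rw [← integral_indicator hDm, ← integral_indicator hDm]
    have hmap : Measure.map (shear m ε) (coordMeasure μ k c c) = coordMeasure μ k c c := by
      have := map_linearMap_pi μ hF (f := shear (c := c) (F := F) m ε)
        (norm_ne_zero_iff.1 (by rw [h1]; exact one_ne_zero))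
      rw [h1, inv_one, ENNReal.ofReal_one, one_smul] at this
      exact this
    conv_rhs => rw [← hmap]
    rw [integral_map (LinearMap.continuous_on_pi _).measurable.aemeasurable
      (hFc.measurable.indicator hDm).aestronglyMeasurable]
    congr 1
    funext v
    by_cases hv : v ∈ D
    · rw [Set.indicator_of_mem hv, Set.indicator_of_mem ((hSD ε hε v).2 hv), jacquetIntegrand,
        jacquetIntegrand, h2 v (hDv v hv).1 ζ f hf hfU, psiV_shear ψ hmn, mul_inv, Circle.coe_mul,
        mul_assoc]
    · rw [Set.indicator_of_notMem hv, Set.indicator_of_notMem fun h => hv ((hSD ε hε v).1 h)]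
  let ν : Measure (Fin c × Fin k × Fin c → F) := Measure.pi fun _ => μ
  let Ball := Metric.closedBall (0 : Fin c × Fin k × Fin c → F) δ
  have hBfin : ν Ball < ⊤ := (isCompact_closedBall _ _).measure_lt_top
  have hBpos : 0 < ν Ball := (Metric.measure_closedBall_pos ν _ hδ0)
  haveI : IsFiniteMeasure (ν.restrict Ball) := ⟨by simpa using hBfin⟩
  have hcont : Continuous fun z : (Fin c × Fin k × Fin c → F) × Coord k c c F =>
      (((ψ (∑ x, z.1 x * pairing n z.2 x))⁻¹ : Circle) : ℂ) := by
    refine continuous_subtype_val.comp (hψ.comp (continuous_finsetSum _ fun x _ => ?_)).inv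
    refine ((continuous_apply x).comp continuous_fst).mul ?_
    simp only [pairing, strictUpper, Matrix.of_apply]
    by_cases h : x.2.1 < n
    · simp only [h, dif_pos]; fun_prop
    · simp only [h, dif_neg, not_false_iff]; fun_prop
  have hswap : ∫ ε in Ball, ∫ v in D, jacquetIntegrand ψ f v *
      (((ψ (∑ x, ε x * pairing n v x))⁻¹ : Circle) : ℂ) ∂(coordMeasure μ k c c) ∂ν =
      ∫ v in D, ∫ ε in Ball, jacquetIntegrand ψ f v *
      (((ψ (∑ x, ε x * pairing n v x))⁻¹ : Circle) : ℂ) ∂ν ∂(coordMeasure μ k c c) := by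
    refine integral_integral_swap ?_
    refine Integrable.mul_bdd (c := 1) (hDi.comp_snd (ν.restrict Ball)) ?_ ?_
    · exact hcont.aestronglyMeasurable
    · exact Eventually.of_forall fun v => (Circle.norm_coe _).le
  have hzero : ∀ v ∈ D, ∫ ε in Ball, jacquetIntegrand ψ f v *
      (((ψ (∑ x, ε x * pairing n v x))⁻¹ : Circle) : ℂ) ∂ν = 0 := by
    intro v hv
    rw [integral_const_mul, integral_addChar_closedBall μ ψ ha (pairing n v) ?_, mul_zero]
    rw [norm_pairing, mul_comm, ← div_le_iff₀ hδ0]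
    refine (Nat.le_ceil _).trans (le_trans ?_ (hDv v hv).2.le)
    exact_mod_cast hx₀.trans hNn
  have hleft := setIntegral_congr_fun (μ := ν) (s := Ball) Metric.isClosed_closedBall.measurableSet hinv
  rw [hleft, setIntegral_const, setIntegral_eq_zero_of_forall_eq_zero hzero] at hswap
  refine (smul_eq_zero.1 hswap).resolve_left ?_
  exact (ENNReal.toReal_pos hBpos.ne' hBfin.ne).ne'

/-- Bounds are chosen from the first column onwards: stability in a column involves only its own
bound and those of earlier columns, so later choices do not disturb it. -/
theorem exists_stable (hF : IsNormalizedAbs F) (hτ : ∀ i, ∀ u : Fˣ, ‖(u : F)‖ = 1 → τ i u = 1)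
    (hψ : Continuous ψ) (hψ1 : ψ ≠ 1) {U : Set (GL (Fin (k * c)) F)} (hU : U ∈ 𝓝 1) :
    ∃ N : Fin k → ℕ, ∀ n, ColStable μ c τ ψ U N n := by
  have h : ∀ j : ℕ, ∃ N : Fin k → ℕ, ∀ n : Fin k, (n : ℕ) < j → ColStable μ c τ ψ U N n := by
    intro j
    induction j with
    | zero => exact ⟨0, fun n hn => absurd hn (Nat.not_lt_zero _)⟩
    | succ j ih =>
      obtain ⟨N, hN⟩ := ih
      by_cases hj : j < k
      · obtain ⟨B, hB⟩ := exists_colStable (τ := τ) μ hF hτ hψ hψ1 hU N ⟨j, hj⟩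
        refine ⟨Function.update N ⟨j, hj⟩ B, fun n hn => ?_⟩
        · rcases Nat.lt_succ_iff_lt_or_eq.1 hn with h1 | h1
          · intro N' hN' hNn
            have hne : n ≠ ⟨j, hj⟩ := fun h => h1.ne (by rw [h])
            rw [Function.update_of_ne hne] at hNn
            refine hN n h1 N' (fun i hi => ?_) hNn
            rw [hN' i hi, Function.update_of_ne]
            rintro rfl
            exact absurd hi (not_lt.2 (Fin.le_def.2 h1.le))
          · obtain rfl : n = ⟨j, hj⟩ := Fin.ext h1
            exact hB B le_rfl
      · exact ⟨N, fun n _ => hN n (by omega)⟩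
  obtain ⟨N, hN⟩ := h k
  exact ⟨N, fun n => hN n n.2⟩

/-- Columns are enlarged from the last to the first, because `ColStable` for a column allows
arbitrary later columns but fixes the earlier ones. -/
theorem boxIntegral_eq_of_stable {U : Set (GL (Fin (k * c)) F)} {N : Fin k → ℕ}
    (hN : ∀ n, ColStable μ c τ ψ U N n) {M : Fin k → ℕ} (hM : N ≤ M) {ζ : Fin k → ℂ}
    {f : GL (Fin (k * c)) F → ℂ} (hf : f ∈ rhoSpace c τ ζ) (hfU : RInv U f) :
    boxIntegral μ ψ M f = boxIntegral μ ψ N f := by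
  have h : ∀ j ≤ k, boxIntegral μ ψ (fun b => if k - j ≤ (b : ℕ) then M b else N b) f =
      boxIntegral μ ψ N f := by
    intro j
    induction j with
    | zero =>
      intro _
      congr 1
      funext b
      rw [if_neg]
      have := b.2
      omega
    | succ j ih =>
      intro hj
      rw [← ih (by omega)]
      have hlt : k - (j + 1) < k := by omega
      have := hN ⟨k - (j + 1), hlt⟩ (fun b => if k - j ≤ (b : ℕ) then M b else N b)
        (fun i hi => ?_) (by simp; split_ifs; exacts [hM _, le_rfl]) (M ⟨k - (j + 1), hlt⟩)
        (by simp; split_ifs; exacts [le_rfl, hM _]) ζ f hf hfU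
      · rw [← this]
        congr 1
        funext b
        by_cases hb : b = ⟨k - (j + 1), hlt⟩
        · subst hb; simp
        · rw [Function.update_of_ne hb]
          have hb' : (b : ℕ) ≠ k - (j + 1) := fun h => hb (Fin.ext h)
          congr 1
          rw [eq_iff_iff]
          omega
      · rw [Fin.lt_def] at hi
        simp only at hi
        rw [if_neg]
        omega
  rw [← h k le_rfl]
  congr 1
  funext b
  simp

/-- The Jacquet integrals extend to a linear functional, independent of `ζ`, which on functions
with a given level is a finite combination of evaluations. -/
theorem exists_jacquetFunctional (hF : IsNormalizedAbs F)
    (hτ : ∀ i, ∀ u : Fˣ, ‖(u : F)‖ = 1 → τ i u = 1) (hψ : Continuous ψ) (hψ1 : ψ ≠ 1) :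
    ∃ Λ : (GL (Fin (k * c)) F → ℂ) →ₗ[ℂ] ℂ,
      (∀ U ∈ 𝓝 (1 : GL (Fin (k * c)) F), ∃ A ∈ evalSpan (GL (Fin (k * c)) F),
        ∀ ζ, ∀ f ∈ rhoSpace c τ ζ, RInv U f → Λ f = A f) ∧
      ∀ ζ ∈ convergenceDomain c τ ψ μ, ∀ f ∈ rhoSpace c τ ζ, Λ f = jacquetIntegral ψ μ f := by
  have hadd : ∀ (N : Fin k → ℕ) (f g : GL (Fin (k * c)) F → ℂ), Continuous f → Continuous g →
      boxIntegral μ ψ N (f + g) = boxIntegral μ ψ N f + boxIntegral μ ψ N g := by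
    intro N f g hf hg
    rw [boxIntegral, boxIntegral, boxIntegral,
      ← integral_add (integrableOn_box μ hψ hf N) (integrableOn_box μ hψ hg N)]
    congr 1
    funext v
    simp [jacquetIntegrand, add_mul]
  have hsmul : ∀ (N : Fin k → ℕ) (x : ℂ) (f : GL (Fin (k * c)) F → ℂ),
      boxIntegral μ ψ N (x • f) = x * boxIntegral μ ψ N f := by
    intro N x f
    rw [boxIntegral, boxIntegral, ← integral_const_mul]
    congr 1
    funext v
    simp [jacquetIntegrand, mul_assoc]
  let W : Submodule ℂ (GL (Fin (k * c)) F → ℂ) :=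
    { carrier := {f | Continuous f ∧ ∃ a, Tendsto (fun N => boxIntegral μ ψ N f) atTop (𝓝 a)}
      add_mem' := by
        rintro f g ⟨hf, a, ha⟩ ⟨hg, b, hb⟩
        refine ⟨hf.add hg, a + b, ?_⟩
        simp only [hadd _ f g hf hg]
        exact ha.add hb
      zero_mem' := ⟨continuous_const, 0, by
        have : ∀ N : Fin k → ℕ, boxIntegral μ ψ N (0 : GL (Fin (k * c)) F → ℂ) = 0 := fun N => by
          simp [boxIntegral, jacquetIntegrand]
        simp only [this]
        exact tendsto_const_nhds⟩
      smul_mem' := by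
        rintro x f ⟨hf, a, ha⟩
        refine ⟨hf.const_smul x, x * a, ?_⟩
        simp only [hsmul]
        exact ha.const_mul x }
  let L : W →ₗ[ℂ] ℂ :=
    { toFun := fun f => limUnder atTop fun N => boxIntegral μ ψ N f.1
      map_add' := by
        rintro ⟨f, hf, a, ha⟩ ⟨g, hg, b, hb⟩
        rw [ha.limUnder_eq, hb.limUnder_eq]
        refine Tendsto.limUnder_eq ?_
        simp only [Submodule.coe_add, hadd _ f g hf hg]
        exact ha.add hb
      map_smul' := by
        rintro x ⟨f, hf, a, ha⟩
        rw [ha.limUnder_eq]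
        refine Tendsto.limUnder_eq ?_
        simp only [Submodule.coe_smul, hsmul]
        exact ha.const_mul x }
  -- `L` is the limit over boxes, defined on the continuous functions for which it exists. The
  -- extension makes it total, and is only ever evaluated where the limit exists.
  obtain ⟨Λ, hΛ⟩ := LinearMap.exists_extend L
  have hval : ∀ (f : GL (Fin (k * c)) F → ℂ) (a : ℂ), Continuous f →
      Tendsto (fun N => boxIntegral μ ψ N f) atTop (𝓝 a) → Λ f = a := by
    intro f a hf ha
    have h1 := LinearMap.congr_fun hΛ ⟨f, hf, a, ha⟩
    exact h1.trans ha.limUnder_eq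
  refine ⟨Λ, fun U hU => ?_, fun ζ hζ f hf => ?_⟩
  · obtain ⟨N, hN⟩ := exists_stable (τ := τ) μ hF hτ hψ hψ1 hU
    obtain ⟨A, hA, hAf⟩ := exists_evalSpan_setIntegral (ν := coordMeasure μ k c c)
      (isCompact_box N) (measurableSet_box N)
      (x := fun v => weyl k c * unip v) (continuous_const.mul continuous_unip)
      (θ := fun v => (((psiV ψ v)⁻¹ : Circle) : ℂ))
      ((continuous_subtype_val.comp (continuous_psiV hψ).inv).continuousOn.integrableOn_compact
        (isCompact_box N)) hU
    refine ⟨A, hA, fun ζ f hf hfU => hval f _ (hfU.continuous hU) ?_⟩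
    rw [← (hAf f hfU).2]
    refine tendsto_const_nhds.congr' ?_
    -- Stability makes the net of box integrals eventually constant, whether or not the full
    -- integral converges.
    filter_upwards [eventually_ge_atTop N] with M hM
    exact (boxIntegral_eq_of_stable μ hN hM hf hfU).symm
  · refine hval f _ hf.1.continuous ?_
    have h1 := tendsto_setIntegral_of_monotone (μ := coordMeasure μ k c c)
      (s := box k c F) measurableSet_box box_mono (hζ f hf).integrableOn
    have h2 : (⋃ N, box k c F N) = Set.univ := by
      refine Set.eq_univ_of_forall fun v => Set.mem_iUnion.2 ⟨fun j => ⌈‖colPart j v‖⌉₊, fun j => ?_⟩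
      exact Nat.le_ceil _
    rw [h2, Measure.restrict_univ] at h1
    exact h1

end Stable

/-! ### The group law of V_{(c^k)} in coordinates and its triangularity. -/

section Mul

variable {F : Type*} [NontriviallyNormedField F] {k a b c l r : ℕ}

/-- Block matrices vanishing on and below the block diagonal. -/
def StrictlyUpper (M : Matrix (Fin k × Fin a) (Fin k × Fin b) F) : Prop :=
  ∀ s t, ¬ s.1 < t.1 → M s t = 0

/-- The coordinates of a block matrix above the block diagonal. -/
def entriesOf (M : Matrix (Fin k × Fin a) (Fin k × Fin b) F) : Coord k a b F :=
  fun p => M (p.1.1.1, p.2.1) (p.1.1.2, p.2.2)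

theorem strictlyUpper_strictUpper (v : Coord k a b F) : StrictlyUpper (strictUpper v) :=
  fun _ _ h => strictUpper_eq_zero v h

theorem strictUpper_entriesOf {M : Matrix (Fin k × Fin a) (Fin k × Fin b) F}
    (h : StrictlyUpper M) : strictUpper (entriesOf M) = M := by
  ext s t
  by_cases hst : s.1 < t.1
  · simp [strictUpper, hst, entriesOf]
  · rw [strictUpper_eq_zero _ hst, h s t hst]

theorem StrictlyUpper.mul {M : Matrix (Fin k × Fin a) (Fin k × Fin b) F}
    {N : Matrix (Fin k × Fin b) (Fin k × Fin c) F} (hM : StrictlyUpper M) (hN : StrictlyUpper N) :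
    StrictlyUpper (M * N) := fun s t h => by
  rw [Matrix.mul_apply]
  refine Finset.sum_eq_zero fun q _ => ?_
  by_cases h1 : s.1 < q.1
  · rw [hN q t fun h2 => h (h1.trans h2), mul_zero]
  · rw [hM s q h1, zero_mul]

/-- Equality of the block diagonals of index less than `d`. -/
def AgreeBelow (d : ℕ) (M N : Matrix (Fin k × Fin a) (Fin k × Fin b) F) : Prop :=
  ∀ s t, (t.1 : ℕ) < s.1 + d → M s t = N s t

theorem AgreeBelow.add {d : ℕ} {M M' N N' : Matrix (Fin k × Fin a) (Fin k × Fin b) F}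
    (h : AgreeBelow d M M') (h' : AgreeBelow d N N') : AgreeBelow d (M + N) (M' + N') :=
  fun s t hst => by rw [Matrix.add_apply, Matrix.add_apply, h s t hst, h' s t hst]

theorem AgreeBelow.mono {d d' : ℕ} {M M' : Matrix (Fin k × Fin a) (Fin k × Fin b) F}
    (h : AgreeBelow d M M') (hd : d' ≤ d) : AgreeBelow d' M M' :=
  fun s t hst => h s t (by omega)

/-- Both factors start above the diagonal, so an entry of the product at distance `d` involves only
entries at smaller distance. This gain of one diagonal makes multiplication triangular with respect
to `gap`. -/
theorem AgreeBelow.mul {d : ℕ} {M M' : Matrix (Fin k × Fin a) (Fin k × Fin b) F}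
    {N N' : Matrix (Fin k × Fin b) (Fin k × Fin c) F} (h : AgreeBelow d M M')
    (h' : AgreeBelow d N N') (hM : StrictlyUpper M) (hM' : StrictlyUpper M') (hN : StrictlyUpper N)
    (hN' : StrictlyUpper N') : AgreeBelow (d + 1) (M * N) (M' * N') := fun s t hst => by
  rw [Matrix.mul_apply, Matrix.mul_apply]
  refine Finset.sum_congr rfl fun q _ => ?_
  by_cases h1 : s.1 < q.1
  · by_cases h2 : q.1 < t.1
    · rw [Fin.lt_def] at h1 h2
      rw [h s q (by omega), h' q t (by omega)]
    · rw [hN q t h2, hN' q t h2, mul_zero, mul_zero]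
  · rw [hM s q h1, hM' s q h1, zero_mul, zero_mul]

/-- The multiplication of `V_{(c^k)}` in coordinates. -/
def mulCoord (u v : Coord k c c F) : Coord k c c F :=
  u + v + entriesOf (strictUpper u * strictUpper v)

theorem strictUpper_mulCoord (u v : Coord k c c F) :
    strictUpper (mulCoord u v) = strictUpper u + strictUpper v + strictUpper u * strictUpper v := by
  rw [mulCoord, strictUpper_add, strictUpper_add, strictUpper_entriesOf
    ((strictlyUpper_strictUpper u).mul (strictlyUpper_strictUpper v))]

theorem unip_mulCoord (u v : Coord k c c F) : unip (mulCoord u v) = unip u * unip v := by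
  apply blocks_injective
  rw [blocks_mul, blocks_unip, blocks_unip, blocks_unip, strictUpper_mulCoord]
  noncomm_ring

/-- The quadratic term of the group law starts at the second superdiagonal, which `ψ` does not see.
-/
theorem psiV_mulCoord (ψ : AddChar F Circle) (u v : Coord k c c F) :
    psiV ψ (mulCoord u v) = psiV ψ u * psiV ψ v := by
  rw [psiV, psiV, psiV, ← AddChar.map_add_eq_mul, ← Finset.sum_add_distrib]
  congr 1
  refine Finset.sum_congr rfl fun p _ => ?_
  split_ifs with h
  · rw [← Finset.sum_add_distrib]
    refine Finset.sum_congr rfl fun α _ => ?_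
    rw [mulCoord, Pi.add_apply, Pi.add_apply, add_eq_left, entriesOf, Matrix.mul_apply]
    refine Finset.sum_eq_zero fun q _ => ?_
    by_cases h1 : p.1.1 < q.1
    · rw [strictUpper_eq_zero v, mul_zero]
      rw [Fin.lt_def] at h1 ⊢
      simp only
      omega
    · rw [strictUpper_eq_zero u h1, zero_mul]
  · rw [add_zero]

theorem continuous_strictUpper : Continuous (strictUpper : Coord k a b F → _) := by
  refine continuous_matrix fun s t => ?_
  by_cases h : s.1 < t.1
  · simp only [strictUpper, Matrix.of_apply, h, dif_pos]; fun_prop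
  · simp only [strictUpper, Matrix.of_apply, h, dif_neg, not_false_iff]; fun_prop

theorem continuous_mulCoord {X : Type*} [TopologicalSpace X] {u v : X → Coord k c c F}
    (hu : Continuous u) (hv : Continuous v) : Continuous fun x => mulCoord (u x) (v x) := by
  refine (hu.add hv).add (continuous_pi fun p => ?_)
  exact ((continuous_strictUpper.comp hu).matrix_mul (continuous_strictUpper.comp hv)).matrix_elem _ _

/-- The difference of block indices. -/
def gap (p : Pair k × Fin a × Fin b) : ℕ := p.1.1.2 - p.1.1.1

theorem agreeBelow_strictUpper {v v' : Coord k a b F} {d : ℕ}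
    (h : ∀ q, gap q < d → v q = v' q) : AgreeBelow d (strictUpper v) (strictUpper v') := by
  intro s t hst
  by_cases h1 : s.1 < t.1
  · simp only [strictUpper, h1, Matrix.of_apply, dif_pos]
    refine h _ ?_
    rw [Fin.lt_def] at h1
    simp only [gap]
    omega
  · rw [strictUpper_eq_zero _ h1, strictUpper_eq_zero _ h1]

theorem AgreeBelow.entriesOf_eq {d : ℕ} {M M' : Matrix (Fin k × Fin a) (Fin k × Fin b) F}
    (h : AgreeBelow (d + 1) M M') {p : Pair k × Fin a × Fin b} (hp : gap p = d) :
    entriesOf M p = entriesOf M' p := by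
  refine h _ _ ?_
  have := p.1.2
  rw [Fin.lt_def] at this
  simp only [gap] at hp ⊢
  omega

/-- The coordinates at the positions in `S`. -/
def mask (S : Fin c → Fin c → Prop) [∀ α β, Decidable (S α β)] (v : Coord k c c F) :
    Coord k c c F := fun p => if S p.2.1 p.2.2 then v p else 0

theorem continuous_mask (S : Fin c → Fin c → Prop) [∀ α β, Decidable (S α β)] :
    Continuous (mask S : Coord k c c F → _) := by
  refine continuous_pi fun p => ?_
  by_cases h : S p.2.1 p.2.2
  · simp only [mask, h, if_true]; fun_prop
  · simp only [mask, h, if_false]; fun_prop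

variable [IsUltrametricDist F] [ProperSpace F] [MeasurableSpace F] [BorelSpace F] (μ : Measure F)
  [μ.IsAddHaarMeasure]

theorem measurePreserving_mulCoord_right (hF : IsNormalizedAbs F) (u : Coord k c c F) :
    MeasurePreserving (fun v => mulCoord v u) (coordMeasure μ k c c) (coordMeasure μ k c c) := by
  refine measurePreserving_triangular μ hF gap (fun _ => 1) (fun _ => norm_one) _
    (continuous_mulCoord continuous_id continuous_const).measurable fun p x y h => ?_
  have h1 := (agreeBelow_strictUpper h).mul (fun _ _ _ => rfl : AgreeBelow _ (strictUpper u) (strictUpper u))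
    (strictlyUpper_strictUpper x) (strictlyUpper_strictUpper y) (strictlyUpper_strictUpper u)
    (strictlyUpper_strictUpper u)
  simp only [mulCoord, Pi.add_apply, h1.entriesOf_eq rfl]
  ring

/-- Up to terms in coordinates of smaller `gap`, the product of the three parts is their sum, which
is `v`. -/
theorem measurePreserving_mask (hF : IsNormalizedAbs F) (S₁ S₂ S₃ : Fin c → Fin c → Prop)
    [∀ α β, Decidable (S₁ α β)] [∀ α β, Decidable (S₂ α β)] [∀ α β, Decidable (S₃ α β)]
    (hS : ∀ v : Coord k c c F, mask S₁ v + mask S₂ v + mask S₃ v = v) :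
    MeasurePreserving (fun v => mulCoord (mulCoord (mask S₁ v) (mask S₂ v)) (mask S₃ v))
      (coordMeasure μ k c c) (coordMeasure μ k c c) := by
  refine measurePreserving_triangular μ hF gap (fun _ => 1) (fun _ => norm_one) _
    (continuous_mulCoord (continuous_mulCoord (continuous_mask _) (continuous_mask _))
      (continuous_mask _)).measurable fun p x y h => ?_
  have hm : ∀ (S : Fin c → Fin c → Prop) [∀ α β, Decidable (S α β)],
      AgreeBelow (gap p) (strictUpper (mask S x)) (strictUpper (mask S y)) := fun S _ =>
    agreeBelow_strictUpper fun q hq => by simp only [mask, h q hq]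
  have su : ∀ v : Coord k c c F, StrictlyUpper (strictUpper v) := strictlyUpper_strictUpper
  have h1 := (hm S₁).mul (hm S₂) (su _) (su _) (su _) (su _)
  have h2 : AgreeBelow (gap p) (strictUpper (mulCoord (mask S₁ x) (mask S₂ x)))
      (strictUpper (mulCoord (mask S₁ y) (mask S₂ y))) := by
    rw [strictUpper_mulCoord, strictUpper_mulCoord]
    exact ((hm S₁).add (hm S₂)).add (h1.mono (Nat.le_succ _))
  have h3 := h2.mul (hm S₃) (su _) (su _) (su _) (su _)
  have hx := congrFun (hS x) p
  have hy := congrFun (hS y) p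
  simp only [Pi.add_apply] at hx hy
  have e3 := h3.entriesOf_eq rfl
  have e1 := h1.entriesOf_eq rfl
  simp only [mulCoord, Pi.add_apply] at e1 e3 ⊢
  rw [e1, e3]
  linear_combination hx - hy

end Mul

/-! ### The factorization of V_{(c^k)} through V², the diagonal blocks and V³. -/

section Blocks

variable {F : Type*} [NontriviallyNormedField F] {k l r : ℕ}

theorem psiV_blockCoord (ψ : AddChar F Circle) (v1 : Coord k l l F) (v2 : Coord k l r F)
    (v3 : Coord k r l F) (v4 : Coord k r r F) :
    psiV ψ (blockCoord v1 v2 v3 v4) = psiV ψ v1 * psiV ψ v4 := by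
  rw [psiV, psiV, psiV, ← AddChar.map_add_eq_mul, ← Finset.sum_add_distrib]
  congr 1
  refine Finset.sum_congr rfl fun p _ => ?_
  split_ifs with h
  · rw [← finSumFinEquiv.sum_comp, Fintype.sum_sum_type]
    simp only [blockCoord_apply, Matrix.fromBlocks_apply₁₁, Matrix.fromBlocks_apply₂₂,
      Matrix.of_apply]
  · rw [add_zero]

/-- Positions of the coordinates of the four kinds. -/
def blockPos (k l r : ℕ) : (Pair k × Fin r × Fin l) ⊕ (((Pair k × Fin l × Fin l) ⊕
    (Pair k × Fin r × Fin r)) ⊕ (Pair k × Fin l × Fin r)) → Pair k × Fin (l + r) × Fin (l + r) :=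
  Sum.elim (fun p => (p.1, finSumFinEquiv (Sum.inr p.2.1), finSumFinEquiv (Sum.inl p.2.2)))
    (Sum.elim (Sum.elim
      (fun p => (p.1, finSumFinEquiv (Sum.inl p.2.1), finSumFinEquiv (Sum.inl p.2.2)))
      (fun p => (p.1, finSumFinEquiv (Sum.inr p.2.1), finSumFinEquiv (Sum.inr p.2.2))))
      (fun p => (p.1, finSumFinEquiv (Sum.inl p.2.1), finSumFinEquiv (Sum.inr p.2.2))))

theorem blockPos_bijective : Function.Bijective (blockPos k l r) := by
  constructor
  · rintro (⟨p, α, β⟩ | (⟨p, α, β⟩ | ⟨p, α, β⟩) | ⟨p, α, β⟩)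
      (⟨p', α', β'⟩ | (⟨p', α', β'⟩ | ⟨p', α', β'⟩) | ⟨p', α', β'⟩) h <;>
    simp only [blockPos, Sum.elim_inl, Sum.elim_inr, Prod.mk.injEq,
      EmbeddingLike.apply_eq_iff_eq, Sum.inl.injEq, Sum.inr.injEq, reduceCtorEq, false_and,
      and_false] at h <;>
    obtain ⟨rfl, rfl, rfl⟩ := h <;> rfl
  · rintro ⟨p, α, β⟩
    obtain ⟨α, rfl⟩ := finSumFinEquiv.surjective α
    obtain ⟨β, rfl⟩ := finSumFinEquiv.surjective β
    rcases α with α | α <;> rcases β with β | β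
    · exact ⟨Sum.inr (Sum.inl (Sum.inl (p, α, β))), rfl⟩
    · exact ⟨Sum.inr (Sum.inr (p, α, β)), rfl⟩
    · exact ⟨Sum.inl (p, α, β), rfl⟩
    · exact ⟨Sum.inr (Sum.inl (Sum.inr (p, α, β))), rfl⟩

/-- The element of `GL_{k(l+r)}` with the coordinates of `diag(u₁, u₂)`, conjugated by `κ`. -/
noncomputable def diagUnip (u : Coord k l l F × Coord k r r F) : GL (Fin (k * (l + r))) F :=
  unip (blockCoord u.1 0 0 u.2)

theorem kappa_conj_diagGL_unip (u : Coord k l l F × Coord k r r F) :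
    diagGL (unip u.1) (unip u.2) * kappa k l r = kappa k l r * diagUnip u := by
  have h : diagGL (unip u.1) (unip u.2) = kappa k l r * diagUnip u * (kappa k l r)⁻¹ := by
    refine Units.ext ?_
    rw [kappa, mul_permGL_inv_val, permGL_mul_val]
    ext a b
    obtain ⟨a, rfl⟩ := (splitEquiv k l r).surjective a
    obtain ⟨b, rfl⟩ := (splitEquiv k l r).surjective b
    have hb : ∀ (i j : Fin k) (α β : Fin l ⊕ Fin r), (diagUnip u).val
        (finProdFinEquiv (i, finSumFinEquiv α)) (finProdFinEquiv (j, finSumFinEquiv β)) =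
        (1 + strictUpper (blockCoord u.1 0 0 u.2)) (i, finSumFinEquiv α) (j, finSumFinEquiv β) :=
      fun i j α β => by rw [← blocks_unip]; rfl
    have hl : ∀ {c : ℕ} (u : Coord k c c F) (i j : Fin k) (α β : Fin c), (unip u).val
        (finProdFinEquiv (i, α)) (finProdFinEquiv (j, β)) =
        (1 + strictUpper u) (i, α) (j, β) := fun u i j α β => by rw [← blocks_unip]; rfl
    rcases a with a | a <;> rcases b with b | b <;>
      obtain ⟨⟨i, α⟩, rfl⟩ := finProdFinEquiv.surjective a <;>
      obtain ⟨⟨j, β⟩, rfl⟩ := finProdFinEquiv.surjective b <;>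
      simp only [diagGL, assemble, Matrix.submatrix_apply, Equiv.symm_apply_apply,
        Matrix.fromBlocks_apply₁₁, Matrix.fromBlocks_apply₂₂, Matrix.fromBlocks_apply₁₂,
        Matrix.fromBlocks_apply₂₁, hl, kappaPerm_inl, kappaPerm_inr, id, hb, Matrix.add_apply,
        strictUpper, Matrix.of_apply, blockCoord_apply, Matrix.one_apply, Prod.mk.injEq,
        EmbeddingLike.apply_eq_iff_eq, Sum.inl.injEq, Sum.inr.injEq, reduceCtorEq, and_false,
        if_false, Matrix.zero_apply, Pi.zero_apply, dite_eq_ite, ite_self, add_zero]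
  rw [h, inv_mul_cancel_right]

theorem diagGL_mul (a a' : GL (Fin (k * l)) F) (d d' : GL (Fin (k * r)) F) :
    diagGL (a * a') (d * d') = diagGL a d * diagGL a' d' := by
  refine Units.ext ?_
  simp [diagGL, assemble_mul]

/-- The integrand of `m(ζ, κ)` at `diag(w u₁, w u₂) g`. -/
theorem kappa_inv_zElt_diagGL (z : Coord k l r F) (u : Coord k l l F × Coord k r r F)
    (g : GL (Fin (k * (l + r))) F) :
    (kappa k l r)⁻¹ * zElt z * (diagGL (weyl k l * unip u.1) (weyl k r * unip u.2) * g) =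
      weyl k (l + r) * unip (blockCoord 0 z 0 0) * diagUnip u * ((kappa k l r)⁻¹ * g) := by
  have h1 := kappa_conj_diagGL_unip u
  have h2 := diagGL_weyl_mul_kappa (F := F) (k := k) (l := l) (r := r)
  rw [← eq_mul_inv_iff_mul_eq] at h1 h2
  rw [kappa_inv_mul_zElt, diagGL_mul, h1, h2]
  group

theorem continuous_blockCoord {X : Type*} [TopologicalSpace X] {v1 : X → Coord k l l F}
    {v2 : X → Coord k l r F} {v3 : X → Coord k r l F} {v4 : X → Coord k r r F}
    (h1 : Continuous v1) (h2 : Continuous v2) (h3 : Continuous v3) (h4 : Continuous v4) :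
    Continuous fun x => blockCoord (v1 x) (v2 x) (v3 x) (v4 x) := by
  refine continuous_pi fun p => ?_
  obtain ⟨p, α, β⟩ := p
  obtain ⟨α, rfl⟩ := finSumFinEquiv.surjective α
  obtain ⟨β, rfl⟩ := finSumFinEquiv.surjective β
  simp only [blockCoord_apply]
  rcases α with α | α <;> rcases β with β | β <;>
    simp only [Matrix.fromBlocks_apply₁₁, Matrix.fromBlocks_apply₂₂, Matrix.fromBlocks_apply₁₂,
        Matrix.fromBlocks_apply₂₁, Matrix.of_apply] <;> fun_prop

theorem continuous_diagUnip :
    Continuous (diagUnip : Coord k l l F × Coord k r r F → _) :=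
  continuous_unip.comp (continuous_blockCoord continuous_fst continuous_const continuous_const
    continuous_snd)

theorem blockCoord_zero :
    blockCoord (0 : Coord k l l F) (0 : Coord k l r F) (0 : Coord k r l F) (0 : Coord k r r F) = 0 := by
  funext ⟨p, α, β⟩
  obtain ⟨α, rfl⟩ := finSumFinEquiv.surjective α
  obtain ⟨β, rfl⟩ := finSumFinEquiv.surjective β
  rw [blockCoord_apply]
  rcases α with α | α <;> rcases β with β | β <;> rfl

theorem unip_zero {c : ℕ} : unip (0 : Coord k c c F) = 1 := by
  apply blocks_injective
  rw [blocks_unip, blocks_one]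
  ext s t
  simp [strictUpper]

theorem continuous_vThree : Continuous (vThree : Coord k r l F → GL (Fin (k * (l + r))) F) :=
  continuous_unip.comp (continuous_blockCoord continuous_const continuous_const continuous_id
    continuous_const)

theorem vThree_zero : vThree (0 : Coord k r l F) = 1 := by
  rw [vThree, blockCoord_zero, unip_zero]

theorem diagUnip_zero : diagUnip (0 : Coord k l l F × Coord k r r F) = 1 := by
  rw [diagUnip, Prod.fst_zero, Prod.snd_zero, blockCoord_zero, unip_zero]

theorem rhoSpace_translate {c : ℕ} {τ : Fin k → (Fˣ →* ℂˣ)} {ζ : Fin k → ℂ}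
    {f : GL (Fin (k * c)) F → ℂ} (hf : f ∈ rhoSpace c τ ζ) (g : GL (Fin (k * c)) F) :
    (fun x => f (x * g)) ∈ rhoSpace c τ ζ :=
  ⟨hf.1.translate g, fun m u x => by
    change f (levi m * unip u * x * g) = _
    rw [mul_assoc (levi m * unip u), hf.2]⟩

/-- The modulus factor in `fibre` is therefore trivial at all points where the Jacquet integrals
evaluate it. -/
theorem absDet_weyl_mul_unip {c : ℕ} (v : Coord k c c F) : absDet (weyl k c * unip v) = 1 := by
  have h1 : (unip v).val.det = 1 := by
    change ((1 + strictUpper v).submatrix finProdFinEquiv.symm finProdFinEquiv.symm).det = 1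
    rw [Matrix.det_submatrix_equiv_self, det_one_add_strictUpper]
  have h2 : ‖(weyl k c : GL (Fin (k * c)) F).val.det‖ = 1 := by
    rcases Int.units_eq_one_or (Equiv.Perm.sign (weylPerm k c)) with h | h <;>
      simp [weyl, permGL, Matrix.det_permutation, h]
  rw [absDet, Units.val_mul, Matrix.det_mul, norm_mul, h1, h2, norm_one, mul_one]

variable [IsUltrametricDist F] [ProperSpace F] [MeasurableSpace F] [BorelSpace F] (μ : Measure F)
  [μ.IsAddHaarMeasure]

theorem measurePreserving_blockCoord :
    MeasurePreserving (fun x : Coord k r l F × ((Coord k l l F × Coord k r r F) × Coord k l r F) =>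
      blockCoord x.2.1.1 x.2.2 x.1 x.2.1.2)
      ((coordMeasure μ k r l).prod (((coordMeasure μ k l l).prod (coordMeasure μ k r r)).prod
        (coordMeasure μ k l r))) (coordMeasure μ k (l + r) (l + r)) := by
  let E := Equiv.ofBijective _ (blockPos_bijective (k := k) (l := l) (r := r))
  have h1 := measurePreserving_sumPiEquivProdPi_symm
    (fun _ : (Pair k × Fin l × Fin l) ⊕ (Pair k × Fin r × Fin r) => μ)
  have h2 := measurePreserving_sumPiEquivProdPi_symm
    (fun _ : ((Pair k × Fin l × Fin l) ⊕ (Pair k × Fin r × Fin r)) ⊕ (Pair k × Fin l × Fin r) => μ)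
  have h3 := measurePreserving_sumPiEquivProdPi_symm
    (fun _ : (Pair k × Fin r × Fin l) ⊕ (((Pair k × Fin l × Fin l) ⊕ (Pair k × Fin r × Fin r)) ⊕
      (Pair k × Fin l × Fin r)) => μ)
  have h4 := measurePreserving_piCongrLeft (fun _ => μ) E
  have h5 := h4.comp (h3.comp ((MeasurePreserving.id (coordMeasure μ k r l)).prod
    (h2.comp (h1.prod (MeasurePreserving.id (coordMeasure μ k l r))))))
  convert! h5 using 1
  funext x p
  obtain ⟨q, rfl⟩ := E.surjective p
  simp only [Function.comp_apply]
  rw [MeasurableEquiv.coe_piCongrLeft, Equiv.piCongrLeft_apply_apply]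
  rcases q with ⟨p, α, β⟩ | (⟨p, α, β⟩ | ⟨p, α, β⟩) | ⟨p, α, β⟩ <;>
    exact blockCoord_apply _ _ _ _ _ _ _

/-- The order of the factors matters: V² stands next to w, where it becomes w V² w⁻¹ = κ⁻¹Zκ, and V³
is outermost on the right. -/
theorem measurePreserving_decomposition (hF : IsNormalizedAbs F) :
    ∃ T : Coord k r l F × ((Coord k l l F × Coord k r r F) × Coord k l r F) →
        Coord k (l + r) (l + r) F,
      MeasurePreserving T ((coordMeasure μ k r l).prod
        (((coordMeasure μ k l l).prod (coordMeasure μ k r r)).prod (coordMeasure μ k l r)))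
        (coordMeasure μ k (l + r) (l + r)) ∧
      (∀ x, unip (T x) = unip (blockCoord 0 x.2.2 0 0) * diagUnip x.2.1 * vThree x.1) ∧
      ∀ (ψ : AddChar F Circle) x, psiV ψ (T x) = psiV ψ x.2.1.1 * psiV ψ x.2.1.2 := by
  let h : Fin (l + r) → Bool := fun α => (finSumFinEquiv.symm α).isLeft
  have hS : ∀ v : Coord k (l + r) (l + r) F, mask (fun α β => h α = true ∧ h β = false) v +
      mask (fun α β => h α = h β) v + mask (fun α β => h α = false ∧ h β = true) v = v := by
    intro v
    funext p
    simp only [mask, Pi.add_apply]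
    rcases Bool.eq_false_or_eq_true (h p.2.1) with h1 | h1 <;>
      rcases Bool.eq_false_or_eq_true (h p.2.2) with h2 | h2 <;> simp [h1, h2]
  have hT := (measurePreserving_mask μ hF _ _ _ hS).comp
    (measurePreserving_blockCoord (k := k) (l := l) (r := r) μ)
  have hmask : ∀ (x : Coord k r l F × ((Coord k l l F × Coord k r r F) × Coord k l r F)),
      mask (fun α β => h α = true ∧ h β = false) (blockCoord x.2.1.1 x.2.2 x.1 x.2.1.2) =
        blockCoord 0 x.2.2 0 0 ∧
      mask (fun α β => h α = h β) (blockCoord x.2.1.1 x.2.2 x.1 x.2.1.2) =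
        blockCoord x.2.1.1 0 0 x.2.1.2 ∧
      mask (fun α β => h α = false ∧ h β = true) (blockCoord x.2.1.1 x.2.2 x.1 x.2.1.2) =
        blockCoord 0 0 x.1 0 := by
    intro x
    refine ⟨?_, ?_, ?_⟩ <;> funext ⟨p, α, β⟩ <;>
      obtain ⟨α, rfl⟩ := finSumFinEquiv.surjective α <;>
      obtain ⟨β, rfl⟩ := finSumFinEquiv.surjective β <;>
      simp only [mask, blockCoord_apply, h, Equiv.symm_apply_apply] <;>
      rcases α with α | α <;> rcases β with β | β <;> simp
  refine ⟨_, hT, fun x => ?_, fun ψ x => ?_⟩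
  · obtain ⟨h1, h2, h3⟩ := hmask x
    rw [Function.comp_apply, unip_mulCoord, unip_mulCoord, h1, h2, h3]
    rfl
  · obtain ⟨h1, h2, h3⟩ := hmask x
    rw [Function.comp_apply, psiV_mulCoord, psiV_mulCoord, h1, h2, h3, psiV_blockCoord,
      psiV_blockCoord, psiV_blockCoord]
    simp [psiV]

end Blocks

/-! ### The identity in the domain of absolute convergence. -/

section RootExchange

variable {F : Type*} [NontriviallyNormedField F] [IsUltrametricDist F] [ProperSpace F]
  [MeasurableSpace F] [BorelSpace F] (μ : Measure F) [μ.IsAddHaarMeasure] {k l r : ℕ}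

instance (a b : ℕ) : (coordMeasure μ k a b).IsOpenPosMeasure := by
  unfold coordMeasure; infer_instance

/-- Fubini yields integrability for almost every slice; for smooth functions the slices near a given
point coincide, up to a character, with the one at that point, and some nearby slice is good. -/
theorem exists_near_of_ae {X : Type*} [TopologicalSpace X] [MeasurableSpace X] (ν : Measure X)
    [ν.IsOpenPosMeasure] {p q : X → Prop} (hp : ∀ᵐ x ∂ν, p x) (x₀ : X) (hq : ∀ᶠ x in 𝓝 x₀, q x) :
    ∃ x, p x ∧ q x := by
  obtain ⟨x, hx⟩ := (Measure.dense_of_ae hp).inter_nhds_nonempty hq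
  exact ⟨x, hx.1, hx.2⟩

theorem eventually_forall_eq {n : ℕ} {f : GL (Fin n) F → ℂ} (hf : IsSmooth f)
    {X : Type*} [TopologicalSpace X] {y : X → GL (Fin n) F} (hy : Continuous y) {x₀ : X}
    (h0 : y x₀ = 1) (g : GL (Fin n) F) : ∀ᶠ x in 𝓝 x₀, ∀ z, f (z * (y x * g)) = f (z * g) := by
  obtain ⟨U, hU, hfU⟩ := isSmooth_iff.1 hf
  have h1 : ∀ᶠ x in 𝓝 x₀, g⁻¹ * y x * g ∈ U := by
    have : Continuous fun x => g⁻¹ * y x * g := by fun_prop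
    exact this.tendsto' x₀ 1 (by simp [h0]) hU
  filter_upwards [h1] with x hx z
  rw [← hfU (z * g) _ hx]
  congr 1
  group

/-- The common integrand of the iterated integrals. -/
noncomputable def doubleIntegrand (ψ : AddChar F Circle) (f : GL (Fin (k * (l + r))) F → ℂ)
    (g : GL (Fin (k * (l + r))) F) (x : (Coord k l l F × Coord k r r F) × Coord k l r F) : ℂ :=
  f (weyl k (l + r) * unip (blockCoord 0 x.2 0 0) * diagUnip x.1 * g) *
    ((((psiV ψ x.1.1)⁻¹ : Circle) : ℂ) * (((psiV ψ x.1.2)⁻¹ : Circle) : ℂ))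

variable {τ : Fin k → (Fˣ →* ℂˣ)} {ψ : AddChar F Circle}

theorem integrable_tripleIntegrand (hF : IsNormalizedAbs F) (hψ : Continuous ψ) {ζ : Fin k → ℂ}
    (hζ : ζ ∈ convergenceDomain (l + r) τ ψ μ) {f : GL (Fin (k * (l + r))) F → ℂ}
    (hf : f ∈ rhoSpace (l + r) τ ζ) (g : GL (Fin (k * (l + r))) F) :
    Integrable (fun x : Coord k r l F × ((Coord k l l F × Coord k r r F) × Coord k l r F) =>
      doubleIntegrand ψ f (vThree x.1 * g) x.2) ((coordMeasure μ k r l).prod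
        (((coordMeasure μ k l l).prod (coordMeasure μ k r r)).prod (coordMeasure μ k l r))) ∧
    ∫ x : Coord k r l F × ((Coord k l l F × Coord k r r F) × Coord k l r F),
      doubleIntegrand ψ f (vThree x.1 * g) x.2 ∂((coordMeasure μ k r l).prod
        (((coordMeasure μ k l l).prod (coordMeasure μ k r r)).prod (coordMeasure μ k l r))) =
      jacquetIntegral ψ μ fun x => f (x * g) := by
  obtain ⟨T, hT, h1, h2⟩ := measurePreserving_decomposition (k := k) (l := l) (r := r) μ hF
  have hg := rhoSpace_translate hf g
  have hc := continuous_jacquetIntegrand hψ hg.1.continuous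
  have h3 : (fun x : Coord k r l F × ((Coord k l l F × Coord k r r F) × Coord k l r F) =>
      doubleIntegrand ψ f (vThree x.1 * g) x.2) = jacquetIntegrand ψ (fun x => f (x * g)) ∘ T := by
    funext x
    simp only [Function.comp_apply, jacquetIntegrand, h1, h2, doubleIntegrand, mul_inv,
      Circle.coe_mul, mul_assoc]
  rw [h3]
  exact ⟨(hT.integrable_comp hc.aestronglyMeasurable).2 (hζ _ hg),
    hT.integral_comp_continuous hc⟩

theorem integrable_doubleIntegrand (hF : IsNormalizedAbs F) (hψ : Continuous ψ) {ζ : Fin k → ℂ}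
    (hζ : ζ ∈ convergenceDomain (l + r) τ ψ μ) {f : GL (Fin (k * (l + r))) F → ℂ}
    (hf : f ∈ rhoSpace (l + r) τ ζ) (g : GL (Fin (k * (l + r))) F) :
    Integrable (doubleIntegrand ψ f g)
      (((coordMeasure μ k l l).prod (coordMeasure μ k r r)).prod (coordMeasure μ k l r)) := by
  obtain ⟨v, hv1, hv2⟩ := exists_near_of_ae _
    (integrable_tripleIntegrand μ hF hψ hζ hf g).1.prod_right_ae 0
    (eventually_forall_eq hf.1 continuous_vThree vThree_zero g)
  refine hv1.congr (Eventually.of_forall fun x => ?_)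
  simp only [doubleIntegrand, hv2]

/-- A good slice `u` near `0` of the double integral is the integrand of m(ζ, κ) up to a nonzero
constant, since `f` does not notice `diagUnip u`. -/
theorem integrable_mIntegrand (hF : IsNormalizedAbs F) (hψ : Continuous ψ) {ζ : Fin k → ℂ}
    (hζ : ζ ∈ convergenceDomain (l + r) τ ψ μ) {f : GL (Fin (k * (l + r))) F → ℂ}
    (hf : f ∈ rhoSpace (l + r) τ ζ) (g : GL (Fin (k * (l + r))) F) :
    Integrable (fun z => f ((kappa k l r)⁻¹ * zElt z * g)) (coordMeasure μ k l r) := by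
  have h0 : ∀ z : Coord k l r F, (kappa k l r)⁻¹ * zElt z * g = weyl k (l + r) *
      unip (blockCoord 0 z 0 0) * ((weyl k (l + r))⁻¹ * (kappa k l r)⁻¹ * g) := fun z => by
    rw [kappa_inv_mul_zElt]; group
  simp only [h0]
  set g' := (weyl k (l + r))⁻¹ * (kappa k l r)⁻¹ * g
  obtain ⟨u, hu1, hu2⟩ := exists_near_of_ae _
    (integrable_doubleIntegrand μ hF hψ hζ hf g').prod_right_ae 0
    (eventually_forall_eq hf.1 continuous_diagUnip diagUnip_zero g')
  have hne : (((psiV ψ u.1)⁻¹ : Circle) : ℂ) * (((psiV ψ u.2)⁻¹ : Circle) : ℂ) ≠ 0 :=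
    mul_ne_zero (Circle.coe_ne_zero _) (Circle.coe_ne_zero _)
  refine (hu1.mul_const ((((psiV ψ u.1)⁻¹ : Circle) : ℂ) * (((psiV ψ u.2)⁻¹ : Circle) : ℂ))⁻¹).congr (Eventually.of_forall fun z => ?_)
  simp only [doubleIntegrand]
  rw [mul_inv_cancel_right₀ hne, mul_assoc _ (diagUnip u), hu2]

theorem mIntegral_diagGL_mul (f : GL (Fin (k * (l + r))) F → ℂ)
    (g : GL (Fin (k * (l + r))) F) (u : Coord k l l F × Coord k r r F) :
    mIntegral μ f (diagGL (weyl k l * unip u.1) (weyl k r * unip u.2) * g) *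
      (((psiV ψ u.1)⁻¹ : Circle) : ℂ) * (((psiV ψ u.2)⁻¹ : Circle) : ℂ) =
    ∫ z, doubleIntegrand ψ f ((kappa k l r)⁻¹ * g) (u, z) ∂(coordMeasure μ k l r) := by
  simp only [doubleIntegrand]
  rw [integral_mul_const, mIntegral, mul_assoc]
  simp only [kappa_inv_zElt_diagGL]

theorem integrable_mIntegral_diagGL (hF : IsNormalizedAbs F) (hψ : Continuous ψ) {ζ : Fin k → ℂ}
    (hζ : ζ ∈ convergenceDomain (l + r) τ ψ μ) {f : GL (Fin (k * (l + r))) F → ℂ}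
    (hf : f ∈ rhoSpace (l + r) τ ζ) (g : GL (Fin (k * (l + r))) F) :
    Integrable (fun u : Coord k l l F × Coord k r r F =>
      mIntegral μ f (diagGL (weyl k l * unip u.1) (weyl k r * unip u.2) * g) *
        (((psiV ψ u.1)⁻¹ : Circle) : ℂ) * (((psiV ψ u.2)⁻¹ : Circle) : ℂ))
      ((coordMeasure μ k l l).prod (coordMeasure μ k r r)) := by
  simp only [mIntegral_diagGL_mul]
  exact (integrable_doubleIntegrand μ hF hψ hζ hf _).integral_prod_left

/-- Applying the Jacquet integrals to both factors is a double integral. -/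
theorem applyFactors_jacquetIntegral {M : GL (Fin (k * (l + r))) F → ℂ}
    {g : GL (Fin (k * (l + r))) F}
    (hM : Integrable (fun u : Coord k l l F × Coord k r r F =>
      M (diagGL (weyl k l * unip u.1) (weyl k r * unip u.2) * g) *
        (((psiV ψ u.1)⁻¹ : Circle) : ℂ) * (((psiV ψ u.2)⁻¹ : Circle) : ℂ))
      ((coordMeasure μ k l l).prod (coordMeasure μ k r r))) :
    applyFactors (jacquetIntegral ψ μ) (jacquetIntegral ψ μ) M g =
      ∫ u : Coord k l l F × Coord k r r F,
        M (diagGL (weyl k l * unip u.1) (weyl k r * unip u.2) * g) *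
        (((psiV ψ u.1)⁻¹ : Circle) : ℂ) * (((psiV ψ u.2)⁻¹ : Circle) : ℂ)
      ∂((coordMeasure μ k l l).prod (coordMeasure μ k r r)) := by
  rw [integral_prod _ hM]
  simp only [applyFactors, jacquetIntegral, jacquetIntegrand, fibre, deltaTwo, absDet_weyl_mul_unip,
    one_pow, div_one, Real.one_rpow, Complex.ofReal_one, one_mul]
  refine integral_congr_ae (Eventually.of_forall fun u => ?_)
  simp only
  rw [← integral_mul_const]
  refine integral_congr_ae (Eventually.of_forall fun v => ?_)
  simp only
  ring

/-- Fubini for the triple integral at `g = 1`. The κ in the argument cancels the κ⁻¹ in the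
definition of m(ζ, κ). -/
theorem integrable_applyFactors_mIntegral (hF : IsNormalizedAbs F) (hψ : Continuous ψ)
    {ζ : Fin k → ℂ} (hζ : ζ ∈ convergenceDomain (l + r) τ ψ μ) {f : GL (Fin (k * (l + r))) F → ℂ}
    (hf : f ∈ rhoSpace (l + r) τ ζ) :
    Integrable (fun v => applyFactors (jacquetIntegral ψ μ) (jacquetIntegral ψ μ) (mIntegral μ f)
      (kappa k l r * vThree v)) (coordMeasure μ k r l) ∧
    jacquetIntegral ψ μ f = ∫ v, applyFactors (jacquetIntegral ψ μ) (jacquetIntegral ψ μ)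
      (mIntegral μ f) (kappa k l r * vThree v) ∂(coordMeasure μ k r l) := by
  obtain ⟨h1, h2⟩ := integrable_tripleIntegrand μ hF hψ hζ hf 1
  have h3 : (fun v => applyFactors (jacquetIntegral ψ μ) (jacquetIntegral ψ μ) (mIntegral μ f)
      (kappa k l r * vThree v)) = fun v : Coord k r l F => ∫ x, doubleIntegrand ψ f (vThree v * 1) x
        ∂(((coordMeasure μ k l l).prod (coordMeasure μ k r r)).prod (coordMeasure μ k l r)) := by
    funext v
    rw [applyFactors_jacquetIntegral μ (integrable_mIntegral_diagGL μ hF hψ hζ hf _),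
      integral_prod _ (integrable_doubleIntegrand μ hF hψ hζ hf _)]
    simp only [mIntegral_diagGL_mul, inv_mul_cancel_left, mul_one]
  rw [h3]
  refine ⟨h1.integral_prod_left, ?_⟩
  rw [← integral_prod _ h1, h2]
  simp only [mul_one]

end RootExchange

/-! ### Moving the parabolic P_{(kl, kr)} across κ⁻¹Zκ. -/

section Quad

variable {F : Type*} [NontriviallyNormedField F] {k c l r : ℕ}

/-- Rows `(i, α)` of the two kinds, in the order of `κ`. -/
def quadEquiv (k l r : ℕ) : (Fin k × Fin l) ⊕ (Fin k × Fin r) ≃ Fin (k * (l + r)) :=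
  (Equiv.sumCongr finProdFinEquiv finProdFinEquiv).trans
    ((splitEquiv k l r).trans (kappaPerm k l r))

theorem quadEquiv_inl (i : Fin k) (α : Fin l) :
    quadEquiv k l r (Sum.inl (i, α)) = finProdFinEquiv (i, finSumFinEquiv (Sum.inl α)) :=
  kappaPerm_inl i α

theorem quadEquiv_inr (i : Fin k) (α : Fin r) :
    quadEquiv k l r (Sum.inr (i, α)) = finProdFinEquiv (i, finSumFinEquiv (Sum.inr α)) :=
  kappaPerm_inr i α

/-- The matrix of `κ x κ⁻¹` in block form. -/
def quad (x : GL (Fin (k * (l + r))) F) :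
    Matrix ((Fin k × Fin l) ⊕ (Fin k × Fin r)) ((Fin k × Fin l) ⊕ (Fin k × Fin r)) F :=
  x.val.submatrix (quadEquiv k l r) (quadEquiv k l r)

theorem quad_mul (x y : GL (Fin (k * (l + r))) F) : quad (x * y) = quad x * quad y := by
  simp [quad, Matrix.submatrix_mul_equiv]

theorem quad_injective : Function.Injective (quad : GL (Fin (k * (l + r))) F → _) := by
  intro x y h
  refine Units.ext ?_
  have := congrArg (fun A => Matrix.submatrix A (quadEquiv k l r).symm (quadEquiv k l r).symm) h
  simpa [quad] using this

theorem quad_one : quad (1 : GL (Fin (k * (l + r))) F) = 1 := by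
  simp [quad]

theorem quad_apply_of_blocks {x : GL (Fin (k * (l + r))) F} (i j : Fin k) (α β : Fin l ⊕ Fin r) :
    blocks x (i, finSumFinEquiv α) (j, finSumFinEquiv β) =
      quad x (Sum.map (Prod.mk i) (Prod.mk i) α) (Sum.map (Prod.mk j) (Prod.mk j) β) := by
  rcases α with α | α <;> rcases β with β | β <;>
    simp [quad, quadEquiv_inl, quadEquiv_inr, blocks]

theorem quad_kappa_conj (x : GL (Fin (k * (l + r))) F) :
    quad ((kappa k l r)⁻¹ * x * kappa k l r) =
      x.val.submatrix ((Equiv.sumCongr finProdFinEquiv finProdFinEquiv).trans (splitEquiv k l r))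
        ((Equiv.sumCongr finProdFinEquiv finProdFinEquiv).trans (splitEquiv k l r)) := by
  have h : x.val = ((kappa k l r)⁻¹ * x * kappa k l r).val.submatrix (kappaPerm k l r)
      (kappaPerm k l r) := by
    have h1 : x = kappa k l r * ((kappa k l r)⁻¹ * x * kappa k l r) * (kappa k l r)⁻¹ := by group
    conv_lhs => rw [h1]
    rw [kappa, mul_permGL_inv_val, permGL_mul_val]
    rfl
  conv_rhs => rw [h]
  rfl

theorem quad_kappa_conj_diagGL (A : GL (Fin (k * l)) F) (D : GL (Fin (k * r)) F) :
    quad ((kappa k l r)⁻¹ * diagGL A D * kappa k l r) =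
      Matrix.fromBlocks (blocks A) 0 0 (blocks D) := by
  rw [quad_kappa_conj]
  ext s t
  rcases s with s | s <;> rcases t with t | t <;> simp [diagGL, assemble, blocks]

theorem quad_kappa_conj_radicalGL (B : Matrix (Fin (k * l)) (Fin (k * r)) F) :
    quad ((kappa k l r)⁻¹ * radicalGL B * kappa k l r) =
      Matrix.fromBlocks 1 (B.submatrix finProdFinEquiv finProdFinEquiv) 0 1 := by
  rw [quad_kappa_conj]
  ext s t
  rcases s with s | s <;> rcases t with t | t <;>
    simp [radicalGL, assemble, Matrix.one_apply]

/-- The strictly lower triangular block matrix with the coordinates `z`, in reversed order. -/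
def lowerOf (z : Coord k l r F) : Matrix (Fin k × Fin l) (Fin k × Fin r) F :=
  Matrix.of fun s t => strictUpper z (s.1.rev, s.2) (t.1.rev, t.2)

/-- The coordinates below the block diagonal, in reversed order. -/
def lowerEntries (M : Matrix (Fin k × Fin l) (Fin k × Fin r) F) : Coord k l r F :=
  fun p => M (p.1.1.1.rev, p.2.1) (p.1.1.2.rev, p.2.2)

theorem lowerOf_apply_pair (z : Coord k l r F) (p : Pair k × Fin l × Fin r) :
    lowerOf z (p.1.1.1.rev, p.2.1) (p.1.1.2.rev, p.2.2) = z p := by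
  rw [lowerOf, Matrix.of_apply, Fin.rev_rev, Fin.rev_rev, strictUpper_apply_pair]

theorem lowerOf_lowerEntries (M : Matrix (Fin k × Fin l) (Fin k × Fin r) F) {s : Fin k × Fin l}
    {t : Fin k × Fin r} (h : t.1 < s.1) : lowerOf (lowerEntries M) s t = M s t := by
  have : s.1.rev < t.1.rev := Fin.rev_lt_rev.2 h
  simp only [lowerOf, strictUpper, Matrix.of_apply, this, dif_pos, lowerEntries, Fin.rev_rev]

theorem lowerOf_eq_zero (z : Coord k l r F) {s : Fin k × Fin l} {t : Fin k × Fin r}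
    (h : ¬ t.1 < s.1) : lowerOf z s t = 0 := by
  rw [lowerOf, Matrix.of_apply, strictUpper_eq_zero]
  rwa [Fin.rev_lt_rev]

theorem lowerOf_neg (z : Coord k l r F) : lowerOf (-z) = -lowerOf z := by
  have : (-z : Coord k l r F) = (-1 : F) • z := (neg_one_smul F z).symm
  ext s t
  rw [lowerOf, Matrix.of_apply, this, strictUpper_smul, Matrix.smul_apply, smul_eq_mul, neg_one_mul]
  rfl

/-- The elements of `κ⁻¹ Z κ`. -/
noncomputable def lowerUnip (z : Coord k l r F) : GL (Fin (k * (l + r))) F :=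
  weyl k (l + r) * unip (blockCoord 0 z 0 0) * (weyl k (l + r))⁻¹

theorem quad_lowerUnip (z : Coord k l r F) :
    quad (lowerUnip z) = Matrix.fromBlocks 1 (lowerOf z) 0 1 := by
  ext s t
  have h : ∀ (i j : Fin k) (α β : Fin l ⊕ Fin r),
      quad (lowerUnip z) (Sum.map (Prod.mk i) (Prod.mk i) α) (Sum.map (Prod.mk j) (Prod.mk j) β) =
      (1 + strictUpper (blockCoord 0 z 0 0)) (i.rev, finSumFinEquiv α) (j.rev, finSumFinEquiv β) := by
    intro i j α β
    rw [← quad_apply_of_blocks, lowerUnip, blocks_weyl_conj, blocks_unip]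
  rcases s with ⟨i, α⟩ | ⟨i, α⟩ <;> rcases t with ⟨j, β⟩ | ⟨j, β⟩
  · refine (h i j (Sum.inl α) (Sum.inl β)).trans ?_
    simp [strictUpper, blockCoord_apply, Matrix.one_apply, -finSumFinEquiv_apply_left,
      -finSumFinEquiv_apply_right]
  · refine (h i j (Sum.inl α) (Sum.inr β)).trans ?_
    simp [strictUpper, blockCoord_apply, lowerOf, -finSumFinEquiv_apply_left,
      -finSumFinEquiv_apply_right]
  · refine (h i j (Sum.inr α) (Sum.inl β)).trans ?_
    simp [strictUpper, blockCoord_apply, -finSumFinEquiv_apply_left,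
      -finSumFinEquiv_apply_right]
  · refine (h i j (Sum.inr α) (Sum.inr β)).trans ?_
    simp [strictUpper, blockCoord_apply, Matrix.one_apply, -finSumFinEquiv_apply_left,
      -finSumFinEquiv_apply_right]

theorem lowerUnip_neg (z : Coord k l r F) : lowerUnip (-z) = (lowerUnip z)⁻¹ := by
  refine eq_inv_of_mul_eq_one_left (quad_injective ?_)
  rw [quad_mul, quad_lowerUnip, quad_lowerUnip, Matrix.fromBlocks_multiply, lowerOf_neg, quad_one,
    ← Matrix.fromBlocks_one]
  simp

/-- Moving an element of the parabolic subgroup across `κ⁻¹ Z κ`. -/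
theorem rhoSpace_lowerUnip {τ : Fin k → (Fˣ →* ℂˣ)} {ζ : Fin k → ℂ}
    {f : GL (Fin (k * (l + r))) F → ℂ} (hf : f ∈ rhoSpace (l + r) τ ζ)
    (A : GL (Fin (k * l)) F) (D : GL (Fin (k * r)) F) (B : Matrix (Fin (k * l)) (Fin (k * r)) F)
    (hA : ∀ s t : Fin k × Fin l, t.1 < s.1 → blocks A s t = 0)
    (hD : ∀ s t : Fin k × Fin r, t.1 < s.1 → blocks D s t = 0)
    (dA dD : Fin k → Fˣ) (hdA : ∀ i, (Matrix.of fun α β => blocks A (i, α) (i, β)).det = dA i)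
    (hdD : ∀ i, (Matrix.of fun α β => blocks D (i, α) (i, β)).det = dD i)
    (z : Coord k l r F) (g : GL (Fin (k * (l + r))) F) :
    f (lowerUnip z * ((kappa k l r)⁻¹ * (diagGL A D * radicalGL B * g))) =
      detChar (l + r) τ ζ (dA * dD) * f (lowerUnip (lowerEntries
        (B.submatrix finProdFinEquiv finProdFinEquiv + blocks A⁻¹ * lowerOf z * blocks D)) *
          ((kappa k l r)⁻¹ * g)) := by
  set M := B.submatrix finProdFinEquiv finProdFinEquiv + blocks A⁻¹ * lowerOf z * blocks D with hM
  -- The part of `M` strictly below the block diagonal is absorbed into the new element of κ⁻¹Zκ;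
  -- the rest stays in `b`, which is block upper triangular and acts through the inducing character.
  let b := lowerUnip z * ((kappa k l r)⁻¹ * diagGL A D * kappa k l r) *
    ((kappa k l r)⁻¹ * radicalGL B * kappa k l r) * (lowerUnip (lowerEntries M))⁻¹
  have hAA : blocks A * blocks A⁻¹ = 1 := by rw [← blocks_mul, mul_inv_cancel, blocks_one]
  have hb : quad b = Matrix.fromBlocks (blocks A) (blocks A * (M - lowerOf (lowerEntries M))) 0
      (blocks D) := by
    simp only [b]
    rw [← lowerUnip_neg, quad_mul, quad_mul, quad_mul, quad_kappa_conj_diagGL,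
      quad_kappa_conj_radicalGL, quad_lowerUnip, quad_lowerUnip, lowerOf_neg]
    simp only [Matrix.fromBlocks_multiply, Matrix.one_mul, Matrix.mul_one, Matrix.mul_zero,
      Matrix.zero_mul, add_zero, zero_add, Matrix.mul_neg, neg_zero]
    congr 1
    have h2 : blocks A * M = blocks A * B.submatrix finProdFinEquiv finProdFinEquiv +
        lowerOf z * blocks D := by
      rw [hM, Matrix.mul_add, ← Matrix.mul_assoc, ← Matrix.mul_assoc, hAA, Matrix.one_mul]
    rw [Matrix.mul_sub, h2]
    abel
  have hX : ∀ s t, t.1 < s.1 → (blocks A * (M - lowerOf (lowerEntries M))) s t = 0 := by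
    intro s t hst
    rw [Matrix.mul_apply]
    refine Finset.sum_eq_zero fun q _ => ?_
    by_cases hq : q.1 < s.1
    · rw [hA s q hq, zero_mul]
    · rw [Matrix.sub_apply, lowerOf_lowerEntries M (hst.trans_le (not_lt.1 hq)), sub_self, mul_zero]
  have he : lowerUnip z * ((kappa k l r)⁻¹ * (diagGL A D * radicalGL B * g)) =
      b * (lowerUnip (lowerEntries M) * ((kappa k l r)⁻¹ * g)) := by
    simp only [b]; group
  rw [he]
  refine rhoSpace_blockUpper hf b (fun s t hst => ?_) (dA * dD) (fun i => ?_) _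
  · obtain ⟨i, α⟩ := s
    obtain ⟨j, β⟩ := t
    obtain ⟨α, rfl⟩ := finSumFinEquiv.surjective α
    obtain ⟨β, rfl⟩ := finSumFinEquiv.surjective β
    rw [quad_apply_of_blocks, hb]
    rcases α with α | α <;> rcases β with β | β
    · exact hA _ _ hst
    · exact hX _ _ hst
    · rfl
    · exact hD _ _ hst
  · have h1 : (Matrix.of fun α β => blocks b (i, α) (i, β)).submatrix finSumFinEquiv finSumFinEquiv =
        Matrix.fromBlocks (Matrix.of fun α β => blocks A (i, α) (i, β))
          (Matrix.of fun α β => (blocks A * (M - lowerOf (lowerEntries M))) (i, α) (i, β)) 0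
          (Matrix.of fun α β => blocks D (i, α) (i, β)) := by
      ext α β
      rw [Matrix.submatrix_apply, Matrix.of_apply, quad_apply_of_blocks, hb]
      rcases α with α | α <;> rcases β with β | β <;> rfl
    rw [← Matrix.det_submatrix_equiv_self finSumFinEquiv, h1, Matrix.det_fromBlocks_zero₂₁, hdA, hdD]
    rfl

theorem blocks_unip_inv (u : Coord k c c F) :
    StrictlyUpper (blocks (unip u)⁻¹ - 1) := by
  have h1 : blocks (unip u) * blocks (unip u)⁻¹ = 1 := by
    rw [← blocks_mul, mul_inv_cancel, blocks_one]
  have hbt : (blocks (unip u)).BlockTriangular (Prod.fst : Fin k × Fin c → Fin k) := by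
    intro s t hst
    have hne : s ≠ t := by rintro rfl; exact lt_irrefl _ hst
    rw [blocks_unip, Matrix.add_apply, Matrix.one_apply_ne hne,
      strictUpper_eq_zero _ (not_lt.2 hst.le), add_zero]
  haveI : Invertible (blocks (unip u)) := ⟨blocks (unip u)⁻¹, by
    rw [← blocks_mul, inv_mul_cancel, blocks_one], h1⟩
  have h2 := Matrix.blockTriangular_inv_of_blockTriangular hbt
  rw [Matrix.inv_eq_right_inv h1] at h2
  have h3 : blocks (unip u)⁻¹ - 1 = -(strictUpper u * blocks (unip u)⁻¹) := by
    rw [blocks_unip, Matrix.add_mul, Matrix.one_mul] at h1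
    rw [← h1]; abel
  intro s t hst
  rw [h3, Matrix.neg_apply, neg_eq_zero, Matrix.mul_apply]
  refine Finset.sum_eq_zero fun q _ => ?_
  by_cases hq : s.1 < q.1
  · rw [h2 ((not_lt.1 hst).trans_lt hq), mul_zero]
  · rw [strictUpper_eq_zero _ hq, zero_mul]

theorem blocks_unip_sub_one (u : Coord k c c F) : StrictlyUpper (blocks (unip u) - 1) := by
  rw [blocks_unip, add_sub_cancel_left]
  exact strictlyUpper_strictUpper u

theorem det_levi (m : Fin k → GL (Fin c) F) : (levi m).val.det = ∏ i, (m i).val.det := by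
  change ((Matrix.blockDiagonal fun i => (m i).val).submatrix _ _).det = _
  rw [Matrix.det_submatrix_equiv_self, Matrix.det_blockDiagonal]

theorem det_unip (v : Coord k c c F) : (unip v).val.det = 1 := by
  change ((1 + strictUpper v).submatrix finProdFinEquiv.symm finProdFinEquiv.symm).det = 1
  rw [Matrix.det_submatrix_equiv_self, det_one_add_strictUpper]

theorem levi_inv (m : Fin k → GL (Fin c) F) : (levi m)⁻¹ = levi fun i => (m i)⁻¹ :=
  Units.ext rfl

variable [IsUltrametricDist F] [ProperSpace F] [MeasurableSpace F] [BorelSpace F] (μ : Measure F)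
  [μ.IsAddHaarMeasure]

theorem continuous_lowerOf : Continuous (lowerOf : Coord k l r F → _) := by
  refine continuous_matrix fun s t => ?_
  exact continuous_strictUpper.matrix_elem _ _

/-- Multiplication by upper unipotent `A` and `D` adds to an entry only entries further from the
diagonal. The rank `k - gap` is thus the right one for triangularity; `B` is a translation. -/
theorem measurePreserving_lowerEntries (hF : IsNormalizedAbs F) {A : Matrix (Fin k × Fin l) (Fin k × Fin l) F}
    {D : Matrix (Fin k × Fin r) (Fin k × Fin r) F} (hA : StrictlyUpper (A - 1))
    (hD : StrictlyUpper (D - 1)) (B : Matrix (Fin k × Fin l) (Fin k × Fin r) F) :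
    MeasurePreserving (fun z => lowerEntries (B + A * lowerOf z * D)) (coordMeasure μ k l r)
      (coordMeasure μ k l r) := by
  refine measurePreserving_triangular μ hF (fun p => k - gap p) (fun _ => 1) (fun _ => norm_one) _
    (Continuous.measurable (continuous_pi fun p => ?_)) fun p x y h => ?_
  · exact (continuous_const.add ((continuous_const.matrix_mul continuous_lowerOf).matrix_mul
      continuous_const)).matrix_elem _ _
  obtain ⟨⟨⟨i, j⟩, hij⟩, α, β⟩ := p
  have hd : ∀ s t, j.rev.val + s.1.val > i.rev.val + t.1.val → lowerOf x s t = lowerOf y s t := by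
    intro s t hst
    by_cases h1 : t.1 < s.1
    · have h2 : s.1.rev < t.1.rev := Fin.rev_lt_rev.2 h1
      simp only [lowerOf, strictUpper, Matrix.of_apply, h2, dif_pos]
      refine h _ ?_
      simp only [gap, Fin.val_rev] at *
      rw [Fin.lt_def] at hij h1
      have := s.1.2
      have := t.1.2
      have := j.2
      omega
    · rw [lowerOf_eq_zero _ h1, lowerOf_eq_zero _ h1]
  have hA' : ∀ s t, A s t = 0 ∨ s.1 < t.1 ∨ s = t ∧ A s t = 1 := by
    intro s t
    by_cases h1 : s.1 < t.1
    · exact Or.inr (Or.inl h1)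
    · have := hA s t h1
      rw [Matrix.sub_apply, sub_eq_zero] at this
      by_cases h2 : s = t
      · subst h2; exact Or.inr (Or.inr ⟨rfl, by rw [this, Matrix.one_apply_eq]⟩)
      · exact Or.inl (by rw [this, Matrix.one_apply_ne h2])
  have hD' : ∀ s t, D s t = 0 ∨ s.1 < t.1 ∨ s = t ∧ D s t = 1 := by
    intro s t
    by_cases h1 : s.1 < t.1
    · exact Or.inr (Or.inl h1)
    · have := hD s t h1
      rw [Matrix.sub_apply, sub_eq_zero] at this
      by_cases h2 : s = t
      · subst h2; exact Or.inr (Or.inr ⟨rfl, by rw [this, Matrix.one_apply_eq]⟩)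
      · exact Or.inl (by rw [this, Matrix.one_apply_ne h2])
  have hz : ∀ z : Coord k l r F, z (⟨(i, j), hij⟩, α, β) = lowerOf z (i.rev, α) (j.rev, β) :=
    fun z => (lowerOf_apply_pair z _).symm
  rw [hz x, hz y]
  simp only [lowerEntries, Matrix.add_apply]
  rw [one_mul, one_mul]
  suffices hs : (A * (lowerOf x - lowerOf y) * D) (i.rev, α) (j.rev, β) =
      (lowerOf x - lowerOf y) (i.rev, α) (j.rev, β) by
    rw [Matrix.mul_sub, Matrix.sub_mul, Matrix.sub_apply, Matrix.sub_apply] at hs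
    linear_combination hs
  have hA1 : A (i.rev, α) (i.rev, α) = 1 := by
    have := hA (i.rev, α) (i.rev, α) (lt_irrefl _)
    rwa [Matrix.sub_apply, sub_eq_zero, Matrix.one_apply_eq] at this
  have hD1 : D (j.rev, β) (j.rev, β) = 1 := by
    have := hD (j.rev, β) (j.rev, β) (lt_irrefl _)
    rwa [Matrix.sub_apply, sub_eq_zero, Matrix.one_apply_eq] at this
  rw [Matrix.mul_apply, Finset.sum_eq_single (j.rev, β)]
  · rw [hD1, mul_one, Matrix.mul_apply, Finset.sum_eq_single (i.rev, α)]
    · rw [hA1, one_mul]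
    · intro s _ hs
      rcases hA' (i.rev, α) s with h1 | h1 | h1
      · rw [h1, zero_mul]
      · rw [Matrix.sub_apply, hd, sub_self, mul_zero]
        rw [Fin.lt_def] at h1
        simp only at h1 ⊢
        omega
      · exact absurd h1.1.symm hs
    · simp
  · intro t _ ht
    rcases hD' t (j.rev, β) with h1 | h1 | h1
    · rw [h1, mul_zero]
    · rw [Matrix.mul_apply, Finset.sum_eq_zero, zero_mul]
      intro s _
      rw [Fin.lt_def] at h1
      simp only at h1
      rcases hA' (i.rev, α) s with h2 | h2 | h2
      · rw [h2, zero_mul]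
      · rw [Matrix.sub_apply, hd, sub_self, mul_zero]
        rw [Fin.lt_def] at h2
        simp only at h2 ⊢
        omega
      · rw [← h2.1, Matrix.sub_apply, hd, sub_self, mul_zero]
        simp only
        omega
    · exact absurd h1.1 ht
  · simp

end Quad

/-! ### Bookkeeping of modulus characters. -/

section PairProducts

variable {k : ℕ}

theorem prod_pair_eq {M : Type*} [CommMonoid M] (g : Fin k × Fin k → M) :
    ∏ p : Pair k, g p.1 = ∏ i, ∏ j, if i < j then g (i, j) else 1 := by
  rw [← Finset.prod_subtype (Finset.univ.filter fun q : Fin k × Fin k => q.1 < q.2)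
    (p := fun q : Fin k × Fin k => q.1 < q.2) (by simp) g, Finset.prod_filter,
    ← Finset.univ_product_univ, Finset.prod_product]

/-- Each index belongs to `k - 1` pairs. -/
theorem prod_pair_mul {M : Type*} [CommMonoid M] (x : Fin k → M) :
    ∏ p : Pair k, (x p.1.1 * x p.1.2) = (∏ i, x i) ^ (k - 1) := by
  have h1 : ∏ p : Pair k, x p.1.2 = ∏ i, ∏ j, if j < i then x i else 1 := by
    rw [prod_pair_eq fun q => x q.2, Finset.prod_comm]
  rw [Finset.prod_mul_distrib, h1, prod_pair_eq fun q => x q.1, ← Finset.prod_mul_distrib,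
    ← Finset.prod_pow]
  refine Finset.prod_congr rfl fun i _ => ?_
  rw [← Finset.prod_mul_distrib]
  have h2 : ∀ j, ((if i < j then x i else 1) * if j < i then x i else 1) =
      if j ∈ Finset.univ.erase i then x i else 1 := by
    intro j
    rcases lt_trichotomy i j with h | h | h
    · simp [h, h.ne', h.asymm]
    · simp [h]
    · simp [h, h.ne, h.asymm]
  simp only [h2, Finset.prod_ite_mem, Finset.univ_inter, Finset.prod_const]
  rw [Finset.card_erase_of_mem (Finset.mem_univ _), Finset.card_univ, Fintype.card_fin]

/-- Reversal of the order of the block indices. -/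
def revPair (k : ℕ) : Equiv.Perm (Pair k) :=
  Function.Involutive.toPerm (fun p => ⟨(p.1.2.rev, p.1.1.rev), Fin.rev_lt_rev.2 p.2⟩) fun p => by
    simp

theorem revPair_apply (p : Pair k) : (revPair k p).1 = (p.1.2.rev, p.1.1.rev) := rfl

/-- This is where the twist by δ^{-1/(2k)} originates: `k * r * (1/2 - 1/(2k)) = (k - 1) * r / 2`,
so by `prod_pair_mul` the twisted modulus becomes a product over pairs, and the identity can be
checked pair by pair. -/
theorem modulus_identity (hk : 1 ≤ k) (l r : ℕ) {a d : Fin k → ℝ} (ha : ∀ i, 0 < a i)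
    (hd : ∀ i, 0 < d i) :
    (∏ p : Pair k, (a p.1.1 * d p.1.1 / (a p.1.2 * d p.1.2)) ^ (l + r)) ^ (1 / 2 : ℝ) *
        ∏ p : Pair k, (a p.1.2 ^ r / d p.1.1 ^ l) =
      ((∏ i, a i) ^ (k * r) / (∏ i, d i) ^ (k * l)) ^ (1 / 2 - 1 / (2 * (k : ℝ))) *
        (∏ p : Pair k, (a p.1.1 / a p.1.2) ^ l) ^ (1 / 2 : ℝ) *
        (∏ p : Pair k, (d p.1.1 / d p.1.2) ^ r) ^ (1 / 2 : ℝ) := by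
  have hA : 0 < ∏ i, a i := Finset.prod_pos fun i _ => ha i
  have hD : 0 < ∏ i, d i := Finset.prod_pos fun i _ => hd i
  have hk0 : (k : ℝ) ≠ 0 := by positivity
  have h1 : ((∏ i, a i) ^ (k * r) / (∏ i, d i) ^ (k * l)) ^ (1 / 2 - 1 / (2 * (k : ℝ))) =
      √(∏ p : Pair k, ((a p.1.1 * a p.1.2) ^ r / (d p.1.1 * d p.1.2) ^ l)) := by
    rw [Finset.prod_div_distrib, Finset.prod_pow, Finset.prod_pow, prod_pair_mul, prod_pair_mul,
      ← pow_mul, ← pow_mul, mul_comm k r, mul_comm k l, mul_comm (k - 1) r, mul_comm (k - 1) l,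
      pow_mul, pow_mul _ l, ← div_pow, pow_mul _ r, pow_mul _ l, ← div_pow, Real.sqrt_eq_rpow]
    have hQ : 0 < (∏ i, a i) ^ r / (∏ i, d i) ^ l := by positivity
    generalize (∏ i, a i) ^ r / (∏ i, d i) ^ l = Q at hQ
    rw [← Real.rpow_natCast, ← Real.rpow_natCast, ← Real.rpow_mul hQ.le, ← Real.rpow_mul hQ.le]
    congr 1
    rw [Nat.cast_sub hk]
    field_simp
    push_cast
    ring
  have h2 : ∏ p : Pair k, (a p.1.2 ^ r / d p.1.1 ^ l) =
      √(∏ p : Pair k, (a p.1.2 ^ r / d p.1.1 ^ l) ^ 2) := by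
    rw [Finset.prod_pow, Real.sqrt_sq]
    exact Finset.prod_nonneg fun p _ => by have := ha p.1.2; have := hd p.1.1; positivity
  have hnn : ∀ (g : Pair k → ℝ), (∀ p, 0 < g p) → 0 ≤ ∏ p, g p := fun g hg =>
    Finset.prod_nonneg fun p _ => (hg p).le
  rw [h1, h2, ← Real.sqrt_eq_rpow, ← Real.sqrt_eq_rpow, ← Real.sqrt_eq_rpow, ← Real.sqrt_mul,
    ← Real.sqrt_mul, ← Real.sqrt_mul, ← Finset.prod_mul_distrib, ← Finset.prod_mul_distrib,
    ← Finset.prod_mul_distrib]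
  · congr 1
    refine Finset.prod_congr rfl fun p _ => ?_
    have h3 := (ha p.1.1).ne'
    have h4 := (ha p.1.2).ne'
    have h5 := (hd p.1.1).ne'
    have h6 := (hd p.1.2).ne'
    simp only [div_pow, mul_pow, pow_add]
    field_simp
  · refine mul_nonneg (hnn _ fun p => ?_) (hnn _ fun p => ?_)
    · have := ha p.1.1; have := ha p.1.2; have := hd p.1.1; have := hd p.1.2; positivity
    · have := ha p.1.1; have := ha p.1.2; positivity
  · refine hnn _ fun p => ?_
    have := ha p.1.1; have := ha p.1.2; have := hd p.1.1; have := hd p.1.2; positivity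
  · refine hnn _ fun p => ?_
    have := ha p.1.1; have := ha p.1.2; have := hd p.1.1; have := hd p.1.2; positivity

end PairProducts

/-! ### m(ζ, κ)f belongs to I(ζ). -/

section TwoStep

variable {F : Type*} [NontriviallyNormedField F] {k l r : ℕ}

/-- The map `z ↦ (a_p z_p b_p)_p`. -/
def sandwich (a : Pair k → Matrix (Fin l) (Fin l) F) (b : Pair k → Matrix (Fin r) (Fin r) F) :
    Matrix (Pair k × Fin l × Fin r) (Pair k × Fin l × Fin r) F :=
  Matrix.of fun p q => if p.1 = q.1 then a p.1 p.2.1 q.2.1 * b p.1 q.2.2 p.2.2 else 0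

theorem det_sandwich (a : Pair k → Matrix (Fin l) (Fin l) F)
    (b : Pair k → Matrix (Fin r) (Fin r) F) :
    (sandwich a b).det = ∏ p, ((a p).det ^ r * (b p).det ^ l) := by
  let e : Pair k × Fin l × Fin r ≃ (Fin l × Fin r) × Pair k := Equiv.prodComm _ _
  have h : sandwich a b = (Matrix.blockDiagonal fun p =>
      Matrix.kroneckerMap (· * ·) (a p) (b p).transpose).submatrix e e := by
    ext p q
    simp [sandwich, e, Matrix.blockDiagonal_apply, Matrix.kroneckerMap_apply]
  rw [h, Matrix.det_submatrix_equiv_self, Matrix.det_blockDiagonal]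
  refine Finset.prod_congr rfl fun p _ => ?_
  have := Matrix.det_kronecker (a p) (b p).transpose
  rw [Matrix.det_transpose, Fintype.card_fin, Fintype.card_fin] at this
  exact this

theorem lowerEntries_levi (m₁ : Fin k → GL (Fin l) F) (m₂ : Fin k → GL (Fin r) F)
    (z : Coord k l r F) :
    lowerEntries (blocks (levi m₁)⁻¹ * lowerOf z * blocks (levi m₂)) =
      Matrix.toLin' (sandwich (fun p => (m₁ p.1.1.rev)⁻¹.val) fun p => (m₂ p.1.2.rev).val) z := by
  funext p
  obtain ⟨⟨⟨i, j⟩, hij⟩, α, β⟩ := p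
  rw [Matrix.toLin'_apply, Matrix.mulVec, dotProduct, Fintype.sum_prod_type,
    Finset.sum_eq_single ⟨(i, j), hij⟩ (fun q _ hq => by simp [sandwich, Ne.symm hq]) (by simp),
    lowerEntries, levi_inv, Matrix.mul_apply, Fintype.sum_prod_type, Finset.sum_eq_single j.rev
    (fun q _ hq => by simp [blocks_levi, hq]) (by simp), Fintype.sum_prod_type_right]
  refine Finset.sum_congr rfl fun β' _ => ?_
  rw [Matrix.mul_apply, Fintype.sum_prod_type, Finset.sum_eq_single i.rev
    (fun q _ hq => by simp [blocks_levi, Ne.symm hq]) (by simp), Finset.sum_mul]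
  refine Finset.sum_congr rfl fun α' _ => ?_
  have := lowerOf_apply_pair z (⟨(i, j), hij⟩, α', β')
  simp only at this
  simp only [blocks_levi, if_true, this, sandwich, Matrix.of_apply]
  ring

theorem detChar_eq_mul (c : ℕ) (τ : Fin k → (Fˣ →* ℂˣ)) (ζ : Fin k → ℂ) (d : Fin k → Fˣ) :
    detChar c τ ζ d = (((∏ p : Pair k, (‖(d p.1.1 : F)‖ / ‖(d p.1.2 : F)‖) ^ c) ^ (1 / 2 : ℝ) : ℝ) : ℂ) *
      detChar 0 τ ζ d := by
  simp [detChar]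

theorem of_blocks_levi {c : ℕ} (m : Fin k → GL (Fin c) F) (i : Fin k) :
    (Matrix.of fun α β => blocks (levi m) (i, α) (i, β)) = (m i).val := by
  ext α β
  simp [blocks_levi]

theorem of_blocks_unip {c : ℕ} (u : Coord k c c F) (i : Fin k) :
    (Matrix.of fun α β => blocks (unip u) (i, α) (i, β)) = 1 := by
  ext α β
  simp [blocks_unip, strictUpper, Matrix.one_apply]

theorem absDet_levi_mul_unip {c : ℕ} (m : Fin k → GL (Fin c) F) (u : Coord k c c F) :
    absDet (levi m * unip u) = ∏ i, ‖(m i).val.det‖ := by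
  rw [absDet, Units.val_mul, Matrix.det_mul, det_unip, mul_one, det_levi, norm_prod]

variable [IsUltrametricDist F] [ProperSpace F] [MeasurableSpace F] [BorelSpace F] (μ : Measure F)
  [μ.IsAddHaarMeasure]

theorem mIntegral_eq (f : GL (Fin (k * (l + r))) F → ℂ) (g : GL (Fin (k * (l + r))) F) :
    mIntegral μ f g = ∫ z, f (lowerUnip z * ((kappa k l r)⁻¹ * g)) ∂(coordMeasure μ k l r) := by
  simp only [mIntegral, kappa_inv_mul_zElt, lowerUnip, mul_assoc]

theorem continuous_lowerUnip : Continuous (lowerUnip : Coord k l r F → _) :=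
  (continuous_const.mul (continuous_unip.comp (continuous_blockCoord continuous_const continuous_id
    continuous_const continuous_const))).mul continuous_const

variable {τ : Fin k → (Fˣ →* ℂˣ)} {ζ : Fin k → ℂ} {f : GL (Fin (k * (l + r))) F → ℂ}

/-- Unipotent elements contribute a measure preserving substitution and a trivial character. -/
theorem mIntegral_unip (hF : IsNormalizedAbs F) (hf : f ∈ rhoSpace (l + r) τ ζ)
    (u₁ : Coord k l l F) (u₂ : Coord k r r F) (B : Matrix (Fin (k * l)) (Fin (k * r)) F)
    (g : GL (Fin (k * (l + r))) F) :
    mIntegral μ f (diagGL (unip u₁) (unip u₂) * radicalGL B * g) = mIntegral μ f g := by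
  have hu : ∀ {c : ℕ} (u : Coord k c c F) (s t : Fin k × Fin c), t.1 < s.1 →
      blocks (unip u) s t = 0 := by
    intro c u s t hst
    have h1 := blocks_unip_sub_one u s t (not_lt.2 hst.le)
    rwa [Matrix.sub_apply, Matrix.one_apply_ne (by rintro rfl; exact lt_irrefl _ hst),
      sub_zero] at h1
  rw [mIntegral_eq, mIntegral_eq]
  simp only [rhoSpace_lowerUnip hf (unip u₁) (unip u₂) B (hu u₁) (hu u₂) 1 1
    (fun i => by rw [of_blocks_unip, Matrix.det_one]; rfl)
    (fun i => by rw [of_blocks_unip, Matrix.det_one]; rfl)]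
  have h1 : detChar (l + r) τ ζ (1 : Fin k → Fˣ) = 1 := by simp [detChar]
  simp only [mul_one, h1, one_mul]
  have hc : Continuous fun z : Coord k l r F => f (lowerUnip z * ((kappa k l r)⁻¹ * g)) :=
    hf.1.continuous.comp (continuous_lowerUnip.mul continuous_const)
  exact (measurePreserving_lowerEntries μ hF (blocks_unip_inv u₁) (blocks_unip_sub_one u₂)
    _).integral_comp_continuous hc

/-- The Levi element acts by the inducing character of ρ_c and by the Jacobian of `z_p ↦ a_p z_p
b_p`. The unramified parts match at once (`detChar 0` isolates them) and the moduli match by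
`modulus_identity`. -/
theorem mIntegral_levi (hF : IsNormalizedAbs F) (hk : 1 ≤ k) (hf : f ∈ rhoSpace (l + r) τ ζ)
    (m₁ : Fin k → GL (Fin l) F) (m₂ : Fin k → GL (Fin r) F) (g : GL (Fin (k * (l + r))) F) :
    mIntegral μ f (diagGL (levi m₁) (levi m₂) * g) =
      ((((∏ i, ‖(m₁ i).val.det‖) ^ (k * r) / (∏ i, ‖(m₂ i).val.det‖) ^ (k * l)) ^
        (1 / 2 - 1 / (2 * (k : ℝ))) : ℝ) : ℂ) * inducingChar τ ζ m₁ * inducingChar τ ζ m₂ *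
        mIntegral μ f g := by
  have hlev : ∀ {c : ℕ} (m : Fin k → GL (Fin c) F) (s t : Fin k × Fin c), t.1 < s.1 →
      blocks (levi m) s t = 0 := fun m s t hst => by rw [blocks_levi, if_neg hst.ne']
  have hrad : diagGL (levi m₁) (levi m₂) * g = diagGL (levi m₁) (levi m₂) * radicalGL 0 * g := by
    have : (radicalGL 0 : GL (Fin (k * (l + r))) F) = 1 := Units.ext assemble_one
    rw [this, mul_one]
  have hdet : ∀ {c : ℕ} (m : GL (Fin c) F), m.val.det ≠ 0 := fun m =>
    ((Matrix.isUnit_iff_isUnit_det _).1 m.isUnit).ne_zero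
  rw [hrad, mIntegral_eq, mIntegral_eq]
  simp only [rhoSpace_lowerUnip hf (levi m₁) (levi m₂) 0 (hlev m₁) (hlev m₂)
    (fun i => Matrix.GeneralLinearGroup.det (m₁ i)) (fun i => Matrix.GeneralLinearGroup.det (m₂ i))
    (fun i => by rw [of_blocks_levi]; rfl) (fun i => by rw [of_blocks_levi]; rfl),
    Matrix.submatrix_zero, Pi.zero_apply, zero_add, lowerEntries_levi]
  rw [integral_const_mul]
  have hc : Continuous fun z : Coord k l r F => f (lowerUnip z * ((kappa k l r)⁻¹ * g)) :=
    hf.1.continuous.comp (continuous_lowerUnip.mul continuous_const)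
  have hdet1 : LinearMap.det (Matrix.toLin' (sandwich (fun p : Pair k => (m₁ p.1.1.rev)⁻¹.val)
      fun p => (m₂ p.1.2.rev).val)) = ∏ p : Pair k, ((m₁ p.1.1.rev).val.det⁻¹ ^ r *
        (m₂ p.1.2.rev).val.det ^ l) := by
    rw [LinearMap.det_toLin', det_sandwich]
    refine Finset.prod_congr rfl fun p _ => ?_
    rw [Matrix.coe_units_inv, Matrix.det_nonsing_inv, Ring.inverse_eq_inv']
  -- Conjugation by w reversed the block indices; `revPair` restores them, exchanging the two
  -- members of each pair.
  have hdet2 : ‖∏ p : Pair k, ((m₁ p.1.1.rev).val.det⁻¹ ^ r * (m₂ p.1.2.rev).val.det ^ l)‖⁻¹ =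
      ∏ p : Pair k, (‖(m₁ p.1.2).val.det‖ ^ r / ‖(m₂ p.1.1).val.det‖ ^ l) := by
    rw [norm_prod, ← Finset.prod_inv_distrib, ← Equiv.prod_comp (revPair k)]
    refine Finset.prod_congr rfl fun p _ => ?_
    simp only [revPair_apply, Fin.rev_rev, norm_mul, norm_pow, norm_inv,
      mul_inv, inv_pow, inv_inv, div_eq_mul_inv]
  have hint := integral_comp_linearMap μ hF (f := Matrix.toLin' (sandwich
    (fun p : Pair k => (m₁ p.1.1.rev)⁻¹.val) fun p => (m₂ p.1.2.rev).val))
    (by rw [hdet1]; exact Finset.prod_ne_zero_iff.2 fun p _ =>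
      mul_ne_zero (pow_ne_zero _ (inv_ne_zero (hdet _))) (pow_ne_zero _ (hdet _))) hc
  rw [hdet1, hdet2] at hint
  have hint' := hint
  change ∫ z, _ ∂(coordMeasure μ k l r) = _ * ∫ z, _ ∂(coordMeasure μ k l r) at hint'
  rw [hint', ← mul_assoc]
  congr 1
  rw [inducingChar_eq, inducingChar_eq, detChar_eq_mul l, detChar_eq_mul r, detChar_eq_mul (l + r),
    detChar_mul]
  have hid := modulus_identity hk l r (a := fun i => ‖(m₁ i).val.det‖)
    (d := fun i => ‖(m₂ i).val.det‖) (fun i => norm_pos_iff.2 (hdet _))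
    (fun i => norm_pos_iff.2 (hdet _))
  have hid' := congrArg (fun x : ℝ => (x : ℂ)) hid
  simp only [Complex.ofReal_mul] at hid'
  simp only [Pi.mul_apply, Units.val_mul, norm_mul]
  simp only [Matrix.GeneralLinearGroup.val_det_apply]
  linear_combination (detChar 0 τ ζ (fun i => Matrix.GeneralLinearGroup.det (m₁ i)) *
    detChar 0 τ ζ (fun i => Matrix.GeneralLinearGroup.det (m₂ i))) * hid'

theorem mIntegral_mem_twoStepSpace (hF : IsNormalizedAbs F) (hk : 1 ≤ k)
    (hf : f ∈ rhoSpace (l + r) τ ζ) : mIntegral μ f ∈ twoStepSpace l r τ ζ := by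
  refine ⟨?_, fun m₁ u₁ m₂ u₂ B g => ?_⟩
  · obtain ⟨U, hU, hfU⟩ := isSmooth_iff.1 hf.1
    refine isSmooth_iff.2 ⟨U, hU, fun g h hh => ?_⟩
    simp only [mIntegral, ← mul_assoc, hfU _ _ hh]
  · rw [diagGL_mul, mul_assoc, mul_assoc, mIntegral_levi μ hF hk hf, ← mul_assoc (diagGL _ _),
      mIntegral_unip μ hF hf, deltaTwo, absDet_levi_mul_unip, absDet_levi_mul_unip]

end TwoStep

/-! ### Bounded support on κ V. -/

section VThree

variable {F : Type*} [NontriviallyNormedField F] {k c l r : ℕ}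

theorem quad_vThree (v : Coord k r l F) :
    quad (vThree v : GL (Fin (k * (l + r))) F) = Matrix.fromBlocks 1 0 (strictUpper v) 1 := by
  ext s t
  have h : ∀ (i j : Fin k) (α β : Fin l ⊕ Fin r),
      quad (vThree v : GL (Fin (k * (l + r))) F) (Sum.map (Prod.mk i) (Prod.mk i) α)
        (Sum.map (Prod.mk j) (Prod.mk j) β) =
      (1 + strictUpper (blockCoord 0 0 v 0)) (i, finSumFinEquiv α) (j, finSumFinEquiv β) := by
    intro i j α β
    rw [← quad_apply_of_blocks, vThree, blocks_unip]
  rcases s with ⟨i, α⟩ | ⟨i, α⟩ <;> rcases t with ⟨j, β⟩ | ⟨j, β⟩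
  · refine (h i j (Sum.inl α) (Sum.inl β)).trans ?_
    simp [strictUpper, blockCoord_apply, Matrix.one_apply, -finSumFinEquiv_apply_left,
      -finSumFinEquiv_apply_right]
  · refine (h i j (Sum.inl α) (Sum.inr β)).trans ?_
    simp [strictUpper, blockCoord_apply, -finSumFinEquiv_apply_left,
      -finSumFinEquiv_apply_right]
  · refine (h i j (Sum.inr α) (Sum.inl β)).trans ?_
    simp [strictUpper, blockCoord_apply, -finSumFinEquiv_apply_left,
      -finSumFinEquiv_apply_right]
  · refine (h i j (Sum.inr α) (Sum.inr β)).trans ?_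
    simp [strictUpper, blockCoord_apply, Matrix.one_apply, -finSumFinEquiv_apply_left,
      -finSumFinEquiv_apply_right]

theorem quad_vThree_inv (v : Coord k r l F) :
    quad ((vThree v : GL (Fin (k * (l + r))) F)⁻¹) =
      Matrix.fromBlocks 1 0 (-strictUpper v) 1 := by
  have h : (vThree v : GL (Fin (k * (l + r))) F)⁻¹ = vThree (-v) := by
    refine inv_eq_of_mul_eq_one_left (quad_injective ?_)
    have h1 : strictUpper (-v) = -strictUpper v := by
      rw [← neg_one_smul F v, strictUpper_smul, neg_one_smul]
    rw [quad_mul, quad_vThree, quad_vThree, Matrix.fromBlocks_multiply, h1, quad_one,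
      ← Matrix.fromBlocks_one]
    simp
  have h1 : strictUpper (-v) = -strictUpper v := by
    rw [← neg_one_smul F v, strictUpper_smul, neg_one_smul]
  rw [h, quad_vThree, h1]

theorem mul_single_eq {m n p : Type*} [Fintype n] [DecidableEq n] [DecidableEq p]
    (A : Matrix m n F) (i : n) (j : p) (y : F) (a : m) (b : p) :
    (A * Matrix.single i j y) a b = if b = j then A a i * y else 0 := by
  split_ifs with h
  · subst h; simp
  · exact Matrix.mul_single_apply_of_ne _ _ _ _ _ h _

theorem single_mul_eq {m n p : Type*} [Fintype n] [DecidableEq m] [DecidableEq n]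
    (A : Matrix n p F) (i : m) (j : n) (y : F) (a : m) (b : p) :
    (Matrix.single i j y * A) a b = if a = i then y * A j b else 0 := by
  split_ifs with h
  · subst h; simp
  · exact Matrix.single_mul_apply_of_ne _ _ _ _ _ h _

/-- A function on the group which transforms under the unipotent elements `diag(1, u)` and the
radical according to `ψ`, and which is right invariant under a given neighbourhood of `1`, has
bounded support on `κ V`. -/
theorem exists_bound_support [IsUltrametricDist F] {ψ : AddChar F Circle} (hψ1 : ψ ≠ 1)
    {U : Set (GL (Fin (k * (l + r))) F)} (hU : U ∈ 𝓝 1) :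
    ∃ C : ℝ, ∀ Ψ : GL (Fin (k * (l + r))) F → ℂ, RInv U Ψ →
      (∀ (u : Coord k r r F) (B : Matrix (Fin (k * l)) (Fin (k * r)) F) (g : GL (Fin (k * (l + r))) F),
        Ψ (diagGL 1 (unip u) * radicalGL B * g) = (psiV ψ u : ℂ) * Ψ g) →
      ∀ v : Coord k r l F, Ψ (kappa k l r * vThree v) ≠ 0 → ‖v‖ ≤ C := by
  obtain ⟨a, ha⟩ : ∃ a, ψ a ≠ 1 := by
    by_contra! h
    exact hψ1 (DFunLike.ext _ _ fun x => by rw [h x, AddChar.one_apply])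
  obtain ⟨δ, hδ, hδU⟩ := exists_entries_nhds_one hU
  -- Block rows are bounded from the last upwards, `j` rows at a time. The clause `1 ≤ C` gives `C ≤
  -- C ^ 2`, used in the estimates.
  suffices H : ∀ j : ℕ, ∃ C : ℝ, 1 ≤ C ∧ ∀ Ψ : GL (Fin (k * (l + r))) F → ℂ, RInv U Ψ →
      (∀ (u : Coord k r r F) (B : Matrix (Fin (k * l)) (Fin (k * r)) F) (g : GL (Fin (k * (l + r))) F),
        Ψ (diagGL 1 (unip u) * radicalGL B * g) = (psiV ψ u : ℂ) * Ψ g) →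
      ∀ v : Coord k r l F, Ψ (kappa k l r * vThree v) ≠ 0 →
        ∀ p : Pair k × Fin r × Fin l, k ≤ p.1.1.1.val + j → ‖v p‖ ≤ C by
    obtain ⟨C, hC1, hC⟩ := H k
    refine ⟨C, fun Ψ h1 h2 v hv => ?_⟩
    exact (pi_norm_le_iff_of_nonneg (zero_le_one.trans hC1)).2 fun p =>
      hC Ψ h1 h2 v hv p (Nat.le_add_left _ _)
  intro j
  induction j with
  | zero => exact ⟨1, le_rfl, fun Ψ _ _ v _ p hp => absurd p.1.1.1.2 (not_lt.2 hp)⟩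
  | succ j ih =>
    obtain ⟨C, hC1, hC⟩ := ih
    refine ⟨max C (‖a‖ * C ^ 2 / δ), le_max_of_le_left hC1, fun Ψ h1 h2 v hv p hp => ?_⟩
    by_cases hpj : k ≤ p.1.1.1.val + j
    · exact (hC Ψ h1 h2 v hv p hpj).trans (le_max_left _ _)
    by_contra! hlt
    have hbig : ‖a‖ * C ^ 2 < δ * ‖v p‖ := by
      have := (le_max_right _ _).trans_lt hlt
      rwa [div_lt_iff₀ hδ, mul_comm _ δ] at this
    have hvp : v p ≠ 0 := by
      rintro h0
      rw [h0, norm_zero] at hlt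
      linarith [le_max_left C (‖a‖ * C ^ 2 / δ)]
    obtain ⟨⟨⟨i, s⟩, his⟩, α, β⟩ := p
    simp only at hp hpj hvp hbig his
    rw [Fin.lt_def] at his
    -- The block column just above the diagonal in row `i`, where `ψ` reads; it exists because `i <
    -- s`.
    let n : Fin k := ⟨i.val + 1, by have := s.2; omega⟩
    set y : F := a / v (⟨(i, s), his⟩, α, β) with hy
    have hyn : ‖y‖ * C ^ 2 < δ := by
      rw [hy, norm_div, div_mul_eq_mul_div, div_lt_iff₀ (norm_pos_iff.2 hvp)]
      exact hbig
    set X := strictUpper v with hX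
    -- `y` is chosen so that the `((i, α), (n, α))` entry of `Xt * Y` is `a`, while `y` itself is
    -- tiny because the entry of `v` is large. Truncating `X` to rows up to `i` keeps `Xt * Y`
    -- strictly upper triangular.
    let Y : Matrix (Fin k × Fin l) (Fin k × Fin r) F := Matrix.single (s, β) (n, α) y
    let Xt : Matrix (Fin k × Fin r) (Fin k × Fin l) F := Matrix.of fun a b =>
      if a.1 ≤ i then X a b else 0
    have hrow : ∀ a b, ¬ a.1 ≤ i → ‖X a b‖ ≤ C := by
      intro a b hab
      by_cases h : a.1 < b.1
      · have : X a b = v (⟨(a.1, b.1), h⟩, a.2, b.2) := by simp [hX, strictUpper, h]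
        rw [this]
        refine hC Ψ h1 h2 v hv _ ?_
        rw [Fin.le_def] at hab
        simp only
        omega
      · rw [hX, strictUpper_eq_zero _ h, norm_zero]
        exact zero_le_one.trans hC1
    have hU' : StrictlyUpper (Xt * Y) := by
      intro a b hab
      rw [mul_single_eq]
      split_ifs with hb
      · subst hb
        have : ¬ a.1 ≤ i := by
          intro h; apply hab; rw [Fin.le_def] at h; rw [Fin.lt_def]; simp only [n]; omega
        simp [Xt, this]
      · rfl
    let u : Coord k r r F := entriesOf (Xt * Y)
    let B : Matrix (Fin (k * l)) (Fin (k * r)) F := Y.submatrix finProdFinEquiv.symm finProdFinEquiv.symm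
    let g' : GL (Fin (k * (l + r))) F := (vThree v)⁻¹ *
      ((kappa k l r)⁻¹ * diagGL 1 (unip u) * kappa k l r) *
      ((kappa k l r)⁻¹ * radicalGL B * kappa k l r) * vThree v
    -- The rows up to `i`, possibly large, cancel here; only rows already bounded by `C` remain.
    let W : Matrix (Fin k × Fin r) (Fin k × Fin r) F := Xt * Y - X * Y
    have hW : ∀ a b, W a b = if b = (n, α) then (if a.1 ≤ i then 0 else -(X a (s, β) * y)) else 0 := by
      intro a b
      simp only [W, Matrix.sub_apply, Y, mul_single_eq, Xt, Matrix.of_apply]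
      split_ifs <;> simp
    have hq : quad g' = Matrix.fromBlocks (1 + Y * X) Y (W * X) (1 + W) := by
      have hB : (Y.submatrix finProdFinEquiv.symm finProdFinEquiv.symm).submatrix
          finProdFinEquiv finProdFinEquiv = Y := by ext; simp
      simp only [g']
      rw [quad_mul, quad_mul, quad_mul, quad_kappa_conj_diagGL, quad_kappa_conj_radicalGL,
        quad_vThree, quad_vThree_inv, blocks_one, blocks_unip, strictUpper_entriesOf hU', hB]
      simp only [Matrix.fromBlocks_multiply, Matrix.one_mul, Matrix.mul_one, Matrix.mul_zero,
        Matrix.zero_mul, add_zero, zero_add, ← hX, W]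
      congr 1
      · simp only [Matrix.add_mul, Matrix.sub_mul, Matrix.neg_mul, Matrix.one_mul]
        abel
      · rw [Matrix.neg_mul]
        abel
    have hn : ¬ n ≤ i := by rw [Fin.le_def]; simp [n]
    have hC2 : C ≤ C ^ 2 := by nlinarith
    have hWle : ∀ a b, ‖W a b‖ ≤ ‖y‖ * C := by
      intro a b
      rw [hW]
      split_ifs with h3 h4
      · rw [norm_zero]; positivity
      · rw [norm_neg, norm_mul, mul_comm]
        exact mul_le_mul_of_nonneg_left (hrow _ _ h4) (norm_nonneg _)
      · rw [norm_zero]; positivity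
    have hbd : ∀ σ τ, ‖(quad g' - 1) σ τ‖ ≤ ‖y‖ * C ^ 2 := by
      intro σ τ
      rw [hq, ← Matrix.fromBlocks_one, Matrix.sub_apply]
      rcases σ with σ | σ <;> rcases τ with τ | τ
      · simp only [Matrix.fromBlocks_apply₁₁, Matrix.add_apply, add_sub_cancel_left, Y, single_mul_eq]
        split_ifs
        · rw [norm_mul]
          exact mul_le_mul_of_nonneg_left ((hrow _ _ hn).trans hC2) (norm_nonneg _)
        · rw [norm_zero]; positivity
      · simp only [Matrix.fromBlocks_apply₁₂, Matrix.zero_apply, sub_zero, Y, Matrix.single_apply]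
        split_ifs
        · exact le_mul_of_one_le_right (norm_nonneg _) (hC1.trans hC2)
        · rw [norm_zero]; positivity
      · simp only [Matrix.fromBlocks_apply₂₁, Matrix.zero_apply, sub_zero]
        rw [Matrix.mul_apply, Finset.sum_eq_single (n, α) (fun b _ hb => by rw [hW, if_neg hb, zero_mul])
          (by simp), norm_mul, pow_two, ← mul_assoc]
        exact mul_le_mul (hWle _ _) (hrow _ _ hn) (norm_nonneg _) (by positivity)
      · simp only [Matrix.fromBlocks_apply₂₂, Matrix.add_apply, add_sub_cancel_left]
        exact (hWle _ _).trans (mul_le_mul_of_nonneg_left hC2 (norm_nonneg _))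
    have hgU : g' ∈ U := by
      refine hδU g' fun i' j' => ?_
      obtain ⟨σ, rfl⟩ := (quadEquiv k l r).surjective i'
      obtain ⟨τ, rfl⟩ := (quadEquiv k l r).surjective j'
      have : (g'.val - 1) (quadEquiv k l r σ) (quadEquiv k l r τ) = (quad g' - 1) σ τ := by
        simp [quad, Matrix.one_apply]
      rw [this]
      exact (hbd σ τ).trans_lt hyn
    have hpsi : psiV ψ u = ψ a := by
      rw [psiV]
      congr 1
      have hin : i < n := by rw [Fin.lt_def]; simp [n]
      rw [Finset.sum_eq_single ⟨(i, n), hin⟩]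
      · rw [if_pos rfl, Finset.sum_eq_single α]
        · simp only [u, entriesOf, Y, mul_single_eq, if_true, Xt, Matrix.of_apply, le_refl]
          have : X (i, α) (s, β) = v (⟨(i, s), his⟩, α, β) := strictUpper_apply_pair v (⟨(i, s), his⟩, α, β)
          rw [this, hy, mul_div_cancel₀ _ hvp]
        · intro γ _ hγ
          simp [u, entriesOf, Y, hγ]
        · simp
      · intro q _ hqne
        split_ifs with h3
        · refine Finset.sum_eq_zero fun γ _ => ?_
          simp only [u, entriesOf, Y, mul_single_eq]
          rw [if_neg]
          rintro h4
          apply hqne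
          have h5 : q.1.2 = n := congrArg Prod.fst h4
          refine Subtype.ext (Prod.ext (Fin.ext ?_) h5)
          rw [h5] at h3
          simp only [n] at h3
          simp only
          omega
        · rfl
      · simp
    -- The same group element acts on the left through `ψ` and, conjugated to `g'`, on the right
    -- through the level; hence the value must vanish if `ψ a ≠ 1`.
    have hfin : (ψ a : ℂ) * Ψ (kappa k l r * vThree v) = Ψ (kappa k l r * vThree v) := by
      rw [← hpsi, ← h2 u B, ← h1 (kappa k l r * vThree v) g' hgU]
      congr 1
      simp only [g']
      group
    have : (ψ a : ℂ) = 1 := mul_right_cancel₀ hv (by rw [hfin, one_mul])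
    exact ha (Circle.ext (by simpa using this))

end VThree

/-! ### Fibres of functions in I(ζ) as elements of ρ_l ⊗ ρ_r. -/

section Fibres

variable {F : Type*} [NontriviallyNormedField F] {k c l r : ℕ}

theorem absDet_mul {n : ℕ} (g h : GL (Fin n) F) : absDet (g * h) = absDet g * absDet h := by
  rw [absDet, Units.val_mul, Matrix.det_mul, norm_mul, absDet, absDet]

theorem absDet_pos {n : ℕ} (g : GL (Fin n) F) : 0 < absDet g :=
  norm_pos_iff.2 ((Matrix.isUnit_iff_isUnit_det _).1 g.isUnit).ne_zero

theorem absDet_unip (u : Coord k c c F) : absDet (unip u) = 1 := by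
  rw [absDet, det_unip, norm_one]

theorem deltaTwo_pos (a : GL (Fin (k * l)) F) (d : GL (Fin (k * r)) F) : 0 < deltaTwo a d :=
  div_pos (pow_pos (absDet_pos a) _) (pow_pos (absDet_pos d) _)

theorem deltaTwo_mul (a a' : GL (Fin (k * l)) F) (d d' : GL (Fin (k * r)) F) :
    deltaTwo (a * a') (d * d') = deltaTwo a d * deltaTwo a' d' := by
  rw [deltaTwo, deltaTwo, deltaTwo, absDet_mul, absDet_mul, mul_pow, mul_pow, mul_div_mul_comm]

theorem radicalGL_zero : (radicalGL 0 : GL (Fin (k * (l + r))) F) = 1 := Units.ext assemble_one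

theorem levi_one : levi (1 : Fin k → GL (Fin c) F) = 1 := by
  refine Units.ext ?_
  change (Matrix.blockDiagonal fun _ => (1 : Matrix (Fin c) (Fin c) F)).submatrix _ _ = 1
  exact (congrArg (fun A : Matrix (Fin c × Fin k) (Fin c × Fin k) F => A.submatrix _ _)
      Matrix.blockDiagonal_one).trans (Matrix.submatrix_one_equiv _)

theorem inducingChar_one (τ : Fin k → (Fˣ →* ℂˣ)) (ζ : Fin k → ℂ) :
    inducingChar τ ζ (1 : Fin k → GL (Fin c) F) = 1 := by
  simp [inducingChar, deltaP, absDet]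

theorem diagGL_mul_radicalGL (a : GL (Fin (k * l)) F) (d : GL (Fin (k * r)) F)
    (B : Matrix (Fin (k * l)) (Fin (k * r)) F) :
    diagGL a d * radicalGL B = radicalGL (a.val * B * d⁻¹.val) * diagGL a d := by
  refine Units.ext ?_
  change assemble a.val 0 0 d.val * assemble 1 B 0 1 = assemble 1 _ 0 1 * assemble a.val 0 0 d.val
  rw [assemble_mul, assemble_mul]
  simp [Matrix.mul_assoc]

variable {τ : Fin k → (Fˣ →* ℂˣ)} {ζ : Fin k → ℂ} {M : GL (Fin (k * (l + r))) F → ℂ}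

theorem fibre_equivariant (hM : M ∈ twoStepSpace l r τ ζ) (m₁ : Fin k → GL (Fin l) F)
    (u₁ : Coord k l l F) (m₂ : Fin k → GL (Fin r) F) (u₂ : Coord k r r F)
    (g : GL (Fin (k * (l + r))) F) (a : GL (Fin (k * l)) F) (d : GL (Fin (k * r)) F) :
    fibre M g (levi m₁ * unip u₁ * a) (levi m₂ * unip u₂ * d) =
      inducingChar τ ζ m₁ * inducingChar τ ζ m₂ * fibre M g a d := by
  have h1 := hM.2 m₁ u₁ m₂ u₂ 0 (diagGL a d * g)
  rw [radicalGL_zero, mul_one] at h1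
  have hp := deltaTwo_pos (levi m₁ * unip u₁) (levi m₂ * unip u₂)
  rw [fibre, fibre, diagGL_mul, mul_assoc (diagGL _ _), h1, deltaTwo_mul,
    Real.mul_rpow hp.le (deltaTwo_pos a d).le, Real.rpow_neg hp.le]
  have h2 : (((deltaTwo (levi m₁ * unip u₁) (levi m₂ * unip u₂)) ^
      (1 / 2 - 1 / (2 * (k : ℝ))) : ℝ) : ℂ) ≠ 0 :=
    Complex.ofReal_ne_zero.2 (Real.rpow_pos_of_pos hp _).ne'
  push_cast at h2 ⊢
  generalize 1 / 2 - 1 / (2 * (k : ℝ)) = e at h2 ⊢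
  field_simp

theorem radicalGL_equivariant (hM : M ∈ twoStepSpace l r τ ζ)
    (B : Matrix (Fin (k * l)) (Fin (k * r)) F) (g : GL (Fin (k * (l + r))) F) :
    M (radicalGL B * g) = M g := by
  have h := hM.2 1 0 1 0 B g
  have h1 : (diagGL 1 1 : GL (Fin (k * (l + r))) F) = 1 := Units.ext assemble_one
  rw [levi_one, levi_one, unip_zero, unip_zero, mul_one, mul_one, h1, one_mul, inducingChar_one,
    inducingChar_one] at h
  simpa [deltaTwo, absDet] using h

/-- The radical passes to the left of `diagGL a d`, where `M` is invariant, so only a right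
translation in the second variable is left. -/
theorem fibre_diagGL_radicalGL (hM : M ∈ twoStepSpace l r τ ζ) (u : Coord k r r F)
    (B : Matrix (Fin (k * l)) (Fin (k * r)) F) (g : GL (Fin (k * (l + r))) F)
    (a : GL (Fin (k * l)) F) (d : GL (Fin (k * r)) F) :
    fibre M (diagGL 1 (unip u) * radicalGL B * g) a d = fibre M g a (d * unip u) := by
  have h1 : diagGL a d * (diagGL 1 (unip u) * radicalGL B * g) =
      radicalGL (a.val * B * (d * unip u)⁻¹.val) * (diagGL a (d * unip u) * g) := by
    rw [← mul_assoc, ← mul_assoc, ← diagGL_mul, mul_one, diagGL_mul_radicalGL, mul_assoc]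
  have h2 : deltaTwo a (d * unip u) = deltaTwo a d := by
    rw [deltaTwo, absDet_mul, absDet_unip, mul_one, deltaTwo]
  rw [fibre, fibre, h1, radicalGL_equivariant hM, h2]

variable [IsUltrametricDist F] [ProperSpace F]

theorem continuous_diagGL : Continuous fun p : GL (Fin (k * l)) F × GL (Fin (k * r)) F =>
    (diagGL p.1 p.2 : GL (Fin (k * (l + r))) F) := by
  refine continuous_of_val ?_
  change Continuous fun p : GL (Fin (k * l)) F × GL (Fin (k * r)) F =>
    (Matrix.fromBlocks p.1.val 0 0 p.2.val).submatrix _ _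
  exact (Continuous.matrix_fromBlocks (Units.continuous_val.comp continuous_fst) continuous_const
    continuous_const (Units.continuous_val.comp continuous_snd)).matrix_submatrix _ _

theorem eventually_absDet_eq_one {n : ℕ} : ∀ᶠ h : GL (Fin n) F in 𝓝 1, absDet h = 1 :=
  eventually_norm_eq_one (φ := fun h : GL (Fin n) F => h.val.det)
    (Units.continuous_val.matrix_det) (by simp)

/-- Fibres inherit right invariance, uniformly. -/
theorem exists_rInv_fibre {U : Set (GL (Fin (k * (l + r))) F)} (hU : U ∈ 𝓝 1)
    (g : GL (Fin (k * (l + r))) F) :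
    ∃ U₁ ∈ 𝓝 (1 : GL (Fin (k * l)) F), ∃ U₂ ∈ 𝓝 (1 : GL (Fin (k * r)) F),
      ∀ M, RInv U M → (∀ d, RInv U₁ fun a => fibre M g a d) ∧ ∀ a, RInv U₂ fun d => fibre M g a d := by
  have hU' := conj_mem_nhds_one hU g
  have h1 : (diagGL 1 1 : GL (Fin (k * (l + r))) F) = 1 := Units.ext assemble_one
  have hc₁ : Tendsto (fun a : GL (Fin (k * l)) F => (diagGL a 1 : GL (Fin (k * (l + r))) F))
      (𝓝 1) (𝓝 1) := by
    have : Continuous fun a : GL (Fin (k * l)) F => (diagGL a 1 : GL (Fin (k * (l + r))) F) :=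
      continuous_diagGL.comp (continuous_id.prodMk continuous_const)
    exact this.tendsto' _ _ h1
  have hc₂ : Tendsto (fun d : GL (Fin (k * r)) F => (diagGL 1 d : GL (Fin (k * (l + r))) F))
      (𝓝 1) (𝓝 1) := by
    have : Continuous fun d : GL (Fin (k * r)) F => (diagGL 1 d : GL (Fin (k * (l + r))) F) :=
      continuous_diagGL.comp (continuous_const.prodMk continuous_id)
    exact this.tendsto' _ _ h1
  refine ⟨_, inter_mem (hc₁ hU') eventually_absDet_eq_one, _,
    inter_mem (hc₂ hU') eventually_absDet_eq_one, fun M hM => ⟨fun d a h hh => ?_, fun a d h hh => ?_⟩⟩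
  · have h2 : diagGL (a * h) d * g = diagGL a d * g * (g⁻¹ * diagGL h 1 * g) := by
      conv_lhs => rw [← mul_one d, diagGL_mul]
      group
    have h3 : absDet h = 1 := hh.2
    simp only [fibre]
    rw [h2, hM _ _ hh.1, deltaTwo, absDet_mul, h3, mul_one, deltaTwo]
  · have h2 : diagGL a (d * h) * g = diagGL a d * g * (g⁻¹ * diagGL 1 h * g) := by
      conv_lhs => rw [← mul_one a, diagGL_mul]
      group
    have h3 : absDet h = 1 := hh.2
    simp only [fibre]
    rw [h2, hM _ _ hh.1, deltaTwo, absDet_mul, h3, mul_one, deltaTwo]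

theorem fibre_mem_rhoSpace_right (hM : M ∈ twoStepSpace l r τ ζ) (g : GL (Fin (k * (l + r))) F)
    (a : GL (Fin (k * l)) F) : (fun d => fibre M g a d) ∈ rhoSpace r τ ζ := by
  obtain ⟨U, hU, hMU⟩ := isSmooth_iff.1 hM.1
  obtain ⟨U₁, hU₁, U₂, hU₂, h⟩ := exists_rInv_fibre hU g
  refine ⟨isSmooth_iff.2 ⟨U₂, hU₂, (h M hMU).2 a⟩, fun m u d => ?_⟩
  have := fibre_equivariant hM 1 0 m u g a d
  rwa [levi_one, unip_zero, mul_one, one_mul, inducingChar_one, one_mul] at this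

theorem fibre_mem_rhoSpace_left (hM : M ∈ twoStepSpace l r τ ζ) (g : GL (Fin (k * (l + r))) F)
    (d : GL (Fin (k * r)) F) : (fun a => fibre M g a d) ∈ rhoSpace l τ ζ := by
  obtain ⟨U, hU, hMU⟩ := isSmooth_iff.1 hM.1
  obtain ⟨U₁, hU₁, U₂, hU₂, h⟩ := exists_rInv_fibre hU g
  refine ⟨isSmooth_iff.2 ⟨U₁, hU₁, (h M hMU).1 d⟩, fun m u a => ?_⟩
  have := fibre_equivariant hM m u 1 0 g a d
  rwa [levi_one, unip_zero, mul_one, one_mul, inducingChar_one, mul_one] at this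

theorem rhoSpace_zero : (0 : GL (Fin (k * c)) F → ℂ) ∈ rhoSpace c τ ζ :=
  ⟨⟨⊤, isOpen_univ, fun _ _ _ => rfl⟩, fun _ _ _ => (mul_zero _).symm⟩

theorem rhoSpace_smul {f : GL (Fin (k * c)) F → ℂ} (hf : f ∈ rhoSpace c τ ζ) (x : ℂ) :
    x • f ∈ rhoSpace c τ ζ := by
  obtain ⟨⟨K, hK, h⟩, h'⟩ := hf
  refine ⟨⟨K, hK, fun g x hx => ?_⟩, fun m u g => ?_⟩
  · simp only [Pi.smul_apply, h g x hx]
  · simp only [Pi.smul_apply, h', smul_eq_mul]; ring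

theorem rhoSpace_add {f f' : GL (Fin (k * c)) F → ℂ} (hf : f ∈ rhoSpace c τ ζ)
    (hf' : f' ∈ rhoSpace c τ ζ) : f + f' ∈ rhoSpace c τ ζ := by
  obtain ⟨⟨K, hK, h⟩, h'⟩ := hf
  obtain ⟨⟨K₂, hK₂, h₂⟩, h₂'⟩ := hf'
  refine ⟨⟨K ⊓ K₂, hK.inter hK₂, fun g x hx => ?_⟩, fun m u g => ?_⟩
  · simp only [Pi.add_apply, h g x hx.1, h₂ g x hx.2]
  · simp only [Pi.add_apply, h', h₂']; ring

/-- Applying a combination of evaluations to one variable. -/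
theorem evalSpan_mem_rhoSpace {G : Type*} {A : (G → ℂ) →ₗ[ℂ] ℂ} (hA : A ∈ evalSpan G)
    {Φ : GL (Fin (k * c)) F → G → ℂ} {V : Set (GL (Fin (k * c)) F)}
    (h : ∀ d, (fun a => Φ a d) ∈ rhoSpace c τ ζ ∧ RInv V fun a => Φ a d) :
    (fun a => A (Φ a)) ∈ rhoSpace c τ ζ ∧ RInv V fun a => A (Φ a) := by
  refine Submodule.span_induction (p := fun A _ => (fun a => A (Φ a)) ∈ rhoSpace c τ ζ ∧
    RInv V fun a => A (Φ a)) ?_ ?_ ?_ ?_ hA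
  · rintro _ ⟨g, rfl⟩
    exact h g
  · exact ⟨rhoSpace_zero, fun _ _ _ => rfl⟩
  · refine fun A B _ _ h1 h2 => ⟨rhoSpace_add h1.1 h2.1, fun g x hx => ?_⟩
    exact congrArg₂ (· + ·) (h1.2 g x hx) (h2.2 g x hx)
  · refine fun x A _ h1 => ⟨rhoSpace_smul h1.1 x, fun g y hy => ?_⟩
    exact congrArg (x * ·) (h1.2 g y hy)

end Fibres

/-! ### Applying functionals to the two factors. -/

section Apply

variable {F : Type*} [NontriviallyNormedField F] {k c l r : ℕ} [IsUltrametricDist F] [ProperSpace F]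
  {τ : Fin k → (Fˣ →* ℂˣ)}

/-- `Λ` is on each `ρ_c(τ_ζ)`, and on functions invariant under a fixed neighbourhood of `1`,
a combination of evaluations that does not depend on `ζ`. -/
def IsLocallyFinite (c : ℕ) (τ : Fin k → (Fˣ →* ℂˣ)) (Λ : (GL (Fin (k * c)) F → ℂ) →ₗ[ℂ] ℂ) : Prop :=
  ∀ U ∈ 𝓝 (1 : GL (Fin (k * c)) F), ∃ A ∈ evalSpan (GL (Fin (k * c)) F), ∀ ζ,
    ∀ f ∈ rhoSpace c τ ζ, RInv U f → Λ f = A f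

variable {Λ₁ : (GL (Fin (k * l)) F → ℂ) →ₗ[ℂ] ℂ} {Λ₂ : (GL (Fin (k * r)) F → ℂ) →ₗ[ℂ] ℂ}

/-- After `Λ₂` has become a finite combination of evaluations, the resulting function of `a` is
again in ρ_l with a level known in advance, so `Λ₁` can be replaced too. The combinations depend on
`g` and `U` but not on `ζ`. -/
theorem exists_applyFactors_eq (h₁ : IsLocallyFinite l τ Λ₁) (h₂ : IsLocallyFinite r τ Λ₂)
    {U : Set (GL (Fin (k * (l + r))) F)} (hU : U ∈ 𝓝 1) (g : GL (Fin (k * (l + r))) F) :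
    ∃ A₁ ∈ evalSpan (GL (Fin (k * l)) F), ∃ A₂ ∈ evalSpan (GL (Fin (k * r)) F), ∀ ζ,
      ∀ M ∈ twoStepSpace l r τ ζ, RInv U M →
        (∀ a, Λ₂ (fun d => fibre M g a d) = A₂ fun d => fibre M g a d) ∧
        (fun a => A₂ fun d => fibre M g a d) ∈ rhoSpace l τ ζ ∧
        applyFactors Λ₁ Λ₂ M g = A₁ fun a => A₂ fun d => fibre M g a d := by
  obtain ⟨U₁, hU₁, U₂, hU₂, h⟩ := exists_rInv_fibre hU g
  obtain ⟨A₁, hA₁, h3⟩ := h₁ U₁ hU₁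
  obtain ⟨A₂, hA₂, h4⟩ := h₂ U₂ hU₂
  refine ⟨A₁, hA₁, A₂, hA₂, fun ζ M hM hMU => ?_⟩
  have h5 : ∀ a, Λ₂ (fun d => fibre M g a d) = A₂ fun d => fibre M g a d := fun a =>
    h4 ζ _ (fibre_mem_rhoSpace_right hM g a) ((h M hMU).2 a)
  have h6 := evalSpan_mem_rhoSpace (Φ := fun a d => fibre M g a d) hA₂ fun d =>
    ⟨fibre_mem_rhoSpace_left hM g d, (h M hMU).1 d⟩
  refine ⟨h5, h6.1, ?_⟩
  rw [applyFactors]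
  simp only [h5]
  exact h3 ζ _ h6.1 h6.2

theorem applyFactors_mem_entireFun (h₁ : IsLocallyFinite l τ Λ₁) (h₂ : IsLocallyFinite r τ Λ₂)
    {U : Set (GL (Fin (k * (l + r))) F)} (hU : U ∈ 𝓝 1)
    {N : (Fin k → ℂ) → GL (Fin (k * (l + r))) F → ℂ} (hN : ∀ ζ, N ζ ∈ twoStepSpace l r τ ζ)
    (hNU : ∀ ζ, RInv U (N ζ)) (hNe : ∀ g, (fun ζ => N ζ g) ∈ entireFun F k)
    (g : GL (Fin (k * (l + r))) F) :
    (fun ζ => applyFactors Λ₁ Λ₂ (N ζ) g) ∈ entireFun F k := by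
  obtain ⟨A₁, hA₁, A₂, hA₂, h⟩ := exists_applyFactors_eq h₁ h₂ hU g
  have : (fun ζ => applyFactors Λ₁ Λ₂ (N ζ) g) = fun ζ => A₁ fun a => A₂ fun d => fibre (N ζ) g a d :=
    funext fun ζ => (h ζ _ (hN ζ) (hNU ζ)).2.2
  rw [this]
  refine mem_entireFun_of_evalSpan hA₁ (f := fun ζ a => A₂ fun d => fibre (N ζ) g a d) fun a =>
    mem_entireFun_of_evalSpan hA₂ (f := fun ζ d => fibre (N ζ) g a d) fun d => ?_
  exact Subalgebra.smul_mem _ (hNe _) _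

theorem rInv_applyFactors {U : Set (GL (Fin (k * (l + r))) F)} {M : GL (Fin (k * (l + r))) F → ℂ}
    (hM : RInv U M) (L₁ : (GL (Fin (k * l)) F → ℂ) → ℂ) (L₂ : (GL (Fin (k * r)) F → ℂ) → ℂ) :
    RInv U (applyFactors L₁ L₂ M) := by
  intro g h hh
  have : ∀ a d, fibre M (g * h) a d = fibre M g a d := fun a d => by
    rw [fibre, ← mul_assoc, hM _ h hh, fibre]
  simp only [applyFactors, this]

theorem applyFactors_smul (x : ℂ) (M : GL (Fin (k * (l + r))) F → ℂ) (g : GL (Fin (k * (l + r))) F) :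
    applyFactors Λ₁ Λ₂ (x • M) g = x * applyFactors Λ₁ Λ₂ M g := by
  have h : ∀ a, (fun d => fibre (x • M) g a d) = x • fun d => fibre M g a d := fun a => by
    funext d
    simp only [fibre, Pi.smul_apply, smul_eq_mul]
    ring
  simp only [applyFactors, h, map_smul]
  exact map_smul Λ₁ x fun a => Λ₂ fun d => fibre M g a d

variable [MeasurableSpace F] [BorelSpace F] (μ : Measure F)
  [μ.IsAddHaarMeasure] {ψ : AddChar F Circle} {ζ : Fin k → ℂ} {M : GL (Fin (k * (l + r))) F → ℂ}

theorem applyFactors_eq_jacquetIntegral (h₁ : IsLocallyFinite l τ Λ₁) (h₂ : IsLocallyFinite r τ Λ₂)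
    (hJ₁ : ∀ f ∈ rhoSpace l τ ζ, Λ₁ f = jacquetIntegral ψ μ f)
    (hJ₂ : ∀ f ∈ rhoSpace r τ ζ, Λ₂ f = jacquetIntegral ψ μ f) (hM : M ∈ twoStepSpace l r τ ζ) :
    applyFactors Λ₁ Λ₂ M = applyFactors (jacquetIntegral ψ μ) (jacquetIntegral ψ μ) M := by
  funext g
  obtain ⟨U, hU, hMU⟩ := isSmooth_iff.1 hM.1
  obtain ⟨A₁, hA₁, A₂, hA₂, h⟩ := exists_applyFactors_eq h₁ h₂ hU g
  obtain ⟨h3, h4, h5⟩ := h ζ M hM hMU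
  have h6 : ∀ a, jacquetIntegral ψ μ (fun d => fibre M g a d) = A₂ fun d => fibre M g a d := fun a =>
    (hJ₂ _ (fibre_mem_rhoSpace_right hM g a)).symm.trans (h3 a)
  simp only [applyFactors, h6, h3]
  exact hJ₁ _ h4

/-- Invariance of the measure under right multiplication, with `ψ` a character. It is an identity of
integrals and needs no convergence hypothesis. -/
theorem jacquetIntegral_translate (hF : IsNormalizedAbs F) (hψ : Continuous ψ)
    {f : GL (Fin (k * c)) F → ℂ} (hf : Continuous f) (u : Coord k c c F) :
    jacquetIntegral ψ μ (fun g => f (g * unip u)) = (psiV ψ u : ℂ) * jacquetIntegral ψ μ f := by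
  have h := (measurePreserving_mulCoord_right μ hF u).integral_comp_continuous
    (continuous_jacquetIntegrand hψ hf)
  rw [jacquetIntegral, jacquetIntegral, ← h, ← integral_const_mul]
  congr 1
  funext v
  rw [jacquetIntegrand, jacquetIntegrand, unip_mulCoord, psiV_mulCoord, mul_assoc, mul_inv]
  have h1 : (psiV ψ u : ℂ) ≠ 0 := Circle.coe_ne_zero _
  push_cast
  field_simp

theorem applyFactors_jacquetIntegral_equivariant (hF : IsNormalizedAbs F) (hψ : Continuous ψ)
    (hM : M ∈ twoStepSpace l r τ ζ) (u : Coord k r r F) (B : Matrix (Fin (k * l)) (Fin (k * r)) F)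
    (g : GL (Fin (k * (l + r))) F) :
    applyFactors (jacquetIntegral ψ μ) (jacquetIntegral ψ μ) M (diagGL 1 (unip u) * radicalGL B * g) =
      (psiV ψ u : ℂ) * applyFactors (jacquetIntegral ψ μ) (jacquetIntegral ψ μ) M g := by
  have h : ∀ a, jacquetIntegral ψ μ (fun d => fibre M (diagGL 1 (unip u) * radicalGL B * g) a d) =
      (psiV ψ u : ℂ) * jacquetIntegral ψ μ fun d => fibre M g a d := by
    intro a
    simp only [fibre_diagGL_radicalGL hM]
    exact jacquetIntegral_translate μ hF hψ (fibre_mem_rhoSpace_right hM g a).1.continuous u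
  simp only [applyFactors, h]
  rw [jacquetIntegral, jacquetIntegral, ← integral_const_mul]
  simp only [jacquetIntegrand, mul_assoc]

end Apply

/-! ### Continuation of the identity to general ζ. -/

section Continuation

variable {F : Type*} [NontriviallyNormedField F] [IsUltrametricDist F] [ProperSpace F]
  {k c l r : ℕ} {τ : Fin k → (Fˣ →* ℂˣ)}

theorem twoStepSpace_smul {ζ : Fin k → ℂ} {M : GL (Fin (k * (l + r))) F → ℂ}
    (hM : M ∈ twoStepSpace l r τ ζ) (x : ℂ) : x • M ∈ twoStepSpace l r τ ζ := by
  obtain ⟨⟨K, hK, h⟩, h'⟩ := hM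
  refine ⟨⟨K, hK, fun g y hy => ?_⟩, fun m₁ u₁ m₂ u₂ B g => ?_⟩
  · simp only [Pi.smul_apply, h g y hy]
  · simp only [Pi.smul_apply, h', smul_eq_mul]; ring

/-- The norm of a determinant is an integral power of `q`, so `‖det‖ ^ ζ i` is an integral power of
`q ^ ζ i`. Thus equivariance is an identity between Laurent polynomials. -/
theorem inducingChar_mem_entireFun (hF : IsNormalizedAbs F) (m : Fin k → GL (Fin c) F) :
    (fun ζ => inducingChar τ ζ m) ∈ entireFun F k := by
  have h : ∀ i, (fun ζ : Fin k → ℂ => (absDet (m i) : ℂ) ^ ζ i *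
      (τ i (Matrix.GeneralLinearGroup.det (m i)) : ℂ)) ∈ entireFun F k := by
    intro i
    refine mul_mem ?_ (const_mem_entireFun _)
    have hq : (residueCard F : ℂ) ≠ 0 := residueCard_cast_ne_zero
    convert! cpow_zpow_mem_entireFun (F := F) i (deg (m i).val.det) using 1
    funext ζ
    have h1 : (m i).val.det ≠ 0 := ((Matrix.isUnit_iff_isUnit_det _).1 (m i).isUnit).ne_zero
    have hq0 : (0 : ℝ) < (residueCard F : ℝ) := residueCard_pos
    rw [absDet, norm_eq_zpow_deg hF h1, Complex.cpow_def_of_ne_zero (by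
      exact_mod_cast (zpow_pos hq0 _).ne'), Complex.cpow_def_of_ne_zero hq, ← Complex.exp_int_mul,
      ← Complex.ofReal_log (zpow_pos hq0 _).le, Real.log_zpow, Complex.ofReal_mul,
      Complex.ofReal_log hq0.le]
    push_cast
    ring_nf
  have h2 : (fun ζ => inducingChar τ ζ m) = (fun _ => ((deltaP m ^ (1 / 2 : ℝ) : ℝ) : ℂ)) *
      ∏ i, fun ζ : Fin k → ℂ => (absDet (m i) : ℂ) ^ ζ i *
        (τ i (Matrix.GeneralLinearGroup.det (m i)) : ℂ) := by
    funext ζ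
    simp [inducingChar, Finset.prod_apply]
  rw [h2]
  exact mul_mem (const_mem_entireFun _) (prod_mem fun i _ => h i)

/-- Membership in the induced space and right invariance extend from a cone to all `ζ`. -/
theorem twoStepSpace_of_cone (hF : IsNormalizedAbs F) {R : ℝ}
    {N : (Fin k → ℂ) → GL (Fin (k * (l + r))) F → ℂ} (hN : ∀ g, (fun ζ => N ζ g) ∈ entireFun F k)
    {U : Set (GL (Fin (k * (l + r))) F)} (hU : U ∈ 𝓝 1)
    (h : ∀ ζ ∈ cone k R, N ζ ∈ twoStepSpace l r τ ζ ∧ RInv U (N ζ)) (ζ : Fin k → ℂ) :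
    N ζ ∈ twoStepSpace l r τ ζ ∧ RInv U (N ζ) := by
  have h1 : RInv U (N ζ) := fun g x hx =>
    congrFun (entireFun_ext (hN (g * x)) (hN g) (interior_cone_nonempty R)
      fun ζ hζ => (h ζ hζ).2 g x hx) ζ
  refine ⟨⟨isSmooth_iff.2 ⟨U, hU, h1⟩, fun m₁ u₁ m₂ u₂ B g => ?_⟩, h1⟩
  exact congrFun (entireFun_ext (hN _) (mul_mem (mul_mem (mul_mem (const_mem_entireFun _)
    (inducingChar_mem_entireFun hF m₁)) (inducingChar_mem_entireFun hF m₂)) (hN g))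
    (interior_cone_nonempty R) fun ζ hζ => (h ζ hζ).1.2 m₁ u₁ m₂ u₂ B g) ζ

variable [MeasurableSpace F] [BorelSpace F] (μ : Measure F) [μ.IsAddHaarMeasure]
  {ψ : AddChar F Circle}

theorem mIntegral_smul (x : ℂ) (f : GL (Fin (k * (l + r))) F → ℂ) :
    mIntegral μ (x • f) = x • mIntegral μ f := by
  funext g
  simp only [mIntegral, Pi.smul_apply, smul_eq_mul]
  exact integral_const_mul _ _

theorem IsLocallyFinite.mem_entireFun {Λ : (GL (Fin (k * c)) F → ℂ) →ₗ[ℂ] ℂ}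
    (hΛ : IsLocallyFinite c τ Λ) {ξ : (Fin k → ℂ) → GL (Fin (k * c)) F → ℂ}
    (hξ : IsEntireSection c τ ξ) : (fun ζ => Λ (ξ ζ)) ∈ entireFun F k := by
  obtain ⟨U, hU, h⟩ := exists_uniform_rInv (fun ζ => (hξ.1 ζ).1) hξ.2
  obtain ⟨A, hA, hAΛ⟩ := hΛ U hU
  have : (fun ζ => Λ (ξ ζ)) = fun ζ => A (ξ ζ) := funext fun ζ => hAΛ ζ _ (hξ.1 ζ) (h ζ)
  rw [this]
  exact mem_entireFun_of_evalSpan hA hξ.2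

variable {Λ : (GL (Fin (k * (l + r))) F → ℂ) →ₗ[ℂ] ℂ} {Λ₁ : (GL (Fin (k * l)) F → ℂ) →ₗ[ℂ] ℂ}
  {Λ₂ : (GL (Fin (k * r)) F → ℂ) →ₗ[ℂ] ℂ} {R : ℝ}

/-- The root exchange identity along an entire section, after clearing denominators. -/
theorem entireSection_identity (hF : IsNormalizedAbs F) (hk : 1 ≤ k) (hψ : Continuous ψ)
    (hψ1 : ψ ≠ 1) (hR : cone k R ⊆ convergenceDomain (l + r) τ ψ μ)
    (hΛ : IsLocallyFinite (l + r) τ Λ) (hΛ₁ : IsLocallyFinite l τ Λ₁) (hΛ₂ : IsLocallyFinite r τ Λ₂)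
    (hJ : ∀ ζ ∈ cone k R, ∀ f ∈ rhoSpace (l + r) τ ζ, Λ f = jacquetIntegral ψ μ f)
    (hJ₁ : ∀ ζ ∈ cone k R, ∀ f ∈ rhoSpace l τ ζ, Λ₁ f = jacquetIntegral ψ μ f)
    (hJ₂ : ∀ ζ ∈ cone k R, ∀ f ∈ rhoSpace r τ ζ, Λ₂ f = jacquetIntegral ψ μ f)
    {ξ : (Fin k → ℂ) → GL (Fin (k * (l + r))) F → ℂ} (hξ : IsEntireSection (l + r) τ ξ)
    {D : (Fin k → ℂ) → ℂ} (hD : D ∈ entireFun F k) {N : (Fin k → ℂ) → GL (Fin (k * (l + r))) F → ℂ}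
    (hN : ∀ g, (fun ζ => N ζ g) ∈ entireFun F k)
    (hND : ∀ ζ ∈ cone k R, N ζ = D ζ • mIntegral μ (ξ ζ)) (ζ : Fin k → ℂ) :
    N ζ ∈ twoStepSpace l r τ ζ ∧
      Integrable (fun v => applyFactors Λ₁ Λ₂ (N ζ) (kappa k l r * vThree v))
        (coordMeasure μ k r l) ∧
      D ζ * Λ (ξ ζ) = ∫ v, applyFactors Λ₁ Λ₂ (N ζ) (kappa k l r * vThree v)
        ∂(coordMeasure μ k r l) := by
  obtain ⟨U, hU, hξU⟩ := exists_uniform_rInv (fun ζ => (hξ.1 ζ).1) hξ.2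
  have hcone : ∀ ζ ∈ cone k R, N ζ ∈ twoStepSpace l r τ ζ ∧ RInv U (N ζ) := by
    intro ζ hζ
    rw [hND ζ hζ]
    refine ⟨twoStepSpace_smul (mIntegral_mem_twoStepSpace μ hF hk (hξ.1 ζ)) _, fun g h hh => ?_⟩
    simp only [Pi.smul_apply, mIntegral, ← mul_assoc, hξU ζ _ h hh]
  have hall := twoStepSpace_of_cone hF hN hU hcone
  have hΨe := applyFactors_mem_entireFun hΛ₁ hΛ₂ hU (fun ζ => (hall ζ).1) (fun ζ => (hall ζ).2) hN
  have hΨJ : ∀ ζ ∈ cone k R, applyFactors Λ₁ Λ₂ (N ζ) =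
      applyFactors (jacquetIntegral ψ μ) (jacquetIntegral ψ μ) (N ζ) := fun ζ hζ =>
    applyFactors_eq_jacquetIntegral μ hΛ₁ hΛ₂ (hJ₁ ζ hζ) (hJ₂ ζ hζ) (hall ζ).1
  obtain ⟨C, hC⟩ := exists_bound_support (F := F) (k := k) (l := l) (r := r) hψ1 hU
  -- On the cone the functionals are integrals and carry the `ψ`-equivariance needed for bounded
  -- support. For fixed `v` the vanishing then persists for every `ζ` by the identity theorem.
  have hzero : ∀ v : Coord k r l F, C < ‖v‖ → ∀ ζ,
      applyFactors Λ₁ Λ₂ (N ζ) (kappa k l r * vThree v) = 0 := by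
    intro v hv ζ
    refine congrFun (entireFun_ext (hΨe (kappa k l r * vThree v)) (const_mem_entireFun 0)
      (interior_cone_nonempty R) fun ζ hζ => ?_) ζ
    by_contra hne
    refine absurd (hC (applyFactors Λ₁ Λ₂ (N ζ)) (rInv_applyFactors (hall ζ).2 _ _) (fun u B g => ?_)
      v hne) (not_le.2 hv)
    rw [hΨJ ζ hζ]
    exact applyFactors_jacquetIntegral_equivariant μ hF hψ (hall ζ).1 u B g
  let Ω : Set (Coord k r l F) := Metric.closedBall 0 C
  have hΩ : ∀ ζ, ∀ v ∉ Ω, applyFactors Λ₁ Λ₂ (N ζ) (kappa k l r * vThree v) = 0 := fun ζ v hv =>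
    hzero v (by simpa [Ω] using hv) ζ
  -- Bounded support and a common level turn the V-integral into one finite combination of
  -- evaluations for all `ζ`, hence into a Laurent polynomial.
  obtain ⟨A, hA, hAint⟩ := exists_evalSpan_setIntegral (ν := coordMeasure μ k r l)
    (isCompact_closedBall (0 : Coord k r l F) C) measurableSet_closedBall
    (x := fun v => (kappa k l r * vThree v : GL (Fin (k * (l + r))) F))
    (continuous_const.mul continuous_vThree) (θ := fun _ => 1)
    (integrableOn_const (isCompact_closedBall _ _).measure_lt_top.ne) hU
  simp only [mul_one] at hAint
  have hA' := fun ζ => hAint _ (rInv_applyFactors (hall ζ).2 Λ₁ Λ₂)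
  have hint : ∀ ζ, ∫ v, applyFactors Λ₁ Λ₂ (N ζ) (kappa k l r * vThree v) ∂(coordMeasure μ k r l) =
      A (applyFactors Λ₁ Λ₂ (N ζ)) := fun ζ => by
    rw [← (hA' ζ).2, setIntegral_eq_integral_of_forall_compl_eq_zero (hΩ ζ)]
  refine ⟨(hall ζ).1, (hA' ζ).1.integrable_of_forall_notMem_eq_zero (hΩ ζ), ?_⟩
  rw [hint]
  refine congrFun (entireFun_ext (mul_mem hD (hΛ.mem_entireFun hξ)) (mem_entireFun_of_evalSpan hA hΨe)
    (interior_cone_nonempty R) fun ζ hζ => ?_) ζ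
  rw [← hint, Pi.mul_apply]
  have h1 := integrable_applyFactors_mIntegral μ hF hψ (hR hζ) (hξ.1 ζ)
  have h2 := applyFactors_eq_jacquetIntegral μ hΛ₁ hΛ₂ (hJ₁ ζ hζ) (hJ₂ ζ hζ)
    (mIntegral_mem_twoStepSpace μ hF hk (hξ.1 ζ))
  rw [hJ ζ hζ _ (hξ.1 ζ), h1.2, ← h2, hND ζ hζ, ← integral_const_mul]
  simp only [applyFactors_smul]

/-- The root exchange identity along a meromorphic section. -/
theorem meromorphicSection_identity (hF : IsNormalizedAbs F) (hk : 1 ≤ k) (hψ : Continuous ψ)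
    (hψ1 : ψ ≠ 1) (hR : cone k R ⊆ convergenceDomain (l + r) τ ψ μ)
    (hΛ : IsLocallyFinite (l + r) τ Λ) (hΛ₁ : IsLocallyFinite l τ Λ₁) (hΛ₂ : IsLocallyFinite r τ Λ₂)
    (hJ : ∀ ζ ∈ cone k R, ∀ f ∈ rhoSpace (l + r) τ ζ, Λ f = jacquetIntegral ψ μ f)
    (hJ₁ : ∀ ζ ∈ cone k R, ∀ f ∈ rhoSpace l τ ζ, Λ₁ f = jacquetIntegral ψ μ f)
    (hJ₂ : ∀ ζ ∈ cone k R, ∀ f ∈ rhoSpace r τ ζ, Λ₂ f = jacquetIntegral ψ μ f)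
    (hm : ∀ ξ : (Fin k → ℂ) → GL (Fin (k * (l + r))) F → ℂ, IsEntireSection (l + r) τ ξ →
        ∃ D ∈ entireFun F k, D ≠ 0 ∧ ∃ N : (Fin k → ℂ) → GL (Fin (k * (l + r))) F → ℂ,
          (∀ g, (fun ζ => N ζ g) ∈ entireFun F k) ∧
          ∀ ζ ∈ cone k R, ∀ g, N ζ g = D ζ * mIntegral μ (ξ ζ) g)
    {ξ : (Fin k → ℂ) → GL (Fin (k * (l + r))) F → ℂ} (hξ : IsMeromorphicSection (l + r) τ ξ) :
    ∃ (M : (Fin k → ℂ) → GL (Fin (k * (l + r))) F → ℂ) (D : (Fin k → ℂ) → ℂ),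
      D ∈ entireFun F k ∧ D ≠ 0 ∧ (∀ g, (fun ζ => D ζ * M ζ g) ∈ entireFun F k) ∧
      (∀ ζ, D ζ ≠ 0 → ξ ζ ∈ rhoSpace (l + r) τ ζ) ∧
      (∀ ζ ∈ cone k R, D ζ ≠ 0 → M ζ = mIntegral μ (ξ ζ)) ∧
      ∀ ζ, D ζ ≠ 0 → M ζ ∈ twoStepSpace l r τ ζ ∧
        Integrable (fun v => applyFactors Λ₁ Λ₂ (M ζ) (kappa k l r * vThree v))
          (coordMeasure μ k r l) ∧
        Λ (ξ ζ) = ∫ v, applyFactors Λ₁ Λ₂ (M ζ) (kappa k l r * vThree v)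
          ∂(coordMeasure μ k r l) := by
  obtain ⟨φ, hφ, hφ0, hφξ⟩ := hξ
  obtain ⟨D, hD, hD0, N, hN, hND⟩ := hm _ hφξ
  have hid := entireSection_identity μ hF hk hψ hψ1 hR hΛ hΛ₁ hΛ₂ hJ hJ₁ hJ₂ hφξ hD hN
    fun ζ hζ => funext (hND ζ hζ)
  have hξφ : ∀ ζ, φ ζ ≠ 0 → ξ ζ = (φ ζ)⁻¹ • fun g => φ ζ * ξ ζ g := fun ζ h => by
    funext g
    rw [Pi.smul_apply, smul_eq_mul, inv_mul_cancel_left₀ h]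
  have hne : ∀ ζ, (D * φ * (D * φ)) ζ ≠ 0 → D ζ ≠ 0 ∧ φ ζ ≠ 0 := fun ζ h => by
    have := left_ne_zero_of_mul h
    exact ⟨left_ne_zero_of_mul this, right_ne_zero_of_mul this⟩
  -- The denominator is squared because the inverse is `0` where `D * φ` vanishes: with the square,
  -- the product with `M` equals `D * φ * N` at those points too, so it is a Laurent polynomial
  -- everywhere.
  refine ⟨fun ζ => (D ζ * φ ζ)⁻¹ • N ζ, D * φ * (D * φ), mul_mem (mul_mem hD hφ) (mul_mem hD hφ),
    ?_, fun g => ?_, fun ζ h => ?_, fun ζ hζ h => ?_, fun ζ h => ?_⟩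
  · have h1 := entireFun_mul_ne_zero hD hφ hD0 hφ0
    exact entireFun_mul_ne_zero (mul_mem hD hφ) (mul_mem hD hφ) h1 h1
  · convert! mul_mem (mul_mem hD hφ) (hN g) using 1
    funext ζ
    simp only [Pi.mul_apply, Pi.smul_apply, smul_eq_mul]
    by_cases h : D ζ * φ ζ = 0
    · simp [h]
    · rw [mul_assoc, mul_inv_cancel_left₀ h]
  · rw [hξφ ζ (hne ζ h).2]
    exact rhoSpace_smul (hφξ.1 ζ) _
  · obtain ⟨h1, h2⟩ := hne ζ h
    have h3 : N ζ = D ζ • mIntegral μ fun g => φ ζ * ξ ζ g := funext (hND ζ hζ)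
    have h4 := mIntegral_smul μ (φ ζ)⁻¹ fun g => φ ζ * ξ ζ g
    rw [← hξφ ζ h2] at h4
    change (D ζ * φ ζ)⁻¹ • N ζ = _
    rw [h3, h4, smul_smul]
    congr 1
    field_simp
  · obtain ⟨h1, h2⟩ := hne ζ h
    obtain ⟨h3, h4, h5⟩ := hid ζ
    refine ⟨twoStepSpace_smul h3 _, ?_, ?_⟩
    · simp only [applyFactors_smul]
      exact h4.const_mul _
    · simp only [applyFactors_smul]
      rw [integral_const_mul, ← h5, hξφ ζ h2, map_smul, smul_eq_mul, ← hξφ ζ h2]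
      field_simp

end Continuation

end KC

theorem mainTheorem8 {F : Type*} [NontriviallyNormedField F] [IsUltrametricDist F]
    [LocallyCompactSpace F] [CharZero F] [MeasurableSpace F] [BorelSpace F]
    (hF : KC.IsNormalizedAbs F)
    (k l r : ℕ) (hk : 1 ≤ k) (hl : 1 ≤ l) (hr : 1 ≤ r)
    (τ : Fin k → (Fˣ →* ℂˣ)) (hτ : ∀ i, ∀ u : Fˣ, ‖(u : F)‖ = 1 → τ i u = 1) :
    ∃ R : ℝ, ∀ (ψ : AddChar F Circle), Continuous ψ → ψ ≠ 1 →
      ∀ (μ : Measure F) [μ.IsAddHaarMeasure],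
      -- the identity in the domain of absolute convergence, which contains a cone
      (KC.cone k R ⊆ KC.convergenceDomain (l + r) τ ψ μ ∧
        ∀ ζ ∈ KC.convergenceDomain (l + r) τ ψ μ, ∀ f ∈ KC.rhoSpace (l + r) τ ζ,
          (∀ g, Integrable (fun z => f ((KC.kappa k l r)⁻¹ * KC.zElt z * g))
            (KC.coordMeasure μ k l r)) ∧
          KC.mIntegral μ f ∈ KC.twoStepSpace l r τ ζ ∧
          (∀ g, Integrable
            (fun u : KC.Coord k l l F × KC.Coord k r r F =>
              KC.mIntegral μ f
                (KC.diagGL (KC.weyl k l * KC.unip u.1) (KC.weyl k r * KC.unip u.2) * g) *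
              (((KC.psiV ψ u.1)⁻¹ : Circle) : ℂ) * (((KC.psiV ψ u.2)⁻¹ : Circle) : ℂ))
            ((KC.coordMeasure μ k l l).prod (KC.coordMeasure μ k r r))) ∧
          Integrable
            (fun v => KC.applyFactors (KC.jacquetIntegral ψ μ) (KC.jacquetIntegral ψ μ)
              (KC.mIntegral μ f) (KC.kappa k l r * KC.vThree v)) (KC.coordMeasure μ k r l) ∧
          KC.jacquetIntegral ψ μ f =
            ∫ v, KC.applyFactors (KC.jacquetIntegral ψ μ) (KC.jacquetIntegral ψ μ)
              (KC.mIntegral μ f) (KC.kappa k l r * KC.vThree v) ∂(KC.coordMeasure μ k r l)) ∧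
      -- the identity in general, by meromorphic continuation
      ∃ (lam : (Fin k → ℂ) → (GL (Fin (k * (l + r))) F → ℂ) →ₗ[ℂ] ℂ)
        (lam₁ : (Fin k → ℂ) → (GL (Fin (k * l)) F → ℂ) →ₗ[ℂ] ℂ)
        (lam₂ : (Fin k → ℂ) → (GL (Fin (k * r)) F → ℂ) →ₗ[ℂ] ℂ),
        KC.IsJacquetContinuation (l + r) τ ψ μ R lam ∧
        KC.IsJacquetContinuation l τ ψ μ R lam₁ ∧
        KC.IsJacquetContinuation r τ ψ μ R lam₂ ∧
        ∀ ξ : (Fin k → ℂ) → GL (Fin (k * (l + r))) F → ℂ, KC.IsMeromorphicSection (l + r) τ ξ →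
          ∃ (M : (Fin k → ℂ) → GL (Fin (k * (l + r))) F → ℂ) (D : (Fin k → ℂ) → ℂ),
            D ∈ KC.entireFun F k ∧ D ≠ 0 ∧
            (∀ g, (fun ζ => D ζ * M ζ g) ∈ KC.entireFun F k) ∧
            (∀ ζ, D ζ ≠ 0 → ξ ζ ∈ KC.rhoSpace (l + r) τ ζ) ∧
            (∀ ζ ∈ KC.cone k R, D ζ ≠ 0 → M ζ = KC.mIntegral μ (ξ ζ)) ∧
            ∀ ζ, D ζ ≠ 0 →
              M ζ ∈ KC.twoStepSpace l r τ ζ ∧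
              Integrable
                (fun v => KC.applyFactors (lam₁ ζ) (lam₂ ζ) (M ζ) (KC.kappa k l r * KC.vThree v))
                (KC.coordMeasure μ k r l) ∧
              lam ζ (ξ ζ) =
                ∫ v, KC.applyFactors (lam₁ ζ) (lam₂ ζ) (M ζ) (KC.kappa k l r * KC.vThree v)
                  ∂(KC.coordMeasure μ k r l) := by
  have : ProperSpace F := ProperSpace.of_locallyCompactSpace F
  obtain ⟨R, -, hRc⟩ := KC.exists_convergence_cone (k := k) hF (l + r) hτ
  obtain ⟨R₁, -, hRl⟩ := KC.exists_convergence_cone (k := k) hF l hτ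
  obtain ⟨R₂, -, hRr⟩ := KC.exists_convergence_cone (k := k) hF r hτ
  obtain ⟨R₃, -, hRm⟩ := KC.exists_mIntegral_continuation (k := k) hF l r hτ
  have hle : ∀ S ∈ ({R, R₁, R₂, R₃} : Set ℝ), KC.cone k (max (max R R₁) (max R₂ R₃)) ⊆ KC.cone k S := by
    intro S hS
    refine KC.cone_mono ?_
    rcases hS with rfl | rfl | rfl | rfl <;> simp
  refine ⟨max (max R R₁) (max R₂ R₃), fun ψ hψ hψ1 μ _ => ?_⟩
  have hc := (hle R (by simp)).trans (hRc ψ hψ μ)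
  have hc₁ := (hle R₁ (by simp)).trans (hRl ψ hψ μ)
  have hc₂ := (hle R₂ (by simp)).trans (hRr ψ hψ μ)
  refine ⟨⟨hc, fun ζ hζ f hf => ⟨KC.integrable_mIntegrand μ hF hψ hζ hf,
    KC.mIntegral_mem_twoStepSpace μ hF hk hf, KC.integrable_mIntegral_diagGL μ hF hψ hζ hf,
    KC.integrable_applyFactors_mIntegral μ hF hψ hζ hf⟩⟩, ?_⟩
  obtain ⟨Λ, hΛ, hJ⟩ := KC.exists_jacquetFunctional (k := k) (c := l + r) μ hF hτ hψ hψ1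
  obtain ⟨Λ₁, hΛ₁, hJ₁⟩ := KC.exists_jacquetFunctional (k := k) (c := l) μ hF hτ hψ hψ1
  obtain ⟨Λ₂, hΛ₂, hJ₂⟩ := KC.exists_jacquetFunctional (k := k) (c := r) μ hF hτ hψ hψ1
  -- The continued functionals are constant in `ζ`: the dependence on `ζ` lies entirely in the
  -- function to which they are applied.
  refine ⟨fun _ => Λ, fun _ => Λ₁, fun _ => Λ₂,
    ⟨hc, fun ζ hζ => hJ ζ (hc hζ), fun ξ hξ => KC.IsLocallyFinite.mem_entireFun hΛ hξ⟩,
    ⟨hc₁, fun ζ hζ => hJ₁ ζ (hc₁ hζ), fun ξ hξ => KC.IsLocallyFinite.mem_entireFun hΛ₁ hξ⟩,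
    ⟨hc₂, fun ζ hζ => hJ₂ ζ (hc₂ hζ), fun ξ hξ => KC.IsLocallyFinite.mem_entireFun hΛ₂ hξ⟩,
    fun ξ hξ => ?_⟩
  refine KC.meromorphicSection_identity μ hF hk hψ hψ1 hc hΛ hΛ₁ hΛ₂ (fun ζ hζ => hJ ζ (hc hζ))
    (fun ζ hζ => hJ₁ ζ (hc₁ hζ)) (fun ζ hζ => hJ₂ ζ (hc₂ hζ)) (fun ξ' hξ' => ?_) hξ
  obtain ⟨D, hD, hD0, N, hN, h⟩ := hRm μ ξ' hξ'
  exact ⟨D, hD, hD0, N, hN, fun ζ hζ => h ζ (hle R₃ (by simp) hζ)⟩
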